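/- **Model.** Time is $[0,\infty)$. A time-varying graph (TVG) $\mathcal G$ consists of a finite set $V$ of nodes with unique identifiers and of undirected edges (no loops or multiple edges), each of which is present at some dates and absent at others. The dates of presence of an edge form a union of pairwise disjoint closed intervals of length at least $\zeta$ (possibly unbounded to the right), where $\zeta>0$ is a constant, the crossing delay, known to the nodes. A message sent at date $s$ over an edge arrives at $s+\zeta$ if the edge is present during the whole of $[s,s+\zeta]$, and is lost otherwise. The footprint is the static graph on $V$ whose edges are the pairs that are in contact at some date; it is assumed to be connected. A journey from $u$ to $v$ is a walk $e_1,\dots,e_h$ $(h\ge 1)$ from $u$ to $v$ in the footprint with dates $t_1,\dots,t_h$ such that $t_{i+1}\ge t_i+\zeta$ and $e_i$ is present during $[t_i,t_i+\zeta]$; its departure is $t_1$, its arrival $t_h+\zeta$, and $h$ is its number of hops. **Classes and knowledge.** $\mathcal R$ is the class of TVGs with connected footprint in which no edge disappears for ever. $\mathcal B\subset\mathcal R$ consists of those that have a recurrence bound, i.e. some $\Delta>0$ such that every edge appears for the first time by date $\Delta$ and, after each of its appearances, stays present for ever or appears again within time $\Delta$ (an edge present at date $0$ counts as appearing then). $\mathcal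 P\subset\mathcal B$ consists of those for which there is $p>0$ such that every edge is present at $t$ if and only if it is present at $t+p$, for all $t\ge 0$. An index indicates what all nodes know: $n=|V|$, a recurrence bound $\Delta$, or such a $p$. Let $$\mathcal U=\{\mathcal R_n,\ \mathcal B_n,\ \mathcal B_\Delta,\ \mathcal B_{\{n,\Delta\}},\ \mathcal P_n,\ \mathcal P_\Delta,\ \mathcal P_{\{n,\Delta\}},\ \mathcal P_p\}.$$ **Protocols.** All nodes run the same deterministic protocol. What a node sends at a date is a function of its view: its identifier, the given knowledge, the current date, the presence of its incident edges and the messages received up to now, and, at the emitter from the emission date on, that date. Only finitely many messages are sent in bounded time. A message may carry the information to be broadcast, which only a node that already has the information can send, or be a control message. **Broadcast with termination detection (TDB).** Some information is created at the emitter $x\in V$ at date $\tau$. Every node must receive it, and afterwards, at a finite date, $x$ must enter a terminal state. The broadcast takes place along a tree $T$ rooted at $x$ if the first reception of the information by each node $v\neq x$ is (possibly among other simultaneous ones) from its parent in $T$. The broadcast is * *foremost*, if each $v\ne x$ first receives the information at the earliest arrival date of a journey from $x$ to $v$ departing at or after $\tau$; * *shortest*, if the depth of each $v\neq x$ in $T$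 is the least number of hops of a journey from $x$ to $v$ departing at or after $\tau$; * *fastest*, if the time from the first emission of the information to the date at which the last node is reached is the least $d\ge0$ for which there is $a\ge\tau$ such that journeys departing at or after $a$ and arriving by $a+d$ lead from $x$ to all other nodes (in particular this minimum has to exist). **Reusability.** Fix $k\in\{1,2,\dots\}\cup\{\infty\}$. Broadcast trees for $\mathrm{TDB}[m]$, $m\in\{\text{shortest},\text{foremost},\text{fastest}\}$, are *reusable* in $\mathcal C_K\in\mathcal U$ if there is a single protocol which, on every $\mathcal G\in\mathcal C$ with every correct value of the knowledge $K$, for every emitter $x$ and every emission date $t_0\ge0$, performs an $m$-optimal TDB of information created at $t_0$, along some tree $T$, and then $k$ further $m$-optimal TDBs from $x$ along the same tree $T$, in which the information is only sent from parents to children of $T$. Each of these is started at a date that the emitter determines from its view, after it has detected termination of the previous one; its information is created at that date. Write $P_1\le_{\mathcal U}P_2$ if trees for $P_1$ are reusable in every $\mathcal C_K\in\mathcal U$ in which trees for $P_2$ are reusable; $P_1<_{\mathcal U}P_2$ if moreover there is $\mathcal C_K\in\mathcal U$ in which trees for $P_1$ are reusable but trees for $P_2$ are not; and $P_1\equiv_{\mathcal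 U}P_2$ if $P_1\le_{\mathcal U}P_2$ and $P_2\le_{\mathcal U}P_1$. **Theorem.** For every $\zeta>0$ and every $k\in\{1,2,\dots\}\cup\{\infty\}$, $$\mathrm{TDB}[\text{shortest}]\;<_{\mathcal U}\;\mathrm{TDB}[\text{foremost}]\;\equiv_{\mathcal U}\;\mathrm{TDB}[\text{fastest}].$$ More precisely, among the elements of $\mathcal U$, shortest broadcast trees are reusable exactly in $\mathcal B_\Delta,\ \mathcal B_{\{n,\Delta\}},\ \mathcal P_\Delta,\ \mathcal P_{\{n,\Delta\}}$ and $\mathcal P_p$, while foremost broadcast trees and fastest broadcast trees are reusable exactly in $\mathcal P_p$. -/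

import Mathlib

namespace DynNet

/-! ### Time-varying graphs -/

/-- A time-varying graph with lifetime `[0, ∞)` and constant crossing delay `ζ`.  The nodes are
identified with their (unique) identifiers; `present u v t` says that the undirected edge between
`u` and `v` is present at date `t`.  The dates of presence of every edge form a union of pairwise
disjoint closed intervals (possibly unbounded to the right) of length at least `ζ`. -/
structure TVG (ζ : ℝ) where
  nodes : Finset ℕ
  present : ℕ → ℕ → ℝ → Prop
  mem_left : ∀ {u v t}, present u v t → u ∈ nodes
  symm : ∀ {u v t}, present u v t → present v u t
  loopless : ∀ u t, ¬ present u u t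
  nonneg : ∀ {u v t}, present u v t → 0 ≤ t
  intervals : ∀ u v, ∃ S : Set (Set ℝ), S.PairwiseDisjoint id ∧
    (∀ I ∈ S, (∃ a b, a + ζ ≤ b ∧ I = Set.Icc a b) ∨ ∃ a, I = Set.Ici a) ∧
    {t | present u v t} = ⋃₀ S

namespace TVG

variable {ζ : ℝ} (G : TVG ζ)

/-- `{u, v}` is an edge: there is at least one contact during the lifetime. -/
def Edge (u v : ℕ) : Prop := ∃ t, G.present u v t

/-- The footprint (underlying static graph). -/
def footprint : SimpleGraph G.nodes where
  Adj u v := G.Edge u v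
  symm := ⟨fun _ _ ⟨t, ht⟩ => ⟨t, G.symm ht⟩⟩
  loopless := ⟨fun u ⟨t, ht⟩ => G.loopless u t ht⟩

/-- A message sent at date `s` on the edge between `u` and `v` gets through: the edge is present
during the whole of `[s, s + ζ]`. -/
def Crossing (u v : ℕ) (s : ℝ) : Prop := ∀ t ∈ Set.Icc s (s + ζ), G.present u v t

/-- `G.Journey u v d a h`: there is a journey from `u` to `v` with departure date `d`, arrival
date `a` and `h` hops. -/
inductive Journey : ℕ → ℕ → ℝ → ℝ → ℕ → Prop
  | single {u v : ℕ} {s : ℝ} : G.Crossing u v s → Journey u v s (s + ζ) 1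
  | cons {u w v : ℕ} {s d a : ℝ} {h : ℕ} : G.Crossing u w s → s + ζ ≤ d →
      Journey w v d a h → Journey u v s a (h + 1)

/-- The edge between `u` and `v` appears at date `a` (an edge present at date `0` appears then). -/
def Appears (u v : ℕ) (a : ℝ) : Prop :=
  G.present u v a ∧ ∀ s < a, ∃ r, s < r ∧ r < a ∧ ¬ G.present u v r

/-- No edge disappears forever, and the footprint is connected. -/
def Recurrent : Prop :=
  G.footprint.Connected ∧
    ∀ u v, G.Edge u v → ∀ t, 0 ≤ t → ¬ G.present u v t → ∃ t', t < t' ∧ G.present u v t'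

/-- `Δ` is an upper bound on the recurrence time: every edge appears for the first time by date
`Δ`, and after each of its appearances it either stays for ever or appears again within `Δ`. -/
def RecurrenceBound (Δ : ℝ) : Prop :=
  0 < Δ ∧ ∀ u v, G.Edge u v → (∃ a, a ≤ Δ ∧ G.Appears u v a) ∧
    ∀ a, G.Appears u v a →
      (∀ t, a ≤ t → G.present u v t) ∨ ∃ a', a < a' ∧ a' ≤ a + Δ ∧ G.Appears u v a'

/-- The presence of every edge repeats with period `p`. -/
def IsPeriod (p : ℝ) : Prop :=
  0 < p ∧ ∀ u v t, 0 ≤ t → (G.present u v t ↔ G.present u v (t + p))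

/-- Recurrent time-varying graphs with connected footprint. -/
def ClassR : Prop := G.Recurrent

/-- Time-bounded recurrent time-varying graphs with connected footprint. -/
def ClassB : Prop := G.Recurrent ∧ ∃ Δ, G.RecurrenceBound Δ

/-- Periodic time-varying graphs with connected footprint. -/
def ClassP : Prop := G.footprint.Connected ∧ ∃ p, G.IsPeriod p

end TVG

/-! ### Classes with knowledge -/

/-- What the nodes know about the graph. -/
inductive Knowledge
  | size (n : ℕ)
  | bound (Δ : ℝ)
  | sizeBound (n : ℕ) (Δ : ℝ)
  | period (p : ℝ)

/-- The eight combinations of a class and a type of knowledge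
(`R_n, B_n, B_Δ, B_{n,Δ}, P_n, P_Δ, P_{n,Δ}, P_p`). -/
inductive Context
  | Rn | Bn | Bdelta | BnDelta | Pn | Pdelta | PnDelta | Pp

/-- The graph `G` lies in the class of the context, and `κ` is correct knowledge of the given type
about `G`. -/
def Context.Admits {ζ : ℝ} : Context → TVG ζ → Knowledge → Prop
  | .Rn, G, κ => G.ClassR ∧ κ = .size G.nodes.card
  | .Bn, G, κ => G.ClassB ∧ κ = .size G.nodes.card
  | .Bdelta, G, κ => G.ClassB ∧ ∃ Δ, G.RecurrenceBound Δ ∧ κ = .bound Δ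
  | .BnDelta, G, κ => G.ClassB ∧ ∃ Δ, G.RecurrenceBound Δ ∧ κ = .sizeBound G.nodes.card Δ
  | .Pn, G, κ => G.ClassP ∧ κ = .size G.nodes.card
  | .Pdelta, G, κ => G.ClassP ∧ ∃ Δ, G.RecurrenceBound Δ ∧ κ = .bound Δ
  | .PnDelta, G, κ => G.ClassP ∧ ∃ Δ, G.RecurrenceBound Δ ∧ κ = .sizeBound G.nodes.card Δ
  | .Pp, G, κ => G.ClassP ∧ ∃ p, G.IsPeriod p ∧ κ = .period p

/-- The universe of all classes with knowledge. -/
def universeU : Set Context := Set.univ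

/-! ### Distributed protocols and their runs -/

/-- A message: if `info = some j` it is an information message that carries the `j`-th piece of
information, if `info = none` it is a control message; `body` is additional content. -/
structure Packet (M : Type) where
  info : Option ℕ
  body : M

/-- Everything that a node has locally seen up to the current date `now`: its identifier, the
common knowledge, the emission date if it is the emitter and the emission date has come, the
dates at which the edge to a node `w` was present, and the message that arrived from `w` at
date `s`. -/
structure View (M : Type) where
  id : ℕ
  know : Knowledge
  now : ℝ
  emission : Option ℝ
  presence : ℕ → ℝ → Prop
  received : ℕ → ℝ → Option (Packet M)

/-- A deterministic protocol, run by every node.  Depending on the view of the node at the current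
date, `send` is what it sends now to each potential neighbour, `begins j` says that (as the
emitter) it creates the `j`-th information now (`j ≥ 1`), and `terminated j` that (as the emitter)
it is in the terminal state for the `j`-th broadcast. -/
structure Protocol where
  Msg : Type
  send : View Msg → ℕ → Option (Packet Msg)
  begins : View Msg → ℕ → Prop
  terminated : View Msg → ℕ → Prop

section Run

variable {ζ : ℝ} (G : TVG ζ) {M : Type}

open Classical in
/-- Given that `σ w v s` is what `w` sends to `v` at date `s`, the message that arrives at `v` from
`w` at date `s`: the one sent at `s - ζ`, which is lost unless the edge was present throughout. -/
noncomputable def arrival (σ : ℕ → ℕ → ℝ → Option (Packet M)) (w v : ℕ) (s : ℝ) :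
    Option (Packet M) :=
  if G.Crossing w v (s - ζ) then σ w v (s - ζ) else none

open Classical in
/-- The view of node `v` at date `t` when `x` is the emitter, `t₀` the emission date, and messages
are sent as described by `σ`. -/
noncomputable def view (κ : Knowledge) (x : ℕ) (t₀ : ℝ) (σ : ℕ → ℕ → ℝ → Option (Packet M))
    (v : ℕ) (t : ℝ) : View M where
  id := v
  know := κ
  now := t
  emission := if v = x ∧ t₀ ≤ t then some t₀ else none
  presence w s := s ≤ t ∧ G.present v w s
  received w s := if s ≤ t then arrival G σ w v s else none

/-- What the nodes send in reaction to the messages sent according to `σ`. -/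
noncomputable def react (A : Protocol) (κ : Knowledge) (x : ℕ) (t₀ : ℝ)
    (σ : ℕ → ℕ → ℝ → Option (Packet A.Msg)) : ℕ → ℕ → ℝ → Option (Packet A.Msg) :=
  fun v w t => A.send (view G κ x t₀ σ v t) w

/-- The run of the protocol: `run G A κ x t₀ v w t` is what `v` sends to `w` at date `t`.
As messages need time `ζ > 0`, what is sent at date `t` is settled after `⌊t/ζ⌋ + 1` rounds; the
run is the solution of the equation of `run_eq`. -/
noncomputable def run (A : Protocol) (κ : Knowledge) (x : ℕ) (t₀ : ℝ) :
    ℕ → ℕ → ℝ → Option (Packet A.Msg) :=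
  fun v w t => ((react G A κ x t₀)^[⌊t / ζ⌋₊ + 1] fun _ _ _ => none) v w t

theorem view_congr (κ : Knowledge) (x : ℕ) (t₀ : ℝ) {σ τ : ℕ → ℕ → ℝ → Option (Packet M)} (v : ℕ)
    (t : ℝ) (hζ : 0 < ζ) (h : ∀ v w s, 0 ≤ s → s ≤ t - ζ → σ v w s = τ v w s) :
    view G κ x t₀ σ v t = view G κ x t₀ τ v t := by
  unfold view arrival
  congr 1
  funext w s
  split_ifs with h1 h2
  · exact h w v (s - ζ) (G.nonneg (h2 _ ⟨le_rfl, by linarith⟩)) (by linarith)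
  · rfl
  · rfl

theorem iterate_stable (A : Protocol) (κ : Knowledge) (x : ℕ) (t₀ : ℝ) (hζ : 0 < ζ) (m : ℕ) :
    ∀ k, m ≤ k → ∀ v w t, ⌊t / ζ⌋₊ < m →
      ((react G A κ x t₀)^[k] fun _ _ _ => none) v w t =
        ((react G A κ x t₀)^[m] fun _ _ _ => none) v w t := by
  induction m with
  | zero => intro k _ v w t h; exact absurd h (Nat.not_lt_zero _)
  | succ m ih =>
    intro k hk v w t ht
    obtain ⟨k, rfl⟩ : ∃ k', k = k' + 1 := ⟨k - 1, by omega⟩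
    rw [Function.iterate_succ_apply', Function.iterate_succ_apply']
    unfold react
    rw [view_congr G κ x t₀ v t hζ]
    intro v w s hs hst
    refine ih k (by omega) v w s ?_
    have h1 : s / ζ + 1 ≤ t / ζ := by
      rw [div_add_one hζ.ne']
      exact div_le_div_of_nonneg_right (by linarith) hζ.le
    have h2 : ⌊s / ζ⌋₊ + 1 ≤ ⌊t / ζ⌋₊ := by
      rw [← Nat.floor_add_one (div_nonneg hs hζ.le)]
      exact Nat.floor_mono h1
    omega

/-- In the run every node sends, at every date, what the protocol prescribes for its view. -/
theorem run_eq (A : Protocol) (κ : Knowledge) (x : ℕ) (t₀ : ℝ) (hζ : 0 < ζ) (v w : ℕ) (t : ℝ) :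
    run G A κ x t₀ v w t = A.send (view G κ x t₀ (run G A κ x t₀) v t) w := by
  have h : view G κ x t₀ (run G A κ x t₀) v t =
      view G κ x t₀ ((react G A κ x t₀)^[⌊t / ζ⌋₊] fun _ _ _ => none) v t := by
    refine view_congr G κ x t₀ v t hζ fun v w s hs hst => ?_
    have h1 : s / ζ + 1 ≤ t / ζ := by
      rw [div_add_one hζ.ne']
      exact div_le_div_of_nonneg_right (by linarith) hζ.le
    have h2 : ⌊s / ζ⌋₊ + 1 ≤ ⌊t / ζ⌋₊ := by
      rw [← Nat.floor_add_one (div_nonneg hs hζ.le)]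
      exact Nat.floor_mono h1
    exact (iterate_stable G A κ x t₀ hζ _ _ h2 v w s (Nat.lt_succ_self _)).symm
  rw [h]
  unfold run
  rw [Function.iterate_succ_apply']
  rfl

/-! ### Broadcast with termination detection -/

/-- `v` sends the `j`-th information to `w` at date `s` (possibly in vain). -/
def SendsInfo (σ : ℕ → ℕ → ℝ → Option (Packet M)) (j v w : ℕ) (s : ℝ) : Prop :=
  ∃ b, σ v w s = some ⟨some j, b⟩

/-- The `j`-th information arrives at `v` from `w` at date `r`. -/
def Delivers (σ : ℕ → ℕ → ℝ → Option (Packet M)) (j w v : ℕ) (r : ℝ) : Prop :=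
  ∃ b, arrival G σ w v r = some ⟨some j, b⟩

/-- Date `r` is the first reception of the `j`-th information by `v`. -/
def FirstReception (σ : ℕ → ℕ → ℝ → Option (Packet M)) (j v : ℕ) (r : ℝ) : Prop :=
  IsLeast {r | ∃ w, Delivers G σ j w v r} r

/-- The `j`-th information, created at the emitter `x` at date `τ`, is broadcast along the tree
rooted at `x` in which the parent of every other node `v` is `T v`, and all nodes have it by the
date `φ`.  Only nodes that have the information send it. -/
structure IsBroadcast (σ : ℕ → ℕ → ℝ → Option (Packet M)) (x j : ℕ) (τ φ : ℝ) (T : ℕ → ℕ) :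
    Prop where
  le : τ ≤ φ
  causal : ∀ v ∈ G.nodes, ∀ w s, SendsInfo σ j v w s →
    (v = x ∧ τ ≤ s) ∨ ∃ u r, r ≤ s ∧ Delivers G σ j u v r
  root : T x = x
  tree : ∀ v ∈ G.nodes, v ≠ x → ∃ r, r ≤ φ ∧ FirstReception G σ j v r ∧ Delivers G σ j (T v) v r

/-- The three objectives. -/
inductive Objective
  | foremost | shortest | fastest

/-- The durations `d` for which there is a date `a ≥ τ` such that journeys from `x` can reach all
nodes during `[a, a + d]`. -/
def broadcastDurations (x : ℕ) (τ : ℝ) : Set ℝ :=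
  {d | 0 ≤ d ∧ ∃ a, τ ≤ a ∧ ∀ v ∈ G.nodes, v ≠ x →
    ∃ dep arr h, G.Journey x v dep arr h ∧ a ≤ dep ∧ arr ≤ a + d}

/-- Optimality of the `j`-th broadcast, from `x`, created at date `τ`, along the tree `T`.
* foremost: every node receives the information at the earliest possible date;
* shortest: every node receives it within the least possible number of hops;
* fastest: the time from the first emission to the last node being reached is the least possible,
  over all departures not before `τ`. -/
def Optimal (σ : ℕ → ℕ → ℝ → Option (Packet M)) (x j : ℕ) (τ : ℝ) (T : ℕ → ℕ) :
    Objective → Prop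
  | .foremost => ∀ v ∈ G.nodes, v ≠ x → ∃ r, FirstReception G σ j v r ∧
      IsLeast {a | ∃ d h, τ ≤ d ∧ G.Journey x v d a h} r
  | .shortest => ∀ v ∈ G.nodes, v ≠ x → ∃ h,
      IsLeast {h | ∃ d a, τ ≤ d ∧ G.Journey x v d a h} h ∧ T^[h] v = x
  | .fastest => ∃ a d, IsLeast (broadcastDurations G x τ) d ∧ τ ≤ a ∧
      (∀ v ∈ G.nodes, ∀ w s, SendsInfo σ j v w s → a ≤ s) ∧
      ∀ v ∈ G.nodes, v ≠ x → ∃ r, FirstReception G σ j v r ∧ r ≤ a + d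

end Run

/-! ### Reusability -/

/-- In the run of `A` on `G` with knowledge `κ`, emitter `x` and emission date `t₀`, the protocol
performs an optimal broadcast with termination detection at date `t₀`, and afterwards `k` further
ones (infinitely many if `k = ⊤`) that follow the same broadcast tree `T`: the `j`-th broadcast is
started by the emitter at a date `t j` that it determines from its view, after it has detected, at
the date `f (j - 1)`, the termination of the previous one, and in the broadcasts `j ≥ 1`
information is only sent from parents to children.  In bounded time, only finitely many messages
are sent. -/
def ReusesTree {ζ : ℝ} (k : ℕ∞) (P : Objective) (A : Protocol) (G : TVG ζ) (κ : Knowledge)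
    (x : ℕ) (t₀ : ℝ) : Prop :=
  (∀ v ∈ G.nodes, ∀ t, {q : ℕ × ℝ | 0 ≤ q.2 ∧ q.2 ≤ t ∧
      run G A κ x t₀ v q.1 q.2 ≠ none}.Finite) ∧
  ∃ (T : ℕ → ℕ) (t f : ℕ → ℝ), t 0 = t₀ ∧
    ∀ j : ℕ, (j : ℕ∞) ≤ k →
      IsBroadcast G (run G A κ x t₀) x j (t j) (f j) T ∧
      Optimal G (run G A κ x t₀) x j (t j) T P ∧
      IsLeast {s | t j ≤ s ∧ A.terminated (view G κ x t₀ (run G A κ x t₀) x s) j} (f j) ∧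
      (1 ≤ j →
        f (j - 1) < t j ∧
        IsLeast {s | t₀ ≤ s ∧ A.begins (view G κ x t₀ (run G A κ x t₀) x s) j} (t j) ∧
        ∀ v ∈ G.nodes, ∀ w s, SendsInfo (run G A κ x t₀) j v w s →
          w ∈ G.nodes ∧ w ≠ x ∧ T w = v)

/-- Broadcast trees for the objective `P` are reusable (`k` times) in the given class of
time-varying graphs with the given type of knowledge: a single protocol reuses its tree on every
graph of the class, for every correct value of the knowledge, every emitter and every emission
date. -/
def Reusable (ζ : ℝ) (k : ℕ∞) (P : Objective) (c : Context) : Prop :=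
  ∃ A : Protocol, ∀ (G : TVG ζ) (κ : Knowledge), c.Admits G κ →
    ∀ x ∈ G.nodes, ∀ t₀ : ℝ, 0 ≤ t₀ → ReusesTree k P A G κ x t₀

/-- `P₁ ≤_L P₂`: wherever in `L` trees for `P₂` are reusable, so are trees for `P₁`. -/
def ReuseLE (ζ : ℝ) (k : ℕ∞) (L : Set Context) (P₁ P₂ : Objective) : Prop :=
  ∀ c ∈ L, Reusable ζ k P₂ c → Reusable ζ k P₁ c

/-- `P₁ <_L P₂`. -/
def ReuseLT (ζ : ℝ) (k : ℕ∞) (L : Set Context) (P₁ P₂ : Objective) : Prop :=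
  ReuseLE ζ k L P₁ P₂ ∧ ∃ c ∈ L, Reusable ζ k P₁ c ∧ ¬ Reusable ζ k P₂ c

/-- `P₁ ≡_L P₂`. -/
def ReuseEquiv (ζ : ℝ) (k : ℕ∞) (L : Set Context) (P₁ P₂ : Objective) : Prop :=
  ReuseLE ζ k L P₁ P₂ ∧ ReuseLE ζ k L P₂ P₁

end DynNet

namespace DynNet

open Set

/-! Possibility. If a recurrence bound (in particular a period) `Δ` is known, every edge has been
seen by date `Δ`. Each node then reports its incident contacts up to `Δ`, and the reports are
flooded in control messages. The emitter notices when it has them all: in a connected graph a set of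
reports that includes its own and is closed under the neighbours named in it is complete
(`complete_iff`). It then knows the footprint and, if `Δ` is a period, the whole schedule.

From this it computes a tree: a breadth-first tree of the footprint (shortest), a tree of earliest
arrivals from `t₀` (foremost), or one from the start of a shortest possible window (fastest). That
such arrivals and windows exist is a compactness argument (`exists_foremost`,
`IsPeriod.exists_fastest`). Breadth-first trees stay optimal for ever because every edge recurs. The
other two are optimal again after any multiple of the period, so releases are spaced by multiples of
`Δ` that exceed the duration of a broadcast, and termination is detected by waiting. Only the first
foremost broadcast cannot wait for the reports. It is flooded at once; flooding reaches every node
at its earliest arrival date, also along the tree computed later. `Propagates.foremost` and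
`Propagates.shortest` treat the spreading, and `reusesTree_treeProtocol` combines everything.

Impossibility. Up to a date at which the emitter commits itself, it cannot distinguish two periodic
graphs that agree until then (`view_run_eq_of_agree`). On three nodes, `deviating` copies `regular`
up to that date `τ`, and then lets the edges from `0` to `1` and `2` appear simultaneously. If only
the size is known, a new edge can thus show up after termination and spoil a shortest tree. Even
with size and recurrence bound known, a faster window can show up after termination, and after the
start of the second broadcast a direct contact can beat the foremost tree fixed by the first one.
Coarsening the knowledge (`Reusable.to_Pn`, `Reusable.to_PnDelta`) carries these three
counterexamples to all remaining contexts. -/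

/-- A set of nonnegative reals whose points are pairwise at distance at least `ζ` has only finitely
many elements below any bound. -/
theorem finite_of_separated {ζ : ℝ} (hζ : 0 < ζ) {A : Set ℝ} (h0 : ∀ a ∈ A, 0 ≤ a)
    (hsep : ∀ a ∈ A, ∀ b ∈ A, a < b → a + ζ ≤ b) (t : ℝ) : {a | a ∈ A ∧ a ≤ t}.Finite := by
  refine Set.Finite.of_finite_image (f := fun a => ⌊a / ζ⌋₊)
    ((Set.finite_Iic ⌊t / ζ⌋₊).subset ?_) ?_
  · rintro _ ⟨a, ⟨-, hat⟩, rfl⟩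
    exact Nat.floor_mono (div_le_div_of_nonneg_right hat hζ.le)
  · have key : ∀ a ∈ A, ∀ b ∈ A, ⌊a / ζ⌋₊ = ⌊b / ζ⌋₊ → ¬ a < b := by
      intro a ha b hb hab hlt
      have h1 : a / ζ + 1 ≤ b / ζ := by
        rw [div_add_one hζ.ne']
        exact div_le_div_of_nonneg_right (hsep a ha b hb hlt) hζ.le
      have h2 : ⌊a / ζ⌋₊ + 1 ≤ ⌊b / ζ⌋₊ := by
        rw [← Nat.floor_add_one (div_nonneg (h0 a ha) hζ.le)]
        exact Nat.floor_mono h1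
      omega
    intro a ha b hb hab
    rcases lt_trichotomy a b with h | h | h
    · exact absurd h (key a ha.1 b hb.1 hab)
    · exact h
    · exact absurd h (key b hb.1 a ha.1 hab.symm)

/-- Strong induction along dates, in steps of `ζ`. -/
theorem date_induction {ζ : ℝ} (hζ : 0 < ζ) {p : ℝ → Prop}
    (h : ∀ t, (∀ s, 0 ≤ s → s ≤ t - ζ → p s) → p t) (t : ℝ) : p t := by
  have key : ∀ n : ℕ, ∀ t, t < n * ζ → p t := by
    intro n
    induction n with
    | zero =>
      intro t ht
      refine h t fun s hs hst => ?_
      simp at ht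
      linarith
    | succ n ih =>
      intro t ht
      refine h t fun s _ hst => ih s ?_
      push_cast at ht
      linarith
  obtain ⟨n, hn⟩ := exists_nat_gt (t / ζ)
  exact key n t (by rwa [div_lt_iff₀ hζ] at hn)

/-! ### Appearances, recurrence bounds and periods -/

namespace TVG

variable {ζ : ℝ} {G : TVG ζ} {u v w : ℕ}

theorem ext' {G H : TVG ζ} (h1 : G.nodes = H.nodes) (h2 : G.present = H.present) : G = H := by
  cases G; cases H; simp at h1 h2; subst h1; subst h2; rfl

theorem mem_right {t : ℝ} (h : G.present u v t) : v ∈ G.nodes := G.mem_left (G.symm h)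

theorem Edge.symm (h : G.Edge u v) : G.Edge v u := let ⟨t, ht⟩ := h; ⟨t, G.symm ht⟩

theorem Edge.mem_left (h : G.Edge u v) : u ∈ G.nodes := let ⟨_, ht⟩ := h; G.mem_left ht

theorem Edge.mem_right (h : G.Edge u v) : v ∈ G.nodes := h.symm.mem_left

theorem Crossing.present_left (hζ : 0 < ζ) {s : ℝ} (h : G.Crossing u v s) : G.present u v s :=
  h s ⟨le_rfl, by linarith⟩

theorem Crossing.edge (hζ : 0 < ζ) {s : ℝ} (h : G.Crossing u v s) : G.Edge u v :=
  ⟨s, h.present_left hζ⟩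

theorem Crossing.nonneg (hζ : 0 < ζ) {s : ℝ} (h : G.Crossing u v s) : 0 ≤ s :=
  G.nonneg (h.present_left hζ)

/-- Every date of presence follows an appearance without interruption. -/
theorem exists_appears_le (hζ : 0 < ζ) {t : ℝ} (h : G.present u v t) :
    ∃ a, a ≤ t ∧ G.Appears u v a ∧ ∀ s, a ≤ s → s ≤ t → G.present u v s := by
  obtain ⟨S, hS, hI, hP⟩ := G.intervals u v
  have hmem : ∀ s, G.present u v s ↔ ∃ I ∈ S, s ∈ I := fun s => by
    have := Set.ext_iff.1 hP s
    simpa using this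
  have hform : ∀ I ∈ S, ∀ s ∈ I, ∃ a, a ∈ I ∧ a ≤ s ∧ (∀ r ∈ I, a ≤ r) ∧
      (∀ r, a ≤ r → r ≤ a + ζ → r ∈ I) ∧ ∀ r, a ≤ r → r ≤ s → r ∈ I := by
    intro I hIS s hs
    rcases hI I hIS with ⟨a, b, hab, rfl⟩ | ⟨a, rfl⟩
    · exact ⟨a, ⟨le_rfl, by linarith⟩, hs.1, fun r hr => hr.1,
        fun r h1 h2 => ⟨h1, by linarith⟩, fun r h1 h2 => ⟨h1, h2.trans hs.2⟩⟩
    · exact ⟨a, le_refl a, hs, fun r hr => hr, fun r h1 _ => h1, fun r h1 _ => h1⟩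
  obtain ⟨I, hIS, htI⟩ := (hmem t).1 h
  obtain ⟨a, haI, hat, hmin, hlen, hint⟩ := hform I hIS t htI
  refine ⟨a, hat, ⟨(hmem a).2 ⟨I, hIS, haI⟩, ?_⟩, fun s h1 h2 => (hmem s).2 ⟨I, hIS, hint s h1 h2⟩⟩
  intro s hs
  by_contra hcon
  push Not at hcon
  have disj : ∀ J ∈ S, ∀ r ∈ J, r < a → ∀ r' ∈ J, r' < a := by
    intro J hJ r hr hra r' hr'
    by_contra hge
    push Not at hge
    have hne : J ≠ I := by
      rintro rfl
      exact absurd (hmin r hr) (not_le.2 hra)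
    have hJI := hS hJ hIS hne
    rcases hI J hJ with ⟨c, d, hcd, rfl⟩ | ⟨c, rfl⟩
    · exact Set.disjoint_left.1 hJI (⟨hr.1.trans hra.le, hge.trans hr'.2⟩ : a ∈ Set.Icc c d) haI
    · exact Set.disjoint_left.1 hJI (le_trans hr hra.le : a ∈ Set.Ici c) haI
  -- An interval that meets `(r₀, a)` ends before `a` and is at least `ζ` long, so it begins before
  -- `r₀`. If the edge were present throughout `(s, a)`, the interval covering a date after the end
  -- `d` of `J` would therefore contain `d` as well, against disjointness.
  set r₀ := max s (a - ζ) with hr₀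
  have hr₀a : r₀ < a := max_lt hs (by linarith)
  obtain ⟨J, hJ, hrJ⟩ := (hmem ((r₀ + a) / 2)).1
    (hcon _ (by have := le_max_left s (a - ζ); linarith) (by linarith))
  obtain ⟨c, hcJ, hcr, -, hclen, -⟩ := hform J hJ _ hrJ
  have hζJ : c + ζ < a := disj J hJ _ hrJ (by linarith) _ (hclen _ (by linarith) le_rfl)
  rcases hI J hJ with ⟨c', d, hcd, rfl⟩ | ⟨c', rfl⟩
  · have hda : d < a := disj _ hJ _ hrJ (by linarith) d ⟨by linarith, le_rfl⟩
    have hrd : (r₀ + a) / 2 ≤ d := hrJ.2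
    obtain ⟨K, hK, hdK⟩ := (hmem ((d + a) / 2)).1
      (hcon _ (by have := le_max_left s (a - ζ); linarith) (by linarith))
    obtain ⟨e, heK, hed, -, helen, -⟩ := hform K hK _ hdK
    have heζ : e + ζ < a := disj K hK _ hdK (by linarith) _ (helen _ (by linarith) le_rfl)
    have hne : Set.Icc c' d ≠ K := by
      rintro rfl
      have := hdK.2
      linarith
    have hd2 := Set.disjoint_left.1 (hS hJ hK hne)
    have hge : a - ζ ≤ r₀ := le_max_right _ _
    refine hd2 (a := d) ⟨by linarith, le_rfl⟩ ?_
    rcases hI K hK with ⟨c2, d2, h2, rfl⟩ | ⟨c2, rfl⟩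
    · exact ⟨by have := heK.1; linarith, by have := hdK.2; linarith⟩
    · exact (le_trans heK (by linarith) : c2 ≤ d)
  · exact absurd (disj _ hJ _ hrJ (by linarith) a (le_trans hrJ (by linarith) : c' ≤ a)) (lt_irrefl a)

/-- An edge that appears stays at least for the crossing delay. -/
theorem Appears.crossing {a : ℝ} (h : G.Appears u v a) : G.Crossing u v a := by
  obtain ⟨S, hS, hI, hP⟩ := G.intervals u v
  have hmem : ∀ s, G.present u v s ↔ ∃ I ∈ S, s ∈ I := fun s => by
    have := Set.ext_iff.1 hP s
    simpa using this
  obtain ⟨I, hIS, haI⟩ := (hmem a).1 h.1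
  have key : ∀ c ≤ a, (∀ r, c < r → r < a → r ∈ I) → c = a := by
    intro c hc hr
    by_contra hne
    obtain ⟨r, h1, h2, h3⟩ := h.2 c (lt_of_le_of_ne hc hne)
    exact h3 ((hmem r).2 ⟨I, hIS, hr r h1 h2⟩)
  rcases hI I hIS with ⟨c, d, hcd, rfl⟩ | ⟨c, rfl⟩
  · have hc : c = a := key c haI.1 fun r h1 h2 => ⟨h1.le, h2.le.trans haI.2⟩
    subst hc
    exact fun t ht => (hmem t).2 ⟨_, hIS, ht.1, ht.2.trans hcd⟩
  · have hc : c = a := key c haI fun r h1 h2 => h1.le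
    subst hc
    exact fun t ht => (hmem t).2 ⟨_, hIS, ht.1⟩

theorem Appears.nonneg {a : ℝ} (h : G.Appears u v a) : 0 ≤ a := G.nonneg h.1

theorem Appears.lt {a b : ℝ} (ha : G.Appears u v a) (hb : G.Appears u v b) (hab : a < b) :
    a + ζ ≤ b := by
  by_contra hcon
  push Not at hcon
  obtain ⟨r, h1, h2, h3⟩ := hb.2 a hab
  exact h3 (ha.crossing r ⟨h1.le, by linarith⟩)

theorem finite_appears (hζ : 0 < ζ) (G : TVG ζ) (u v : ℕ) (t : ℝ) :
    {a | G.Appears u v a ∧ a ≤ t}.Finite :=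
  finite_of_separated hζ (A := {a | G.Appears u v a}) (fun _ ha => ha.nonneg)
    (fun _ ha _ hb hab => Appears.lt ha hb hab) t

theorem Crossing.exists_appears (hζ : 0 < ζ) {s : ℝ} (h : G.Crossing u v s) :
    ∃ a, a ≤ s ∧ G.Appears u v a ∧ ∀ r, a ≤ r → r ≤ s + ζ → G.present u v r := by
  obtain ⟨a, has, ha, hint⟩ := exists_appears_le hζ (h.present_left hζ)
  refine ⟨a, has, ha, fun r h1 h2 => ?_⟩
  rcases le_total r s with h3 | h3
  · exact hint r h1 h3
  · exact h r ⟨h3, h2⟩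

/-- The recurrence bound speaks of appearances only. It extends to an arbitrary date `s` by applying
it to the last appearance not after `s`, which exists because appearances are at least `ζ` apart. -/
theorem RecurrenceBound.appears_or_forever (hζ : 0 < ζ) {Δ : ℝ} (hΔ : G.RecurrenceBound Δ)
    (he : G.Edge u v) {s : ℝ} (hs : 0 ≤ s) :
    (∀ t, s ≤ t → G.present u v t) ∨ ∃ a, s < a ∧ a ≤ s + Δ ∧ G.Appears u v a := by
  obtain ⟨⟨a₀, ha₀, happ⟩, hrec⟩ := hΔ.2 u v he
  by_cases hlt : s < a₀
  · exact Or.inr ⟨a₀, hlt, by linarith, happ⟩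
  · obtain ⟨a, ⟨haa, has⟩, hmax⟩ := Set.exists_max_image _ id (finite_appears hζ G u v s)
      ⟨a₀, happ, not_lt.1 hlt⟩
    rcases hrec a haa with h | ⟨a', h1, h2, h3⟩
    · exact Or.inl fun t ht => h t (has.trans ht)
    · refine Or.inr ⟨a', ?_, by linarith, h3⟩
      by_contra hcon
      exact absurd (hmax a' ⟨h3, not_lt.1 hcon⟩) (not_le.2 h1)

theorem RecurrenceBound.exists_crossing (hζ : 0 < ζ) {Δ : ℝ} (hΔ : G.RecurrenceBound Δ)
    (he : G.Edge u v) {s : ℝ} (hs : 0 ≤ s) : ∃ r, s ≤ r ∧ r ≤ s + Δ ∧ G.Crossing u v r := by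
  rcases hΔ.appears_or_forever hζ he hs with h | ⟨a, h1, h2, h3⟩
  · exact ⟨s, le_rfl, by linarith [hΔ.1], fun t ht => h t ht.1⟩
  · exact ⟨a, h1.le, h2, h3.crossing⟩

/-- This is why reports about dates up to `Δ` suffice to know the footprint. -/
theorem RecurrenceBound.edge_iff {Δ : ℝ} (hΔ : G.RecurrenceBound Δ) :
    G.Edge u v ↔ ∃ s, s ≤ Δ ∧ G.present u v s := by
  constructor
  · intro h
    obtain ⟨a, ha, happ⟩ := (hΔ.2 u v h).1
    exact ⟨a, ha, happ.1⟩
  · rintro ⟨s, -, hs⟩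
    exact ⟨s, hs⟩

theorem IsPeriod.add_mul {p : ℝ} (hp : G.IsPeriod p) (n : ℕ) {t : ℝ} (ht : 0 ≤ t) :
    G.present u v t ↔ G.present u v (t + n * p) := by
  induction n with
  | zero => simp
  | succ n ih =>
    rw [ih, hp.2 u v _ (add_nonneg ht (mul_nonneg n.cast_nonneg hp.1.le))]
    congr! 1
    push_cast
    ring

theorem IsPeriod.nat_mul {p : ℝ} (hp : G.IsPeriod p) {n : ℕ} (hn : 0 < n) :
    G.IsPeriod (n * p) :=
  ⟨mul_pos (by exact_mod_cast hn) hp.1, fun _ _ _ ht => hp.add_mul n ht⟩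

theorem exists_sub_mul_mem {p : ℝ} (hp : 0 < p) {a t : ℝ} (hat : a ≤ t) :
    ∃ n : ℕ, a ≤ t - n * p ∧ t - n * p < a + p := by
  refine ⟨⌊(t - a) / p⌋₊, ?_, ?_⟩
  · have := Nat.floor_le (div_nonneg (sub_nonneg.2 hat) hp.le)
    rw [le_div_iff₀ hp] at this
    linarith
  · have := Nat.lt_floor_add_one ((t - a) / p)
    rw [div_lt_iff₀ hp] at this
    linarith

/-- If `a` is an appearance, `a + p` need not be one: an edge present at date `0` counts as
appearing there. But if the edge is ever absent after `a`, it is absent somewhere in `[a, a + p)`,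
so the last appearance before its presence at `a + p` comes after `a`. -/
theorem IsPeriod.recurrenceBound (hζ : 0 < ζ) {p : ℝ} (hp : G.IsPeriod p) :
    G.RecurrenceBound p := by
  refine ⟨hp.1, fun u v ⟨t, ht⟩ => ⟨?_, fun a ha => ?_⟩⟩
  · obtain ⟨n, h1, h2⟩ := exists_sub_mul_mem hp.1 (G.nonneg ht)
    have hpr : G.present u v (t - n * p) := (hp.add_mul n h1).2 (by simpa using ht)
    obtain ⟨a, hat, haa, -⟩ := exists_appears_le hζ hpr
    exact ⟨a, by linarith, haa⟩
  · by_cases hall : ∀ t, a ≤ t → G.present u v t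
    · exact Or.inl hall
    push Not at hall
    obtain ⟨t, hat, hnp⟩ := hall
    obtain ⟨n, h1, h2⟩ := exists_sub_mul_mem hp.1 hat
    have hnp' : ¬ G.present u v (t - n * p) := fun h =>
      hnp (by simpa using (hp.add_mul n (ha.nonneg.trans h1)).1 h)
    have hap : G.present u v (a + p) := (hp.2 u v a ha.nonneg).1 ha.1
    obtain ⟨b, hb, hbb, hint⟩ := exists_appears_le hζ hap
    refine Or.inr ⟨b, ?_, hb, hbb⟩
    by_contra hcon
    exact hnp' (hint _ (by linarith) h2.le)

theorem RecurrenceBound.recurrent (hζ : 0 < ζ) {Δ : ℝ} (hc : G.footprint.Connected)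
    (hΔ : G.RecurrenceBound Δ) : G.Recurrent := by
  refine ⟨hc, fun u v he t ht hnp => ?_⟩
  rcases hΔ.appears_or_forever hζ he ht with h | ⟨a, h1, h2, h3⟩
  · exact absurd (h t le_rfl) hnp
  · exact ⟨a, h1, h3.1⟩

theorem ClassP.classB (hζ : 0 < ζ) (h : G.ClassP) : G.ClassB :=
  let ⟨hc, p, hp⟩ := h
  ⟨(hp.recurrenceBound hζ).recurrent hζ hc, p, hp.recurrenceBound hζ⟩

/-- A set that contains a node and is closed under adjacency contains every node. -/
theorem mem_of_edge_closed (hc : G.footprint.Connected) {S : Set ℕ} {x : ℕ} (hx : x ∈ G.nodes)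
    (hxS : x ∈ S) (hS : ∀ u w, G.Edge u w → u ∈ S → w ∈ S) {v : ℕ} (hv : v ∈ G.nodes) :
    v ∈ S := by
  obtain ⟨p⟩ := hc.preconnected ⟨x, hx⟩ ⟨v, hv⟩
  have key : ∀ {a b : G.nodes}, G.footprint.Walk a b → a.1 ∈ S → b.1 ∈ S := by
    intro a b p
    induction p with
    | nil => exact id
    | cons h _ ih => exact fun ha => ih (hS _ _ h ha)
  exact key p hxS

/-! ### Journeys -/

namespace Journey

theorem bounds (hζ : 0 < ζ) {d a : ℝ} {h : ℕ} (hj : G.Journey u v d a h) :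
    0 ≤ d ∧ d + h * ζ ≤ a ∧ 1 ≤ h := by
  induction hj with
  | single hc => exact ⟨hc.nonneg hζ, by simp, le_rfl⟩
  | cons hc hle _ ih =>
    refine ⟨hc.nonneg hζ, ?_, by omega⟩
    push_cast
    linarith [ih.2.1]

theorem mem_right (hζ : 0 < ζ) {d a : ℝ} {h : ℕ} (hj : G.Journey u v d a h) : v ∈ G.nodes := by
  induction hj with
  | single hc => exact (hc.edge hζ).mem_right
  | cons _ _ _ ih => exact ih

theorem snoc {d a s : ℝ} {h : ℕ} (hj : G.Journey u w d a h) (hs : a ≤ s)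
    (hc : G.Crossing w v s) : G.Journey u v d (s + ζ) (h + 1) := by
  induction hj with
  | single hc' => exact .cons hc' hs (.single hc)
  | cons hc' hle _ ih => exact .cons hc' hle (ih hs hc)

/-- Journeys are built from the front, whereas parents in a foremost tree are found from the back,
as the senders of last hops. -/
theorem last {d a : ℝ} {h : ℕ} (hj : G.Journey u v d a h) :
    ∃ w s, G.Crossing w v s ∧ a = s + ζ ∧
      ((w = u ∧ d ≤ s) ∨ ∃ a' h', G.Journey u w d a' h' ∧ a' ≤ s) := by
  induction hj with
  | single hc => exact ⟨_, _, hc, rfl, Or.inl ⟨rfl, le_rfl⟩⟩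
  | cons hc hle _ ih =>
    obtain ⟨w', s', hc', rfl, h1 | ⟨a', h', h1, h2⟩⟩ := ih
    · obtain ⟨rfl, h2⟩ := h1
      exact ⟨_, s', hc', rfl, Or.inr ⟨_, 1, .single hc, hle.trans h2⟩⟩
    · exact ⟨w', s', hc', rfl, Or.inr ⟨a', _, .cons hc hle h1, h2⟩⟩

/-- The threshold `e` is there for negative shifts: a period can be subtracted only from crossings
that start at date `p` or later. -/
theorem shift {c e : ℝ} (hsh : ∀ u v s, e ≤ s → G.Crossing u v s → G.Crossing u v (s + c))
    (hζ : 0 < ζ) {d a : ℝ} {h : ℕ} (hj : G.Journey u v d a h) (he : e ≤ d) :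
    G.Journey u v (d + c) (a + c) h := by
  induction hj with
  | single hc =>
    rw [add_right_comm]
    exact .single (hsh _ _ _ he hc)
  | cons hc hle _ ih => exact .cons (hsh _ _ _ he hc) (by linarith) (ih (by linarith))

end Journey

theorem IsPeriod.crossing_iff {p : ℝ} (hp : G.IsPeriod p) {s : ℝ} (hs : 0 ≤ s) :
    G.Crossing u v s ↔ G.Crossing u v (s + p) := by
  constructor
  · intro h t ht
    have := (hp.2 u v (t - p) (by linarith [ht.1])).1 (h _ ⟨by linarith [ht.1], by linarith [ht.2]⟩)
    simpa using this
  · intro h t ht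
    exact (hp.2 u v t (hs.trans ht.1)).2 (h _ ⟨by linarith [ht.1], by linarith [ht.2]⟩)

theorem IsPeriod.journey_add (hζ : 0 < ζ) {p : ℝ} (hp : G.IsPeriod p) {d a : ℝ} {h : ℕ}
    (hj : G.Journey u v d a h) : G.Journey u v (d + p) (a + p) h :=
  hj.shift (fun _ _ _ hs hc => (hp.crossing_iff hs).1 hc) hζ (hj.bounds hζ).1

theorem IsPeriod.journey_sub (hζ : 0 < ζ) {p : ℝ} (hp : G.IsPeriod p) {d a : ℝ} {h : ℕ}
    (hj : G.Journey u v d a h) (hd : p ≤ d) : G.Journey u v (d - p) (a - p) h :=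
  hj.shift (c := -p)
    (fun _ _ s hs hc => (hp.crossing_iff (by linarith)).2 (by simpa using hc)) hζ hd

/-- In a recurrent graph journeys to all nodes depart after any date. -/
theorem RecurrenceBound.exists_journey (hζ : 0 < ζ) {Δ : ℝ} (hΔ : G.RecurrenceBound Δ)
    (hc : G.footprint.Connected) {x : ℕ} (hx : x ∈ G.nodes) {τ : ℝ} (hτ : 0 ≤ τ) (hv : v ∈ G.nodes)
    (hvx : v ≠ x) : ∃ d a h, τ ≤ d ∧ G.Journey x v d a h := by
  have := mem_of_edge_closed hc (S := {v | v = x ∨ ∃ d a h, τ ≤ d ∧ G.Journey x v d a h})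
    hx (Or.inl rfl) ?_ hv
  · exact this.resolve_left hvx
  · rintro u w he (rfl | ⟨d, a, h, hd, hj⟩)
    · obtain ⟨r, h1, -, h3⟩ := hΔ.exists_crossing hζ he hτ
      exact Or.inr ⟨_, _, _, h1, .single h3⟩
    · have hb := hj.bounds hζ
      have h0 : 0 ≤ h * ζ := by positivity
      obtain ⟨r, h1, -, h3⟩ := hΔ.exists_crossing hζ he (s := a) (by linarith)
      exact Or.inr ⟨_, _, _, hd, hj.snoc h1 h3⟩

end TVG

namespace TVG

variable {ζ : ℝ} {G : TVG ζ} {u v w : ℕ}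

/-! ### Minima over journeys are attained -/

/-- An infinite union of closed intervals need not be closed, but here the intervals are at least
`ζ` long, disjoint, and start at nonnegative dates. So only finitely many begin by date `t + 1`, and
only these matter near `t`. -/
theorem isClosed_present (hζ : 0 < ζ) (G : TVG ζ) (u v : ℕ) : IsClosed {t | G.present u v t} := by
  obtain ⟨S, hS, hI, hP⟩ := G.intervals u v
  rw [hP]
  have hleast : ∀ I ∈ S, IsClosed I ∧ ∃ a, IsLeast I a ∧ Set.Icc a (a + ζ) ⊆ I := by
    intro I hIS
    rcases hI I hIS with ⟨a, b, hab, rfl⟩ | ⟨a, rfl⟩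
    · exact ⟨isClosed_Icc, a, isLeast_Icc (by linarith), Set.Icc_subset_Icc_right hab⟩
    · exact ⟨isClosed_Ici, a, isLeast_Ici, fun _ h => h.1⟩
  have h0 : ∀ I ∈ S, ∀ a ∈ I, 0 ≤ a := fun I hIS a ha =>
    G.nonneg (u := u) (v := v) (by
      have : a ∈ {t | G.present u v t} := by rw [hP]; exact ⟨I, hIS, ha⟩
      exact this)
  have heq : ∀ I ∈ S, ∀ J ∈ S, ∀ a, a ∈ I → a ∈ J → I = J := by
    intro I hIS J hJS a haI haJ
    by_contra hne
    exact Set.disjoint_left.1 (hS hIS hJS hne) haI haJ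
  have hfin : ∀ B : ℝ, {I | I ∈ S ∧ ∃ a, a ≤ B ∧ IsLeast I a}.Finite := by
    intro B
    refine Set.Finite.of_finite_image (f := sInf) ((finite_of_separated hζ
      (A := {a | ∃ I ∈ S, IsLeast I a}) ?_ ?_ B).subset ?_) ?_
    · rintro a ⟨I, hIS, ha⟩
      exact h0 I hIS a ha.1
    · rintro a ⟨I, hIS, ha⟩ b ⟨J, hJS, hb⟩ hab
      by_contra hcon
      obtain ⟨-, a', ha', hsub⟩ := hleast I hIS
      obtain rfl := ha.unique ha'
      obtain rfl := heq I hIS J hJS b (hsub ⟨hab.le, by linarith⟩) hb.1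
      exact absurd hab (not_lt.2 (hb.2 ha.1))
    · rintro _ ⟨I, ⟨hIS, a, haB, ha⟩, rfl⟩
      rw [ha.csInf_eq]
      exact ⟨⟨I, hIS, ha⟩, haB⟩
    · rintro I ⟨hIS, a, -, ha⟩ J ⟨hJS, b, -, hb⟩ hab
      rw [ha.csInf_eq, hb.csInf_eq] at hab
      exact heq I hIS J hJS a ha.1 (hab ▸ hb.1)
  refine isClosed_of_closure_subset fun t ht => ?_
  have hcl : IsClosed (⋃ I ∈ {I | I ∈ S ∧ ∃ a, a ≤ t + 1 ∧ IsLeast I a}, I) :=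
    (hfin (t + 1)).isClosed_biUnion fun I hI' => (hleast I hI'.1).1
  have hsub : (⋃ I ∈ {I | I ∈ S ∧ ∃ a, a ≤ t + 1 ∧ IsLeast I a}, I) ⊆ ⋃₀ S := by
    intro s hs
    simp only [Set.mem_iUnion] at hs
    obtain ⟨I, hI', hsI⟩ := hs
    exact ⟨I, hI'.1, hsI⟩
  refine hsub (hcl.closure_subset_iff.2 (Set.Subset.refl _) ?_)
  rw [mem_closure_iff] at ht ⊢
  intro o ho hto
  obtain ⟨s, ⟨hso, hst⟩, I, hIS, hsI⟩ := ht (o ∩ Set.Iio (t + 1)) (ho.inter isOpen_Iio)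
    ⟨hto, by simp⟩
  obtain ⟨-, a, ha, -⟩ := hleast I hIS
  exact ⟨s, hso, Set.mem_biUnion (show I ∈ {I | I ∈ S ∧ ∃ a, a ≤ t + 1 ∧ IsLeast I a} from
    ⟨hIS, a, (ha.2 hsI).trans (le_of_lt hst), ha⟩) hsI⟩

theorem isClosed_crossing (hζ : 0 < ζ) (G : TVG ζ) (u v : ℕ) :
    IsClosed {s | G.Crossing u v s} := by
  have : {s | G.Crossing u v s} = ⋂ θ ∈ Set.Icc 0 ζ, (fun s => s + θ) ⁻¹' {t | G.present u v t} := by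
    ext s
    simp only [Set.mem_ofPred_eq, Set.mem_iInter, Set.mem_preimage]
    constructor
    · exact fun h θ hθ => h _ ⟨by linarith [hθ.1], by linarith [hθ.2]⟩
    · intro h t ht
      simpa using h (t - s) ⟨by linarith [ht.1], by linarith [ht.2]⟩
  rw [this]
  exact isClosed_biInter fun θ _ => (isClosed_present hζ G u v).preimage (by fun_prop)

/-- The eliminated variable is confined to the segment between the two dates. Parametrizing this
segment by `[0, 1]` turns the set into a projection along a compact factor. -/
theorem isClosed_exists_between {Z : Set ((ℝ × ℝ) × ℝ)} (hZ : IsClosed Z)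
    (hb : ∀ q ∈ Z, q.1.1 ≤ q.2 ∧ q.2 ≤ q.1.2) : IsClosed {q : ℝ × ℝ | ∃ s, (q, s) ∈ Z} := by
  have hf : Continuous fun y : unitInterval × (ℝ × ℝ) =>
      ((y.2, y.2.1 + (y.1 : ℝ) * (y.2.2 - y.2.1)) : (ℝ × ℝ) × ℝ) := by fun_prop
  have := isClosedMap_snd_of_compactSpace _ (hZ.preimage hf)
  convert this using 1
  ext q
  simp only [Set.mem_ofPred_eq, Set.mem_image, Set.mem_preimage, Prod.exists, exists_eq_right]
  constructor
  · rintro ⟨s, hs⟩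
    obtain ⟨h1, h2⟩ := hb _ hs
    simp only at h1 h2
    rcases eq_or_lt_of_le (h1.trans h2) with heq | hlt
    · refine ⟨0, ?_⟩
      have : s = q.1 := le_antisymm (h2.trans heq.ge) h1
      simpa [this] using hs
    · refine ⟨⟨(s - q.1) / (q.2 - q.1), div_nonneg (by linarith) (by linarith),
        (div_le_one (by linarith)).2 (by linarith)⟩, ?_⟩
      have hne : q.2 - q.1 ≠ 0 := by linarith
      simpa [div_mul_cancel₀ _ hne] using hs
  · rintro ⟨θ, h⟩
    exact ⟨_, h⟩

/-- The pairs of dates between which there is a journey with `h` hops. -/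
theorem isClosed_journeys (hζ : 0 < ζ) (G : TVG ζ) (v : ℕ) (h : ℕ) : ∀ u,
    IsClosed {q : ℝ × ℝ | ∃ d a, q.1 ≤ d ∧ a ≤ q.2 ∧ G.Journey u v d a h} := by
  induction h with
  | zero =>
    intro u
    convert isClosed_empty
    ext q
    simp only [Set.mem_ofPred_eq, Set.mem_empty_iff_false, iff_false]
    rintro ⟨d, a, -, -, hj⟩
    have := (hj.bounds hζ).2.2
    omega
  | succ h ih =>
    intro u
    have hl1 : IsClosed {y : (ℝ × ℝ) × ℝ | y.1.1 ≤ y.2} := isClosed_le (by fun_prop) (by fun_prop)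
    have hl2 : IsClosed {y : (ℝ × ℝ) × ℝ | y.2 + ζ ≤ y.1.2} :=
      isClosed_le (by fun_prop) (by fun_prop)
    -- The date `y.2` is that of the first hop. Requiring its end to be at most `y.1.2` holds for
    -- every journey in question and provides the upper bound needed for eliminating `y.2`.
    have hZ1 : ∀ w, IsClosed {y : (ℝ × ℝ) × ℝ | y.1.1 ≤ y.2 ∧ y.2 + ζ ≤ y.1.2 ∧
        G.Crossing u w y.2} := fun w =>
      hl1.inter (hl2.inter ((isClosed_crossing hζ G u w).preimage continuous_snd))
    have hZ2 : ∀ w, IsClosed {y : (ℝ × ℝ) × ℝ | (y.1.1 ≤ y.2 ∧ y.2 + ζ ≤ y.1.2 ∧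
        G.Crossing u w y.2) ∧ ∃ d a, y.2 + ζ ≤ d ∧ a ≤ y.1.2 ∧ G.Journey w v d a h} := fun w =>
      (hZ1 w).inter
        ((ih w).preimage (f := fun y : (ℝ × ℝ) × ℝ => (y.2 + ζ, y.1.2)) (by fun_prop))
    have h1 : IsClosed {q : ℝ × ℝ | h = 0 ∧ ∃ s, q.1 ≤ s ∧ s + ζ ≤ q.2 ∧ G.Crossing u v s} := by
      by_cases h0 : h = 0
      · simpa [h0] using isClosed_exists_between (hZ1 v) fun q hq => ⟨hq.1, by linarith [hq.2.1]⟩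
      · simp [h0]
    have h2 := G.nodes.finite_toSet.isClosed_biUnion fun w _ =>
      isClosed_exists_between (hZ2 w) fun q hq => ⟨hq.1.1, by linarith [hq.1.2.1]⟩
    convert h1.union h2 using 1
    ext q
    simp only [Set.mem_ofPred_eq, Set.mem_union, Set.mem_iUnion]
    constructor
    · rintro ⟨d, a, hd, ha, hj⟩
      cases hj with
      | single hc => exact Or.inl ⟨rfl, d, hd, ha, hc⟩
      | @cons _ w _ _ d' _ _ hc hle hj =>
        have hb := hj.bounds hζ
        have : 0 ≤ h * ζ := by positivity
        exact Or.inr ⟨w, (hc.edge hζ).mem_right, d, ⟨hd, by linarith, hc⟩, d', a, hle, ha, hj⟩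
    · rintro (⟨rfl, s, h1, h2, h3⟩ | ⟨w, -, s, ⟨h1, -, h3⟩, d, a, h4, h5, h6⟩)
      · exact ⟨s, s + ζ, h1, h2, .single h3⟩
      · exact ⟨s, a, h1, h5, .cons h3 h4 h6⟩

/-- The pairs of dates between which there is a journey, as long as they are not more than
`D` apart. -/
theorem isClosed_journeys_le (hζ : 0 < ζ) (G : TVG ζ) (u v : ℕ) (D : ℝ) :
    IsClosed {q : ℝ × ℝ | q.2 ≤ q.1 + D ∧ ∃ d a h, q.1 ≤ d ∧ a ≤ q.2 ∧ G.Journey u v d a h} := by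
  -- Each hop takes `ζ`, so journeys within time `D` have fewer than `H` hops, and a finite union of
  -- closed sets remains.
  obtain ⟨H, hH⟩ := exists_nat_gt (D / ζ)
  rw [div_lt_iff₀ hζ] at hH
  have h1 : IsClosed {q : ℝ × ℝ | q.2 ≤ q.1 + D} := isClosed_le (by fun_prop) (by fun_prop)
  have h2 := (Set.finite_Iic H).isClosed_biUnion fun h _ => isClosed_journeys hζ G v h u
  convert h1.inter h2 using 1
  ext q
  simp only [Set.mem_ofPred_eq, Set.mem_inter_iff, Set.mem_iUnion, Set.mem_Iic]
  refine and_congr_right fun hq => ⟨?_, ?_⟩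
  · rintro ⟨d, a, h, h1, h2, h3⟩
    refine ⟨h, ?_, d, a, h1, h2, h3⟩
    have hb := (h3.bounds hζ).2.1
    have : (h : ℝ) < H := by
      by_contra hcon
      push Not at hcon
      nlinarith
    exact_mod_cast this.le
  · rintro ⟨h, -, d, a, h1, h2, h3⟩
    exact ⟨d, a, h, h1, h2, h3⟩

/-- Foremost arrival dates exist. -/
theorem exists_foremost (hζ : 0 < ζ) {τ : ℝ} {x : ℕ}
    (hex : ∃ d a h, τ ≤ d ∧ G.Journey x v d a h) :
    ∃ r, IsLeast {a | ∃ d h, τ ≤ d ∧ G.Journey x v d a h} r := by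
  obtain ⟨d₀, a₀, h₀, hd₀, hj₀⟩ := hex
  have hK : IsCompact {b : ℝ | b ∈ Set.Icc τ a₀ ∧
      ∃ d a h, τ ≤ d ∧ a ≤ b ∧ G.Journey x v d a h} := by
    have := (isClosed_journeys_le hζ G x v (a₀ - τ)).preimage
      (f := fun b : ℝ => (τ, b)) (by fun_prop)
    convert (isCompact_Icc (a := τ) (b := a₀)).inter_right this using 1
    ext b
    simp only [Set.mem_ofPred_eq, Set.mem_inter_iff, Set.mem_preimage]
    refine and_congr_right fun hb => ⟨fun h => ⟨by linarith [hb.2], h⟩, fun h => h.2⟩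
  have hjb : ∀ {d a h}, G.Journey x v d a h → τ ≤ d → τ ≤ a := by
    intro d a h hj hd
    have := (hj.bounds hζ).2.1
    have : 0 ≤ h * ζ := by positivity
    linarith
  obtain ⟨r, ⟨⟨h1, h2⟩, d, a, h, hd, ha, hj⟩, hmin⟩ := hK.exists_isLeast
    ⟨a₀, ⟨hjb hj₀ hd₀, le_rfl⟩, d₀, a₀, h₀, hd₀, le_rfl, hj₀⟩
  have har : a = r := le_antisymm ha
    (hmin ⟨⟨hjb hj hd, ha.trans h2⟩, d, a, h, hd, le_rfl, hj⟩)
  subst har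
  refine ⟨a, ⟨d, h, hd, hj⟩, ?_⟩
  rintro b ⟨d', h', hd', hj'⟩
  rcases le_total b a₀ with hb | hb
  · exact hmin ⟨⟨hjb hj' hd', hb⟩, d', b, h', hd', le_rfl, hj'⟩
  · exact h2.trans hb

/-- A window in which all nodes are reached can be postponed by any number of periods. Hence one
optimal duration serves all broadcasts, whenever they are created. -/
theorem IsPeriod.broadcastDurations_eq (hζ : 0 < ζ) {p : ℝ} (hp : G.IsPeriod p) (x : ℕ)
    {τ τ' : ℝ} (hτ : 0 ≤ τ) (hτ' : 0 ≤ τ') :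
    broadcastDurations G x τ = broadcastDurations G x τ' := by
  have key : ∀ τ τ' : ℝ, 0 ≤ τ → broadcastDurations G x τ ⊆ broadcastDurations G x τ' := by
    rintro τ τ' hτ d ⟨h0, a, ha, hj⟩
    obtain ⟨n, hn⟩ := exists_nat_gt (max τ' 0 / p)
    have hn0 : 0 < n := by
      have : (0 : ℝ) < n := lt_of_le_of_lt (div_nonneg (le_max_right _ _) hp.1.le) hn
      exact_mod_cast this
    rw [div_lt_iff₀ hp.1] at hn
    have := le_max_left τ' 0
    refine ⟨h0, a + n * p, by linarith, fun v hv hvx => ?_⟩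
    obtain ⟨dep, arr, h, h1, h2, h3⟩ := hj v hv hvx
    exact ⟨_, _, h, (hp.nat_mul hn0).journey_add hζ h1, by linarith, by linarith⟩
  exact (key τ τ' hτ).antisymm (key τ' τ hτ')

/-- In periodic graphs the least duration of a broadcast exists. -/
theorem IsPeriod.exists_fastest (hζ : 0 < ζ) {p : ℝ} (hp : G.IsPeriod p)
    (hc : G.footprint.Connected) {x : ℕ} (hx : x ∈ G.nodes) {τ : ℝ} (hτ : 0 ≤ τ) :
    ∃ d, IsLeast (broadcastDurations G x τ) d := by
  have hΔ := hp.recurrenceBound hζ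
  have hex : ∀ v : ℕ, ∃ b, τ ≤ b ∧ (v ∈ G.nodes → v ≠ x →
      ∃ d a h, τ ≤ d ∧ a ≤ b ∧ G.Journey x v d a h) := by
    intro v
    by_cases hv : v ∈ G.nodes ∧ v ≠ x
    · obtain ⟨d, a, h, h1, h2⟩ := hΔ.exists_journey hζ hc hx hτ hv.1 hv.2
      exact ⟨max τ a, le_max_left _ _, fun _ _ => ⟨d, a, h, h1, le_max_right _ _, h2⟩⟩
    · exact ⟨τ, le_rfl, fun h1 h2 => absurd ⟨h1, h2⟩ hv⟩
  choose b hb1 hb2 using hex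
  set D := ∑ v ∈ G.nodes, (b v - τ) with hD
  have hle : ∀ v ∈ G.nodes, b v ≤ τ + D := by
    intro v hv
    have := Finset.single_le_sum (f := fun v => b v - τ) (fun i _ => sub_nonneg.2 (hb1 i)) hv
    linarith
  have hD0 : 0 ≤ D := Finset.sum_nonneg fun i _ => sub_nonneg.2 (hb1 i)
  -- Windows, given by start and end, of length at most `D` in which all nodes are reached. By
  -- periodicity only starts within one period after `τ` need be considered, which makes the set
  -- compact; the length is then minimized on it.
  set K : Set (ℝ × ℝ) := (Set.Icc τ (τ + p) ×ˢ Set.Icc τ (τ + p + D)) ∩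
    ({q | q.1 ≤ q.2} ∩ ({q | q.2 ≤ q.1 + D} ∩ ⋂ v ∈ {v | v ∈ G.nodes ∧ v ≠ x},
      {q : ℝ × ℝ | q.2 ≤ q.1 + D ∧ ∃ d a h, q.1 ≤ d ∧ a ≤ q.2 ∧ G.Journey x v d a h})) with hK
  have hKc : IsCompact K := by
    refine (isCompact_Icc.prod isCompact_Icc).inter_right ?_
    refine (isClosed_le (by fun_prop) (by fun_prop)).inter
      ((isClosed_le (by fun_prop) (by fun_prop)).inter ?_)
    exact isClosed_biInter fun v _ => isClosed_journeys_le hζ G x v D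
  have hmem : ∀ d ∈ broadcastDurations G x τ, d ≤ D → ∃ a, (a, a + d) ∈ K := by
    rintro d ⟨hd0, a, ha, hj⟩ hdD
    obtain ⟨n, h1, h2⟩ := exists_sub_mul_mem hp.1 ha
    refine ⟨a - n * p, ⟨⟨⟨h1, h2.le⟩, by linarith, by linarith⟩, ?_, ?_, ?_⟩⟩
    · simp only [Set.mem_ofPred_eq]; linarith
    · simp only [Set.mem_ofPred_eq]; linarith
    · simp only [Set.mem_iInter]
      rintro v ⟨hv, hvx⟩
      obtain ⟨dep, arr, h, h1', h2', h3'⟩ := hj v hv hvx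
      refine ⟨by simp only; linarith, dep - n * p, arr - n * p, h, by simp only; linarith,
        by simp only; linarith, ?_⟩
      rcases Nat.eq_zero_or_pos n with rfl | hn
      · simpa using h1'
      · exact (hp.nat_mul hn).journey_sub hζ h1' (by linarith)
  have hDmem : D ∈ broadcastDurations G x τ := by
    refine ⟨hD0, τ, le_rfl, fun v hv hvx => ?_⟩
    obtain ⟨d, a, h, h1, h2, h3⟩ := hb2 v hv hvx
    exact ⟨d, a, h, h3, h1, h2.trans (hle v hv)⟩
  obtain ⟨a₀, ha₀⟩ := hmem D hDmem le_rfl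
  obtain ⟨⟨a, b'⟩, hab, hmin⟩ := hKc.exists_isMinOn ⟨_, ha₀⟩
    (f := fun q : ℝ × ℝ => q.2 - q.1) (by fun_prop)
  have hmin' : ∀ q ∈ K, b' - a ≤ q.2 - q.1 := fun q hq => hmin hq
  obtain ⟨⟨h1, h2⟩, h3, h4, h5⟩ := hab
  simp only [Set.mem_iInter, Set.mem_ofPred_eq] at h3 h4 h5
  refine ⟨b' - a, ⟨by linarith, a, h1.1, fun v hv hvx => ?_⟩, fun d hd => ?_⟩
  · obtain ⟨-, dep, arr, h, h6, h7, h8⟩ := h5 v ⟨hv, hvx⟩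
    exact ⟨dep, arr, h, h8, h6, by linarith⟩
  · rcases le_total d D with h | h
    · obtain ⟨a', ha'⟩ := hmem d hd h
      have := hmin' _ ha'
      simp only at this
      linarith
    · have := hmin' _ ha₀
      simp only at this
      linarith

/-! ### Foremost and shortest trees -/

/-- `T` is the parent function of a foremost tree for departure date `e`; `R` gives the dates at
which the nodes are reached. -/
structure ForemostTree (G : TVG ζ) (x : ℕ) (e : ℝ) (T : ℕ → ℕ) (R : ℕ → ℝ) : Prop where
  root : T x = x
  start : R x = e
  least : ∀ v ∈ G.nodes, v ≠ x → IsLeast {a | ∃ d h, e ≤ d ∧ G.Journey x v d a h} (R v)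
  le : ∀ v ∈ G.nodes, v ≠ x → R (T v) + ζ ≤ R v
  crossing : ∀ v ∈ G.nodes, v ≠ x → G.Crossing (T v) v (R v - ζ)

/-- The parent of `v` is the sender of the last hop of a foremost journey to `v`. The parent's own
earliest arrival is no later than that hop, so the hop can also end an earliest route through the
tree. -/
theorem RecurrenceBound.exists_foremostTree (hζ : 0 < ζ) {Δ : ℝ} (hΔ : G.RecurrenceBound Δ)
    (hc : G.footprint.Connected) {x : ℕ} (hx : x ∈ G.nodes) {e : ℝ} (he : 0 ≤ e) :
    ∃ T R, G.ForemostTree x e T R := by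
  have hR : ∀ v : ℕ, ∃ r, (v = x → r = e) ∧ (v ∈ G.nodes → v ≠ x →
      IsLeast {a | ∃ d h, e ≤ d ∧ G.Journey x v d a h} r) := by
    intro v
    by_cases hv : v ∈ G.nodes ∧ v ≠ x
    · obtain ⟨r, hr⟩ := exists_foremost hζ (hΔ.exists_journey hζ hc hx he hv.1 hv.2)
      exact ⟨r, fun h => absurd h hv.2, fun _ _ => hr⟩
    · exact ⟨e, fun _ => rfl, fun h1 h2 => absurd ⟨h1, h2⟩ hv⟩
  choose R hR1 hR2 using hR
  have hT : ∀ v : ℕ, ∃ w, (v = x → w = x) ∧ (v ∈ G.nodes → v ≠ x →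
      R w + ζ ≤ R v ∧ G.Crossing w v (R v - ζ)) := by
    intro v
    by_cases hv : v ∈ G.nodes ∧ v ≠ x
    · obtain ⟨d, h, hd, hj⟩ := (hR2 v hv.1 hv.2).1
      obtain ⟨w, s, hcr, hs, hw⟩ := hj.last
      refine ⟨w, fun h => absurd h hv.2, fun _ _ => ⟨?_, by rw [hs]; simpa using hcr⟩⟩
      have : R w ≤ s := by
        by_cases hwx : w = x
        · rw [hR1 w hwx]
          rcases hw with ⟨-, h1⟩ | ⟨a', h', h1, h2⟩
          · linarith
          · have := (h1.bounds hζ).2.1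
            have : 0 ≤ h' * ζ := by positivity
            linarith
        · rcases hw with ⟨h1, -⟩ | ⟨a', h', h1, h2⟩
          · exact absurd h1 hwx
          · exact ((hR2 w (h1.mem_right hζ) hwx).2 ⟨d, h', hd, h1⟩).trans h2
      linarith
    · exact ⟨x, fun _ => rfl, fun h1 h2 => absurd ⟨h1, h2⟩ hv⟩
  choose T hT1 hT2 using hT
  exact ⟨T, R, hT1 x rfl, hR1 x rfl, hR2, fun v hv hvx => (hT2 v hv hvx).1,
    fun v hv hvx => (hT2 v hv hvx).2⟩

/-- This is what makes foremost trees reusable when a period is known. -/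
theorem ForemostTree.shift (hζ : 0 < ζ) {p : ℝ} (hp : G.IsPeriod p) {x : ℕ} {e : ℝ} {T : ℕ → ℕ}
    {R : ℕ → ℝ} (h : G.ForemostTree x e T R) (he : 0 ≤ e) :
    G.ForemostTree x (e + p) T fun v => R v + p where
  root := h.root
  start := by rw [h.start]
  least v hv hvx := by
    obtain ⟨⟨d, k, hd, hj⟩, hmin⟩ := h.least v hv hvx
    refine ⟨⟨d + p, k, by linarith, hp.journey_add hζ hj⟩, ?_⟩
    rintro a ⟨d', k', hd', hj'⟩
    have := hmin ⟨d' - p, k', by linarith, hp.journey_sub hζ hj' (by linarith)⟩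
    linarith
  le v hv hvx := by linarith [h.le v hv hvx]
  crossing v hv hvx := by
    have hcr := h.crossing v hv hvx
    rw [hp.crossing_iff (hcr.nonneg hζ)] at hcr
    convert hcr using 1
    ring

theorem ForemostTree.shift_nat_mul (hζ : 0 < ζ) {p : ℝ} (hp : G.IsPeriod p) {x : ℕ} {e : ℝ}
    {T : ℕ → ℕ} {R : ℕ → ℝ} (h : G.ForemostTree x e T R) (he : 0 ≤ e) (n : ℕ) :
    G.ForemostTree x (e + n * p) T fun v => R v + n * p := by
  rcases Nat.eq_zero_or_pos n with rfl | hn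
  · simpa using h
  · exact h.shift hζ (hp.nat_mul hn) he

/-- `T` is the parent function of a breadth-first search tree of the footprint; `D` gives the
depths. -/
structure ShortestTree (G : TVG ζ) (x : ℕ) (T : ℕ → ℕ) (D : ℕ → ℕ) : Prop where
  root : T x = x
  start : D x = 0
  edge : ∀ v ∈ G.nodes, v ≠ x → G.Edge (T v) v
  depth : ∀ v ∈ G.nodes, v ≠ x → D v = D (T v) + 1
  le : ∀ u w, G.Edge u w → D w ≤ D u + 1

theorem exists_shortestTree (hc : G.footprint.Connected) {x : ℕ} (hx : x ∈ G.nodes) :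
    ∃ T D, G.ShortestTree x T D := by
  classical
  set D : ℕ → ℕ := fun v => if hv : v ∈ G.nodes then G.footprint.dist ⟨v, hv⟩ ⟨x, hx⟩ else 0
    with hD
  have hT : ∀ v : ℕ, ∃ w, (v = x → w = x) ∧ (v ∈ G.nodes → v ≠ x →
      G.Edge w v ∧ D v = D w + 1) := by
    intro v
    by_cases hv : v ∈ G.nodes ∧ v ≠ x
    · obtain ⟨p, hp⟩ := (hc.preconnected ⟨v, hv.1⟩ ⟨x, hx⟩).exists_walk_length_eq_dist
      cases p with
      | nil => exact absurd rfl hv.2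
      | @cons _ w _ hadj q =>
        refine ⟨w, fun h => absurd h hv.2, fun _ _ => ⟨Edge.symm hadj, ?_⟩⟩
        have h1 : G.footprint.dist w ⟨x, hx⟩ ≤ q.length := SimpleGraph.dist_le q
        have h2 := hc.dist_triangle (u := ⟨v, hv.1⟩) (v := w) (w := ⟨x, hx⟩)
        have h3 : G.footprint.dist ⟨v, hv.1⟩ w = 1 := SimpleGraph.dist_eq_one_iff_adj.2 hadj
        rw [SimpleGraph.Walk.length_cons] at hp
        have h4 : D w = G.footprint.dist w ⟨x, hx⟩ := dif_pos w.2
        have h5 : D v = G.footprint.dist ⟨v, hv.1⟩ ⟨x, hx⟩ := dif_pos hv.1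
        omega
    · exact ⟨x, fun _ => rfl, fun h1 h2 => absurd ⟨h1, h2⟩ hv⟩
  choose T hT1 hT2 using hT
  refine ⟨T, D, hT1 x rfl, by simp [hD, hx], fun v hv hvx => (hT2 v hv hvx).1,
    fun v hv hvx => (hT2 v hv hvx).2, fun u w he => ?_⟩
  have h2 := hc.dist_triangle (u := ⟨w, he.mem_right⟩) (v := ⟨u, he.mem_left⟩) (w := ⟨x, hx⟩)
  have h3 : G.footprint.dist ⟨w, he.mem_right⟩ ⟨u, he.mem_left⟩ = 1 :=
    SimpleGraph.dist_eq_one_iff_adj.2 he.symm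
  have h4 : D w = _ := dif_pos he.mem_right
  have h5 : D u = _ := dif_pos he.mem_left
  omega

namespace ShortestTree

variable {x : ℕ} {T D : ℕ → ℕ}

theorem iterate (h : G.ShortestTree x T D) : ∀ n v, v ∈ G.nodes → D v = n → T^[n] v = x := by
  intro n
  induction n with
  | zero =>
    intro v hv hn
    by_contra hvx
    have := h.depth v hv hvx
    omega
  | succ n ih =>
    intro v hv hn
    have hvx : v ≠ x := by
      rintro rfl
      rw [h.start] at hn
      omega
    rw [Function.iterate_succ_apply]
    refine ih _ (h.edge v hv hvx).mem_left ?_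
    have := h.depth v hv hvx
    omega

theorem le_hops (hζ : 0 < ζ) (h : G.ShortestTree x T D) {d a : ℝ} {k : ℕ}
    (hj : G.Journey u v d a k) : D v ≤ D u + k := by
  induction hj with
  | single hc => exact h.le _ _ (hc.edge hζ)
  | cons hc _ _ ih =>
    have := h.le _ _ (hc.edge hζ)
    omega

theorem exists_journey (hζ : 0 < ζ) (h : G.ShortestTree x T D) {Δ : ℝ} (hΔ : G.RecurrenceBound Δ)
    {τ : ℝ} (hτ : 0 ≤ τ) : ∀ n v, v ∈ G.nodes → v ≠ x → D v = n →
      ∃ d a, τ ≤ d ∧ G.Journey x v d a n := by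
  intro n
  induction n with
  | zero =>
    intro v hv hvx hn
    have := h.depth v hv hvx
    omega
  | succ n ih =>
    intro v hv hvx hn
    have he := h.edge v hv hvx
    have hd := h.depth v hv hvx
    by_cases hT : T v = x
    · rw [hT] at he hd
      obtain ⟨r, h1, -, h3⟩ := hΔ.exists_crossing hζ he hτ
      rw [h.start] at hd
      obtain rfl : n = 0 := by omega
      exact ⟨r, r + ζ, h1, .single h3⟩
    · obtain ⟨d, a, h1, h2⟩ := ih (T v) he.mem_left hT (by omega)
      have hb := h2.bounds hζ
      have : 0 ≤ n * ζ := by positivity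
      obtain ⟨r, h3, -, h4⟩ := hΔ.exists_crossing hζ he (s := a) (by linarith)
      exact ⟨d, r + ζ, h1, h2.snoc h3 h4⟩

/-- Since every edge recurs, a path of the footprint can be travelled from any date on. So hop
distances do not depend on the date, and a breadth-first tree remains optimal without any
periodicity. -/
theorem isLeast (hζ : 0 < ζ) (h : G.ShortestTree x T D) {Δ : ℝ} (hΔ : G.RecurrenceBound Δ)
    {τ : ℝ} (hτ : 0 ≤ τ) (hv : v ∈ G.nodes) (hvx : v ≠ x) :
    IsLeast {k | ∃ d a, τ ≤ d ∧ G.Journey x v d a k} (D v) := by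
  refine ⟨h.exists_journey hζ hΔ hτ _ v hv hvx rfl, ?_⟩
  rintro k ⟨d, a, -, hj⟩
  have := h.le_hops hζ hj
  rw [h.start] at this
  omega

end ShortestTree

end TVG

/-! ### Spreading of information along allowed links -/

section Propagation

variable {ζ : ℝ} {G : TVG ζ} {M : Type} {σ : ℕ → ℕ → ℝ → Option (Packet M)}

theorem arrival_eq_some {w v : ℕ} {r : ℝ} {q : Packet M} :
    arrival G σ w v r = some q ↔ G.Crossing w v (r - ζ) ∧ σ w v (r - ζ) = some q := by
  unfold arrival
  split_ifs with h <;> simp [h]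

theorem delivers_iff {j w v : ℕ} {r : ℝ} :
    Delivers G σ j w v r ↔ G.Crossing w v (r - ζ) ∧ SendsInfo σ j w v (r - ζ) := by
  simp [Delivers, SendsInfo, arrival_eq_some]

variable (G σ) in
/-- Node `v` has the `j`-th information at date `s`; the emitter `x` holds it from date `e j` on. -/
def Held (x : ℕ) (e : ℕ → ℝ) (j v : ℕ) (s : ℝ) : Prop :=
  (v = x ∧ e j ≤ s) ∨ (v ≠ x ∧ ∃ u r, r ≤ s ∧ Delivers G σ j u v r)

variable (G σ) in
/-- Node `v` gets the `j`-th information at date `s`. -/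
def Fresh (x : ℕ) (e : ℕ → ℝ) (j v : ℕ) (s : ℝ) : Prop :=
  (v = x ∧ s = e j) ∨ (v ≠ x ∧ FirstReception G σ j v s)

/-- The messages `σ` propagate a sequence of pieces of information: the `j`-th one is released by
`x` at date `e j`, and is forwarded along the links allowed by `C j`, when it is received and at
all appearances, by the nodes that do not have a later one. -/
structure Propagates (G : TVG ζ) (σ : ℕ → ℕ → ℝ → Option (Packet M)) (x : ℕ) (e : ℕ → ℝ)
    (C : ℕ → ℕ → ℕ → Prop) : Prop where
  delay : 0 < ζ
  nonneg : 0 ≤ e 0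
  mono : StrictMono e
  finite : ∀ v ∈ G.nodes, ∀ t, {q : ℕ × ℝ | 0 ≤ q.2 ∧ q.2 ≤ t ∧ σ v q.1 q.2 ≠ none}.Finite
  sends_iff : ∀ v ∈ G.nodes, ∀ j w s, SendsInfo σ j v w s ↔ G.present v w s ∧
    Held G σ x e j v s ∧ (∀ i, j < i → ¬ Held G σ x e i v s) ∧ C j v w ∧
    (G.Appears v w s ∨ Fresh G σ x e j v s)

namespace Propagates

variable {x : ℕ} {e : ℕ → ℝ} {C : ℕ → ℕ → ℕ → Prop} (h : Propagates G σ x e C)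
include h

theorem nonneg' (j : ℕ) : 0 ≤ e j := h.nonneg.trans (h.mono.monotone (Nat.zero_le j))

/-- Information cannot outrun journeys: tracing a reception back from sender to sender yields a
journey that departs no earlier than the release. This gives the lower bound in `foremost`. -/
theorem held_journey {j v : ℕ} {s : ℝ} (hv : Held G σ x e j v s) :
    (v = x ∧ e j ≤ s) ∨ (v ≠ x ∧ ∃ d a k, e j ≤ d ∧ a ≤ s ∧ G.Journey x v d a k) := by
  refine date_induction h.delay (p := fun s => ∀ v, Held G σ x e j v s → (v = x ∧ e j ≤ s) ∨
    (v ≠ x ∧ ∃ d a k, e j ≤ d ∧ a ≤ s ∧ G.Journey x v d a k)) (fun s ih v hv => ?_) s v hv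
  rcases hv with hv | ⟨hvx, u, r, hr, hd⟩
  · exact Or.inl hv
  · refine Or.inr ⟨hvx, ?_⟩
    obtain ⟨hc, hs⟩ := delivers_iff.1 hd
    have hu : u ∈ G.nodes := (hc.edge h.delay).mem_left
    have hheld := ((h.sends_iff u hu j v _).1 hs).2.1
    rcases ih (r - ζ) (hc.nonneg h.delay) (by linarith) u hheld with ⟨rfl, h1⟩ | ⟨-, d, a, k, h1, h2, h3⟩
    · exact ⟨r - ζ, r - ζ + ζ, 1, h1, by linarith, .single hc⟩
    · exact ⟨d, r - ζ + ζ, k + 1, h1, by linarith, h3.snoc h2 hc⟩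

theorem held_le {j v : ℕ} {s : ℝ} (hv : Held G σ x e j v s) : e j ≤ s := by
  rcases h.held_journey hv with ⟨-, h1⟩ | ⟨-, d, a, k, h1, h2, h3⟩
  · exact h1
  · have := (h3.bounds h.delay).2.1
    have h0 := h.delay
    have : 0 ≤ k * ζ := by positivity
    linarith

theorem sends_le {j v w : ℕ} (hv : v ∈ G.nodes) {s : ℝ} (hs : SendsInfo σ j v w s) : e j ≤ s :=
  h.held_le ((h.sends_iff v hv j w s).1 hs).2.1

theorem delivers_journey {j u v : ℕ} (hvx : v ≠ x) {r : ℝ} (hd : Delivers G σ j u v r) :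
    ∃ d k, e j ≤ d ∧ G.Journey x v d r k := by
  obtain ⟨hc, hs⟩ := delivers_iff.1 hd
  have hu : u ∈ G.nodes := (hc.edge h.delay).mem_left
  have hr : r - ζ + ζ = r := by ring
  rcases h.held_journey ((h.sends_iff u hu j v _).1 hs).2.1 with ⟨rfl, h1⟩ | ⟨-, d, a, k, h1, h2, h3⟩
  · have hj := TVG.Journey.single hc
    rw [hr] at hj
    exact ⟨r - ζ, 1, h1, hj⟩
  · have hj := h3.snoc h2 hc
    rw [hr] at hj
    exact ⟨d, k + 1, h1, hj⟩

theorem exists_firstReception {j u v : ℕ} {r : ℝ} (hd : Delivers G σ j u v r) :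
    ∃ r', r' ≤ r ∧ FirstReception G σ j v r' := by
  have hfin : {a | a ≤ r ∧ ∃ w, Delivers G σ j w v a}.Finite := by
    refine ((G.nodes.finite_toSet.biUnion fun w hw =>
      (h.finite w hw r).image fun q => q.2 + ζ)).subset ?_
    rintro a ⟨ha, w, hw⟩
    obtain ⟨hc, b, hb⟩ := delivers_iff.1 hw
    simp only [Set.mem_iUnion]
    refine ⟨w, (hc.edge h.delay).mem_left, (v, a - ζ), ⟨hc.nonneg h.delay, ?_, ?_⟩, by simp⟩
    · simp only; linarith [h.delay]
    · simp [hb]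
  obtain ⟨r', ⟨h1, h2⟩, hmin⟩ := Set.exists_min_image _ id hfin ⟨r, le_rfl, u, hd⟩
  refine ⟨r', h1, h2, fun a ha => ?_⟩
  rcases le_total a r with har | har
  · exact hmin a ⟨har, ha⟩
  · exact h1.trans har

theorem exists_fresh {j v : ℕ} {s : ℝ} (hv : Held G σ x e j v s) :
    ∃ r, r ≤ s ∧ Fresh G σ x e j v r := by
  rcases hv with ⟨rfl, hs⟩ | ⟨hvx, u, r, hr, hd⟩
  · exact ⟨e j, hs, Or.inl ⟨rfl, rfl⟩⟩
  · obtain ⟨r', h1, h2⟩ := h.exists_firstReception hd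
    exact ⟨r', h1.trans hr, Or.inr ⟨hvx, h2⟩⟩

/-- A node that has the information in time for a crossing gets it across. -/
theorem delivers_of_crossing {j u w : ℕ} {d s : ℝ} (hu : Held G σ x e j u d) (hds : d ≤ s)
    (hc : G.Crossing u w s) (hC : C j u w) (hs : s < e (j + 1)) :
    ∃ r, r ≤ s + ζ ∧ Delivers G σ j u w r := by
  obtain ⟨r, hrd, hr⟩ := h.exists_fresh hu
  obtain ⟨a, has, haa, hint⟩ := hc.exists_appears h.delay
  have hus : (u ∈ G.nodes) := (hc.edge h.delay).mem_left
  -- The sender forwards at the later of the date `r` at which it gets the information and the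
  -- appearance `a` that begins the contact used by the crossing. Both are at most `s`, and the
  -- contact lasts until `s + ζ`.
  have hmax : max r a ≤ s := max_le (hrd.trans hds) has
  have hcr : G.Crossing u w (max r a) := fun t ht =>
    hint t ((le_max_right _ _).trans ht.1) (by linarith [ht.2])
  have hheld : Held G σ x e j u (max r a) := by
    rcases hr with ⟨rfl, rfl⟩ | ⟨hux, hr⟩
    · exact Or.inl ⟨rfl, le_max_left _ _⟩
    · obtain ⟨w', hw'⟩ := hr.1
      exact Or.inr ⟨hux, w', r, le_max_left _ _, hw'⟩
  refine ⟨max r a + ζ, by linarith, delivers_iff.2 ?_⟩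
  rw [add_sub_cancel_right]
  refine ⟨hcr, (h.sends_iff u hus j w _).2 ⟨hcr.present_left h.delay, hheld, ?_, hC, ?_⟩⟩
  -- No later information has been released before `e (j + 1)`, so none can take precedence.
  · intro i hi hheld'
    have h1 := h.held_le hheld'
    have h2 := h.mono.monotone (Nat.succ_le_of_lt hi)
    simp only [Nat.succ_eq_add_one] at h2
    linarith
  · rcases le_total r a with hle | hle
    · rw [max_eq_right hle]; exact Or.inl haa
    · rw [max_eq_left hle]; exact Or.inr hr

theorem causal {j v w : ℕ} (hv : v ∈ G.nodes) {s : ℝ} (hs : SendsInfo σ j v w s) :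
    (v = x ∧ e j ≤ s) ∨ ∃ u r, r ≤ s ∧ Delivers G σ j u v r :=
  ((h.sends_iff v hv j w s).1 hs).2.1.imp id fun h => h.2

/-- Along a foremost tree the information travels as fast as possible. -/
theorem foremost {j : ℕ} {T : ℕ → ℕ} {R : ℕ → ℝ} (hT : G.ForemostTree x (e j) T R)
    (hC : ∀ v ∈ G.nodes, v ≠ x → C j (T v) v) (hR : ∀ v ∈ G.nodes, R v ≤ e (j + 1))
    {v : ℕ} (hv : v ∈ G.nodes) (hvx : v ≠ x) :
    FirstReception G σ j v (R v) ∧ Delivers G σ j (T v) v (R v) := by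
  have hmin : ∀ v ∈ G.nodes, v ≠ x → ∀ u r, Delivers G σ j u v r → R v ≤ r := by
    intro v hv hvx u r hd
    obtain ⟨d, k, h1, h2⟩ := h.delivers_journey hvx hd
    exact (hT.least v hv hvx).2 ⟨d, k, h1, h2⟩
  suffices hd : Delivers G σ j (T v) v (R v) from
    ⟨⟨⟨_, hd⟩, fun r ⟨u, hu⟩ => hmin v hv hvx u r hu⟩, hd⟩
  -- Induction on the arrival date: the parent is reached in time for the tree crossing, which
  -- delivers by `R v`; by `hmin` nothing is delivered earlier.
  have key := date_induction h.delay (p := fun t => ∀ v ∈ G.nodes, v ≠ x → R v = t →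
    Delivers G σ j (T v) v (R v)) ?_ (R v)
  · exact key v hv hvx rfl
  rintro t ih v hv hvx rfl
  have hcr := hT.crossing v hv hvx
  have hle := hT.le v hv hvx
  have hTv : T v ∈ G.nodes := (hcr.edge h.delay).mem_left
  have hheld : Held G σ x e j (T v) (R (T v)) := by
    by_cases hTx : T v = x
    · exact Or.inl ⟨hTx, by rw [hTx, hT.start]⟩
    · refine Or.inr ⟨hTx, _, _, le_rfl, ih _ ?_ (by linarith) _ hTv hTx rfl⟩
      obtain ⟨d, k, h1, h2⟩ := (hT.least _ hTv hTx).1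
      have hb := h2.bounds h.delay
      have h0 := h.delay
      have : 0 ≤ k * ζ := by positivity
      linarith
  obtain ⟨r, hr, hd⟩ := h.delivers_of_crossing hheld (by linarith) hcr (hC v hv hvx)
    (by linarith [hR v hv, h.delay])
  have hge := hmin v hv hvx _ _ hd
  obtain rfl : r = R v := by linarith
  exact hd

/-- Along a tree of the footprint the information gets one level deeper within every
`Δ + ζ`. -/
theorem shortest {Δ : ℝ} (hΔ : G.RecurrenceBound Δ) {j : ℕ} {T D : ℕ → ℕ}
    (hT : G.ShortestTree x T D) (hC : ∀ u v, C j u v ↔ T v = u ∧ v ≠ x) {W : ℝ}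
    (hW : ∀ v ∈ G.nodes, D v * (Δ + ζ) ≤ W) (hWe : e j + W ≤ e (j + 1))
    {v : ℕ} (hv : v ∈ G.nodes) (hvx : v ≠ x) :
    ∃ r, r ≤ e j + W ∧ FirstReception G σ j v r ∧ Delivers G σ j (T v) v r := by
  have hζ := h.delay
  have key : ∀ n v, v ∈ G.nodes → D v = n → Held G σ x e j v (e j + n * (Δ + ζ)) := by
    intro n
    induction n with
    | zero =>
      intro v hv hn
      refine Or.inl ⟨?_, by simp⟩
      by_contra hvx
      have := hT.depth v hv hvx
      omega
    | succ n ih =>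
      intro v hv hn
      have hvx : v ≠ x := by
        rintro rfl
        rw [hT.start] at hn
        omega
      have he := hT.edge v hv hvx
      have hd := hT.depth v hv hvx
      have hheld := ih _ he.mem_left (by omega)
      have h0 := h.nonneg' j
      have h1 := hΔ.1
      obtain ⟨s, h2, h3, h4⟩ := hΔ.exists_crossing hζ he (s := e j + n * (Δ + ζ)) (by positivity)
      have hWv := hW v hv
      rw [hn] at hWv
      push_cast at hWv ⊢
      obtain ⟨r, h5, h6⟩ := h.delivers_of_crossing hheld h2 h4 ((hC _ _).2 ⟨rfl, hvx⟩) (by linarith)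
      exact Or.inr ⟨hvx, _, r, by linarith, h6⟩
  rcases key _ v hv rfl with ⟨h1, -⟩ | ⟨-, u, r, hr, hd⟩
  · exact absurd h1 hvx
  · obtain ⟨r', h1, h2⟩ := h.exists_firstReception hd
    obtain ⟨w, hw⟩ := h2.1
    obtain ⟨hc, hs⟩ := delivers_iff.1 hw
    -- Only tree links are allowed, so the first delivery necessarily comes from the parent.
    have := ((hC _ _).1 ((h.sends_iff w (hc.edge hζ).mem_left j v _).1 hs).2.2.2.1).1
    exact ⟨r', by linarith [hW v hv], h2, this ▸ hw⟩

end Propagates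

end Propagation

/-! ### Plans: what the emitter computes once it knows enough of the graph -/

/-- The time that the knowledge (if it is not just the number of nodes) says to suffice for seeing
all edges. -/
def Knowledge.horizon : Knowledge → ℝ
  -- A default value: the protocol is only used when a bound or a period is known.
  | .size _ => 1
  | .bound Δ => Δ
  | .sizeBound _ Δ => Δ
  | .period p => p

/-- A node together with the dates of presence of its edges, up to some date. -/
abbrev Fact := ℕ × (ℕ → ℝ → Prop)

namespace TVG

variable {ζ : ℝ} (G : TVG ζ)

/-- What `v` can report about its edges at date `Δ`. -/
def fact (Δ : ℝ) (v : ℕ) : Fact := (v, fun w s => s ≤ Δ ∧ G.present v w s)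

/-- The collected reports of all nodes. -/
def facts (Δ : ℝ) : Set Fact := {f | ∃ v ∈ G.nodes, f = G.fact Δ v}

variable {G} {G' : TVG ζ} {Δ : ℝ}

theorem nodes_eq_of_facts_eq (h : G.facts Δ = G'.facts Δ) : G.nodes = G'.nodes := by
  have key : ∀ {G G' : TVG ζ}, G.facts Δ = G'.facts Δ → ∀ v ∈ G.nodes, v ∈ G'.nodes := by
    intro G G' h v hv
    have hf : G.fact Δ v ∈ G'.facts Δ := h ▸ ⟨v, hv, rfl⟩
    obtain ⟨w, hw, he⟩ := hf
    obtain rfl : v = w := congrArg Prod.fst he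
    exact hw
  exact Finset.ext fun v => ⟨key h v, key h.symm v⟩

theorem present_of_facts_eq (h : G.facts Δ = G'.facts Δ) {u w : ℕ} {s : ℝ} (hs : s ≤ Δ) :
    G.present u w s ↔ G'.present u w s := by
  have key : ∀ {G G' : TVG ζ}, G.facts Δ = G'.facts Δ → G.present u w s → G'.present u w s := by
    intro G G' h hp
    have hf : G.fact Δ u ∈ G'.facts Δ := h ▸ ⟨u, G.mem_left hp, rfl⟩
    obtain ⟨v, hv, he⟩ := hf
    obtain rfl : u = v := congrArg Prod.fst he
    have h2 := congrFun (congrFun (congrArg Prod.snd he) w) s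
    simp only [fact, eq_iff_iff] at h2
    exact (h2.1 ⟨hs, hp⟩).2
  exact ⟨key h, key h.symm⟩

theorem edge_of_facts_eq (h : G.facts Δ = G'.facts Δ) (hΔ : G.RecurrenceBound Δ)
    (hΔ' : G'.RecurrenceBound Δ) {u w : ℕ} : G.Edge u w ↔ G'.Edge u w := by
  rw [hΔ.edge_iff, hΔ'.edge_iff]
  exact exists_congr fun s => and_congr_right fun hs => present_of_facts_eq h hs

/-- Reports that cover a whole period determine the entire graph, whereas with a mere recurrence
bound they determine the nodes and the footprint. -/
theorem eq_of_facts_eq (h : G.facts Δ = G'.facts Δ) (hp : G.IsPeriod Δ) (hp' : G'.IsPeriod Δ) :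
    G = G' := by
  refine ext' (nodes_eq_of_facts_eq h) ?_
  have key : ∀ {G G' : TVG ζ}, G.facts Δ = G'.facts Δ → G.IsPeriod Δ → G'.IsPeriod Δ →
      ∀ u w t, G.present u w t → G'.present u w t := by
    intro G G' h hp hp' u w t ht
    obtain ⟨n, h1, h2⟩ := exists_sub_mul_mem hp.1 (G.nonneg ht)
    have h3 : G.present u w (t - n * Δ) := (hp.add_mul n h1).2 (by simpa using ht)
    simpa using (hp'.add_mul n h1).1 ((present_of_facts_eq h (by linarith)).1 h3)
  funext u w t
  exact propext ⟨key h hp hp' u w t, key h.symm hp' hp u w t⟩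

end TVG

/-- A plan of the emitter: to wait for `delay` before the broadcasts, which use the tree given by
`parent` and take at most the time `span`. -/
structure Plan where
  delay : ℝ
  parent : ℕ → ℕ
  span : ℝ

instance : Nonempty Plan := ⟨⟨0, id, 0⟩⟩

/-- The plan serves its purpose for the graph `G`, the emitter `x` and the emission date `t₀`. -/
def Plan.Suits {ζ : ℝ} (pl : Plan) (G : TVG ζ) (Δ : ℝ) (x : ℕ) (t₀ : ℝ) : Objective → Prop
  | .shortest => pl.delay = 0 ∧ ∃ D, G.ShortestTree x pl.parent D ∧
      ∀ v ∈ G.nodes, D v * (Δ + ζ) ≤ pl.span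
  | .foremost => pl.delay = 0 ∧ ∃ R, G.ForemostTree x t₀ pl.parent R ∧
      ∀ v ∈ G.nodes, R v ≤ t₀ + pl.span
  | .fastest => ∃ R d, IsLeast (broadcastDurations G x t₀) d ∧
      G.ForemostTree x (t₀ + pl.delay) pl.parent R ∧
      ∀ v ∈ G.nodes, R v ≤ t₀ + pl.delay + d ∧ d ≤ pl.span

/-- The graphs for which trees can be planned from the presence of edges up to date `Δ`. -/
structure TVG.Plannable {ζ : ℝ} (G : TVG ζ) (P : Objective) (Δ : ℝ) : Prop where
  connected : G.footprint.Connected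
  bound : G.RecurrenceBound Δ
  period : P ≠ .shortest → G.IsPeriod Δ

/-- The conditions that a plan made from the reports `F` has to satisfy. -/
def Plan.Valid (ζ : ℝ) (P : Objective) (Δ : ℝ) (F : Set Fact) (x : ℕ) (t₀ : ℝ) (pl : Plan) : Prop :=
  0 ≤ pl.delay ∧ 0 ≤ pl.span ∧ ∃ G : TVG ζ, G.Plannable P Δ ∧ G.facts Δ = F ∧ pl.Suits G Δ x t₀ P

/-- A plan made from the reports `F`. -/
noncomputable def makePlan (ζ : ℝ) (P : Objective) (Δ : ℝ) (F : Set Fact) (x : ℕ) (t₀ : ℝ) : Plan :=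
  Classical.epsilon (Plan.Valid ζ P Δ F x t₀)

/-- The emitter chooses its plan from the reports alone, as one that suits some graph with these
reports. The choice suits the actual graph because shortest plans depend on the footprint only and,
for the other objectives, the two graphs coincide. -/
theorem Plan.Suits.congr {ζ : ℝ} {G G' : TVG ζ} {P : Objective} {Δ : ℝ} {x : ℕ} {t₀ : ℝ}
    {pl : Plan} (hG : G.Plannable P Δ) (hG' : G'.Plannable P Δ) (hF : G'.facts Δ = G.facts Δ)
    (h : pl.Suits G' Δ x t₀ P) : pl.Suits G Δ x t₀ P := by
  by_cases hP : P = .shortest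
  · subst hP
    obtain ⟨h0, D, hT, hD⟩ := h
    have hn := TVG.nodes_eq_of_facts_eq hF
    have he : ∀ {u w}, G'.Edge u w ↔ G.Edge u w := TVG.edge_of_facts_eq hF hG'.bound hG.bound
    refine ⟨h0, D, ⟨hT.root, hT.start, ?_, ?_, ?_⟩, ?_⟩
    · exact fun v hv hvx => he.1 (hT.edge v (hn ▸ hv) hvx)
    · exact fun v hv hvx => hT.depth v (hn ▸ hv) hvx
    · exact fun u w h => hT.le u w (he.2 h)
    · exact fun v hv => hD v (hn ▸ hv)
  · rwa [TVG.eq_of_facts_eq hF (hG'.period hP) (hG.period hP)] at h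

theorem exists_plan {ζ : ℝ} (hζ : 0 < ζ) {G : TVG ζ} {P : Objective} {Δ : ℝ}
    (hG : G.Plannable P Δ) {x : ℕ} (hx : x ∈ G.nodes) {t₀ : ℝ} (ht₀ : 0 ≤ t₀) :
    ∃ pl : Plan, 0 ≤ pl.delay ∧ 0 ≤ pl.span ∧ pl.Suits G Δ x t₀ P := by
  have hbd : ∀ f : ℕ → ℝ, ∀ v ∈ G.nodes, f v ≤ ∑ v ∈ G.nodes, |f v| := fun f v hv =>
    (le_abs_self _).trans (Finset.single_le_sum (f := fun v => |f v|) (fun _ _ => abs_nonneg _) hv)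
  have hbd0 : ∀ f : ℕ → ℝ, 0 ≤ ∑ v ∈ G.nodes, |f v| := fun f =>
    Finset.sum_nonneg fun _ _ => abs_nonneg _
  cases P with
  | shortest =>
    obtain ⟨T, D, hT⟩ := TVG.exists_shortestTree hG.connected hx
    exact ⟨⟨0, T, ∑ v ∈ G.nodes, |D v * (Δ + ζ)|⟩, le_rfl, hbd0 _, rfl, D, hT, hbd _⟩
  | foremost =>
    obtain ⟨T, R, hT⟩ := hG.bound.exists_foremostTree hζ hG.connected hx ht₀
    exact ⟨⟨0, T, ∑ v ∈ G.nodes, |R v - t₀|⟩, le_rfl, hbd0 _, rfl, R, hT,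
      fun v hv => by have := hbd (fun v => R v - t₀) v hv; simp only at this ⊢; linarith⟩
  | fastest =>
    have hp := hG.period (by simp)
    obtain ⟨d, hd⟩ := hp.exists_fastest hζ hG.connected hx ht₀
    obtain ⟨hd0, a, ha, hj⟩ := hd.1
    obtain ⟨T, R, hT⟩ := hG.bound.exists_foremostTree hζ hG.connected hx (ht₀.trans ha)
    refine ⟨⟨a - t₀, T, d⟩, sub_nonneg.2 ha, hd0, R, d, hd, ?_, fun v hv => ⟨?_, le_rfl⟩⟩
    · simpa using hT
    · simp only [add_sub_cancel]
      by_cases hvx : v = x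
      · rw [hvx, hT.start]; linarith
      · obtain ⟨dep, arr, h, h1, h2, h3⟩ := hj v hv hvx
        exact ((hT.least v hv hvx).2 ⟨dep, h, h2, h1⟩).trans h3

theorem makePlan_spec {ζ : ℝ} (hζ : 0 < ζ) {G : TVG ζ} {P : Objective} {Δ : ℝ}
    (hG : G.Plannable P Δ) {x : ℕ} (hx : x ∈ G.nodes) {t₀ : ℝ} (ht₀ : 0 ≤ t₀) :
    0 ≤ (makePlan ζ P Δ (G.facts Δ) x t₀).delay ∧ 0 ≤ (makePlan ζ P Δ (G.facts Δ) x t₀).span ∧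
      (makePlan ζ P Δ (G.facts Δ) x t₀).Suits G Δ x t₀ P := by
  obtain ⟨pl, h1, h2, h3⟩ := exists_plan hζ hG hx ht₀
  obtain ⟨h4, h5, G', hG', hF, h6⟩ :=
    Classical.epsilon_spec (p := Plan.Valid ζ P Δ (G.facts Δ) x t₀) ⟨pl, h1, h2, G, hG, rfl, h3⟩
  exact ⟨h4, h5, h6.congr hG hG' hF⟩

/-- The time from one broadcast to the next one. -/
noncomputable def Plan.gap (pl : Plan) (Δ : ℝ) : ℝ := (⌈pl.span / Δ⌉₊ + 1 : ℕ) * Δ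

/-- The gap is a multiple of `Δ`, so that releases keep their phase if `Δ` is a period; the
additional `Δ` makes the inequality strict, which separates termination from the next start. -/
theorem Plan.span_lt_gap (pl : Plan) {Δ : ℝ} (hΔ : 0 < Δ) : pl.span < pl.gap Δ := by
  unfold Plan.gap
  have h := Nat.le_ceil (pl.span / Δ)
  rw [div_le_iff₀ hΔ] at h
  push_cast
  linarith

/-! ### The protocol -/

/-- The contents of a message: the reports known to the sender, and the links along which the
information is to be forwarded. -/
structure Content where
  facts : Set Fact
  allow : ℕ → ℕ → Prop

namespace View

variable (ζ : ℝ) (P : Objective) (ν : View Content)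

/-- The reports known at date `t`. -/
def known (t : ℝ) : Set Fact :=
  {f | (ν.know.horizon ≤ t ∧ f = (ν.id, fun w s => s ≤ ν.know.horizon ∧ ν.presence w s)) ∨
    ∃ w s q, s ≤ t ∧ ν.received w s = some q ∧ f ∈ q.body.facts}

end View

/-- The reports `F` include one of `x` and one of every neighbour of a node with a report. -/
def Complete (x : ℕ) (F : Set Fact) : Prop :=
  (∃ f ∈ F, f.1 = x) ∧ ∀ f ∈ F, ∀ w s, f.2 w s → ∃ g ∈ F, g.1 = w

namespace View

variable (ζ : ℝ) (P : Objective) (ν : View Content)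

/-- The emitter has found the reports to be complete at the date `t₀ + m * Δ`. -/
def Decided (t₀ : ℝ) (m : ℕ) : Prop :=
  IsLeast {m : ℕ | t₀ + m * ν.know.horizon ≤ ν.now ∧
    Complete ν.id (ν.known (t₀ + m * ν.know.horizon))} m

/-- The plan of the emitter, made at the date `t₀ + m * Δ`. -/
noncomputable def plan (t₀ : ℝ) (m : ℕ) : Plan :=
  makePlan ζ P ν.know.horizon (ν.known (t₀ + m * ν.know.horizon)) ν.id t₀

/-- The `j`-th information is to be released at date `e`, for distribution along the links in
`C`. -/
def Starts (j : ℕ) (e : ℝ) (C : ℕ → ℕ → Prop) : Prop :=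
  ∃ t₀, ν.emission = some t₀ ∧
    -- The first foremost broadcast has to leave at `t₀`, before any tree is known, and therefore
    -- uses all links. Every other release waits for the decision.
    ((P = .foremost ∧ j = 0) → e = t₀ ∧ C = fun _ _ => True) ∧
    (¬ (P = .foremost ∧ j = 0) → ∃ m, ν.Decided t₀ m ∧
      e = t₀ + m * ν.know.horizon + (ν.plan ζ P t₀ m).delay +
        j * (ν.plan ζ P t₀ m).gap ν.know.horizon ∧
      C = fun v w => (ν.plan ζ P t₀ m).parent w = v ∧ w ≠ ν.id)

/-- The `j`-th broadcast has surely ended now. -/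
def Terminated (j : ℕ) : Prop :=
  ∃ t₀ m, ν.emission = some t₀ ∧ ν.Decided t₀ m ∧
    ν.now = t₀ + m * ν.know.horizon + (ν.plan ζ P t₀ m).delay +
        j * (ν.plan ζ P t₀ m).gap ν.know.horizon + (ν.plan ζ P t₀ m).span

/-- The node has the `j`-th information. -/
def Holds (j : ℕ) : Prop :=
  (ν.emission ≠ none ∧ ∃ e C, ν.Starts ζ P j e C ∧ e ≤ ν.now) ∨
  (ν.emission = none ∧ ∃ w s b, ν.received w s = some ⟨some j, b⟩)

/-- The node gets the `j`-th information now. -/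
def Gets (j : ℕ) : Prop :=
  (ν.emission ≠ none ∧ ∃ C, ν.Starts ζ P j ν.now C) ∨
  (ν.emission = none ∧ (∃ w b, ν.received w ν.now = some ⟨some j, b⟩) ∧
    ∀ w s b, ν.received w s = some ⟨some j, b⟩ → ν.now ≤ s)

/-- The links along which the `j`-th information is to be forwarded. -/
def Allows (j : ℕ) (a b : ℕ) : Prop :=
  (ν.emission ≠ none ∧ ∃ e C, ν.Starts ζ P j e C ∧ C a b) ∨
  (ν.emission = none ∧ ∃ w s q, ν.received w s = some ⟨some j, q⟩ ∧ q.allow a b)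

/-- The edge to `w` appears now. -/
def AppearsNow (w : ℕ) : Prop :=
  ν.presence w ν.now ∧ ∀ s < ν.now, ∃ r, s < r ∧ r < ν.now ∧ ¬ ν.presence w r

/-- The `j`-th information is to be sent to `w` now. -/
def Forwards (w j : ℕ) : Prop :=
  ν.presence w ν.now ∧ ν.Holds ζ P j ∧ (∀ i, j < i → ¬ ν.Holds ζ P i) ∧ ν.Allows ζ P j ν.id w ∧
    (ν.AppearsNow w ∨ ν.Gets ζ P j)

/-- A report is to be sent to `w` now. -/
def Reports (w : ℕ) : Prop :=
  ν.presence w ν.now ∧ (ν.AppearsNow w ∨ ∃ m : ℕ, ν.now = m * ν.know.horizon)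

open Classical in
/-- The message to `w`. -/
noncomputable def message (w : ℕ) : Option (Packet Content) :=
  if h : ∃ j, ν.Forwards ζ P w j then
    some ⟨some h.choose, ν.known ν.now, ν.Allows ζ P h.choose⟩
  else if ν.Reports w then some ⟨none, ν.known ν.now, fun _ _ => True⟩ else none

variable {ζ P ν}

/-- Only the latest information held is forwarded, so one message never has to carry two pieces. -/
theorem Forwards.unique {w i j : ℕ} (hi : ν.Forwards ζ P w i) (hj : ν.Forwards ζ P w j) :
    i = j := by
  rcases lt_trichotomy i j with h | h | h
  · exact absurd hj.2.1 (hi.2.2.1 j h)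
  · exact h
  · exact absurd hi.2.1 (hj.2.2.1 i h)

theorem message_info_iff {w j : ℕ} {b : Content} :
    ν.message ζ P w = some ⟨some j, b⟩ ↔
      ν.Forwards ζ P w j ∧ b = ⟨ν.known ν.now, ν.Allows ζ P j⟩ := by
  unfold message
  split_ifs with h1 h2
  · constructor
    · intro h
      simp only [Option.some.injEq, Packet.mk.injEq] at h
      obtain ⟨rfl, rfl⟩ := h
      exact ⟨h1.choose_spec, rfl⟩
    · rintro ⟨h, rfl⟩
      rw [h1.choose_spec.unique h]
  · simp only [Option.some.injEq, Packet.mk.injEq, reduceCtorEq, false_and, false_iff, not_and]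
    exact fun h => absurd ⟨j, h⟩ h1
  · simp only [false_iff, not_and]
    exact fun h => absurd ⟨j, h⟩ h1

/-- Information messages carry the reports too, so they may replace control messages without slowing
the reports down. -/
theorem facts_of_message {w : ℕ} {q : Packet Content} (h : ν.message ζ P w = some q) :
    q.body.facts = ν.known ν.now := by
  unfold message at h
  split_ifs at h
  · simp only [Option.some.injEq] at h; rw [← h]
  · simp only [Option.some.injEq] at h; rw [← h]

theorem message_ne_none_iff {w : ℕ} :
    ν.message ζ P w ≠ none ↔ (∃ j, ν.Forwards ζ P w j) ∨ ν.Reports w := by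
  unfold message
  split_ifs with h1 h2 <;> simp [*]

end View

/-- The protocol that reuses trees for the objective `P`. -/
noncomputable def treeProtocol (ζ : ℝ) (P : Objective) : Protocol where
  Msg := Content
  send ν w := ν.message ζ P w
  begins ν j := ∃ C, ν.Starts ζ P j ν.now C
  terminated ν j := ν.Terminated ζ P j

/-! ### Runs of the protocol: what the nodes learn, hold and send -/

section Analysis

variable {ζ : ℝ} {G : TVG ζ} {κ : Knowledge} {x : ℕ} {t₀ : ℝ} {P : Objective}
  {σ : ℕ → ℕ → ℝ → Option (Packet Content)}

variable (G κ σ) in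
/-- The reports that have reached `v` by date `s`. -/
def Learned (v : ℕ) (s : ℝ) : Set Fact :=
  {f | (κ.horizon ≤ s ∧ f = G.fact κ.horizon v) ∨
    ∃ w r q, r ≤ s ∧ arrival G σ w v r = some q ∧ f ∈ q.body.facts}

theorem view_received {v w : ℕ} {t s : ℝ} {q : Packet Content} :
    (view G κ x t₀ σ v t).received w s = some q ↔ s ≤ t ∧ arrival G σ w v s = some q := by
  simp only [view]
  split_ifs with h <;> simp [h]

/-- What was known at date `s` looks the same in every later view; this keeps the emitter's decision
stable. -/
theorem known_view {v : ℕ} {s t : ℝ} (hst : s ≤ t) :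
    (view G κ x t₀ σ v t).known s = Learned G κ σ v s := by
  ext f
  simp only [View.known, Learned, view_received, Set.mem_ofPred_eq]
  refine or_congr (and_congr_right fun hs => ?_) ?_
  · have hs' : κ.horizon ≤ s := hs
    have : (fun w r => r ≤ κ.horizon ∧ r ≤ t ∧ G.present v w r) =
        fun w r => r ≤ κ.horizon ∧ G.present v w r := by
      funext w r
      exact propext ⟨fun h => ⟨h.1, h.2.2⟩, fun h => ⟨h.1, by linarith [h.1], h.2⟩⟩
    simp only [view, TVG.fact] at this ⊢
    rw [this]
  · refine exists_congr fun w => exists_congr fun r => exists_congr fun q => ?_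
    exact ⟨fun h => ⟨h.1, h.2.1.2, h.2.2⟩, fun h => ⟨h.1, ⟨h.1.trans hst, h.2.1⟩, h.2.2⟩⟩

theorem appearsNow_view {v w : ℕ} {t : ℝ} :
    (view G κ x t₀ σ v t).AppearsNow w ↔ G.Appears v w t := by
  simp only [View.AppearsNow, TVG.Appears, view, le_refl, true_and]
  refine and_congr_right fun _ => forall_congr' fun s => forall_congr' fun _ =>
    exists_congr fun r => and_congr_right fun _ => and_congr_right fun hr => ?_
  simp [hr.le]

theorem presence_now_view {v w : ℕ} {t : ℝ} :
    (view G κ x t₀ σ v t).presence w (view G κ x t₀ σ v t).now ↔ G.present v w t := by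
  simp [view]

theorem reports_view {v w : ℕ} {t : ℝ} : (view G κ x t₀ σ v t).Reports w ↔
    G.present v w t ∧ (G.Appears v w t ∨ ∃ m : ℕ, t = m * κ.horizon) := by
  rw [View.Reports, presence_now_view, appearsNow_view]
  rfl

theorem Learned.mono {v : ℕ} {s t : ℝ} (hst : s ≤ t) :
    Learned G κ σ v s ⊆ Learned G κ σ v t := by
  rintro f (⟨h1, h2⟩ | ⟨w, r, q, h1, h2⟩)
  · exact Or.inl ⟨h1.trans hst, h2⟩
  · exact Or.inr ⟨w, r, q, h1.trans hst, h2⟩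

theorem emission_emitter {t : ℝ} (h : t₀ ≤ t) : (view G κ x t₀ σ x t).emission = some t₀ := by
  simp [view, h]

theorem emission_eq_none {v : ℕ} {t : ℝ} (h : v ≠ x ∨ t < t₀) :
    (view G κ x t₀ σ v t).emission = none := by
  rcases h with h | h <;> simp [view, h]

variable (hσ : ∀ v w t, σ v w t = (view G κ x t₀ σ v t).message ζ P w)
include hσ

theorem sendsInfo_iff {j v w : ℕ} {t : ℝ} :
    SendsInfo σ j v w t ↔ (view G κ x t₀ σ v t).Forwards ζ P w j := by
  simp [SendsInfo, hσ, View.message_info_iff]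

theorem facts_of_sends {v w : ℕ} {t : ℝ} {q : Packet Content} (h : σ v w t = some q) :
    q.body.facts = Learned G κ σ v t := by
  rw [hσ] at h
  rw [View.facts_of_message h]
  exact known_view le_rfl

/-! #### The reports -/

section Reports

variable (hζ : 0 < ζ)
include hζ

theorem learned_subset (v : ℕ) (hv : v ∈ G.nodes) (s : ℝ) :
    Learned G κ σ v s ⊆ G.facts κ.horizon := by
  refine date_induction hζ (p := fun s => ∀ v ∈ G.nodes,
    Learned G κ σ v s ⊆ G.facts κ.horizon) (fun s ih v hv => ?_) s v hv
  rintro f (⟨-, rfl⟩ | ⟨w, r, q, h1, h2, h3⟩)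
  · exact ⟨v, hv, rfl⟩
  · obtain ⟨hc, hs⟩ := arrival_eq_some.1 h2
    rw [facts_of_sends hσ hs] at h3
    exact ih _ (hc.nonneg hζ) (by linarith) w (hc.edge hζ).mem_left h3

theorem learned_of_crossing {v w : ℕ} {s : ℝ} (hc : G.Crossing v w s)
    (hs : G.Appears v w s ∨ ∃ m : ℕ, s = m * κ.horizon) :
    Learned G κ σ v s ⊆ Learned G κ σ w (s + ζ) := by
  intro f hf
  have h1 : σ v w s ≠ none := by
    rw [hσ, View.message_ne_none_iff]
    exact Or.inr (reports_view.2 ⟨hc.present_left hζ, hs⟩)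
  obtain ⟨q, hq⟩ := Option.ne_none_iff_exists'.1 h1
  refine Or.inr ⟨v, s + ζ, q, le_rfl, ?_, ?_⟩
  · rw [arrival_eq_some, add_sub_cancel_right]
    exact ⟨hc, hq⟩
  · rwa [facts_of_sends hσ hq]

/-- Reports cross an edge at its next appearance. An edge that stays for ever may have none, and for
it the sending dates at multiples of the horizon are needed. -/
theorem learned_of_edge (hΔ : G.RecurrenceBound κ.horizon) {v w : ℕ} (he : G.Edge v w) {f : Fact}
    (hf : ∃ s, 0 ≤ s ∧ f ∈ Learned G κ σ v s) : ∃ s, 0 ≤ s ∧ f ∈ Learned G κ σ w s := by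
  obtain ⟨s, hs, hf⟩ := hf
  have h0 := hΔ.1
  have key : ∃ r, s ≤ r ∧ G.Crossing v w r ∧
      (G.Appears v w r ∨ ∃ m : ℕ, r = m * κ.horizon) := by
    rcases hΔ.appears_or_forever hζ he hs with h | ⟨a, h1, -, h3⟩
    · refine ⟨⌈s / κ.horizon⌉₊ * κ.horizon, ?_, ?_, Or.inr ⟨_, rfl⟩⟩
      · have := Nat.le_ceil (s / κ.horizon)
        rwa [div_le_iff₀ h0] at this
      · intro t ht
        have := Nat.le_ceil (s / κ.horizon)
        rw [div_le_iff₀ h0] at this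
        exact h t (this.trans ht.1)
    · exact ⟨a, h1.le, h3.crossing, Or.inl h3⟩
  obtain ⟨r, h1, h2, h3⟩ := key
  exact ⟨r + ζ, by linarith, learned_of_crossing hσ hζ h2 h3 (Learned.mono h1 hf)⟩

theorem exists_learned (hΔ : G.RecurrenceBound κ.horizon) (hc : G.footprint.Connected)
    (hx : x ∈ G.nodes) : ∃ m : ℕ, G.facts κ.horizon ⊆ Learned G κ σ x (t₀ + m * κ.horizon) := by
  have h0 := hΔ.1
  have h1 : ∀ u : ℕ, ∃ s, u ∈ G.nodes → G.fact κ.horizon u ∈ Learned G κ σ x s := by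
    intro u
    by_cases hu : u ∈ G.nodes
    · obtain ⟨s, -, hs⟩ := TVG.mem_of_edge_closed hc
        (S := {v | ∃ s, 0 ≤ s ∧ G.fact κ.horizon u ∈ Learned G κ σ v s}) hu
        ⟨κ.horizon, h0.le, Or.inl ⟨le_rfl, rfl⟩⟩
        (fun v w he hv => learned_of_edge hσ hζ hΔ he hv) hx
      exact ⟨s, fun _ => hs⟩
    · exact ⟨0, fun h => absurd h hu⟩
  choose s hs using h1
  obtain ⟨B, hB⟩ := (G.nodes.finite_toSet.image s).bddAbove
  obtain ⟨m, hm⟩ := exists_nat_gt ((B - t₀) / κ.horizon)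
  rw [div_lt_iff₀ h0] at hm
  refine ⟨m, ?_⟩
  rintro f ⟨u, hu, rfl⟩
  exact Learned.mono (by linarith [hB (Set.mem_image_of_mem s hu)]) (hs u hu)

/-- The number of nodes need not be known: every edge is seen within the horizon, so the reporting
nodes form a set closed under adjacency that contains `x`, and by connectedness this is everything.
-/
theorem complete_iff (hΔ : G.RecurrenceBound κ.horizon) (hc : G.footprint.Connected)
    (hx : x ∈ G.nodes) {s : ℝ} :
    Complete x (Learned G κ σ x s) ↔ Learned G κ σ x s = G.facts κ.horizon := by
  have hsub := learned_subset hσ hζ x hx s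
  constructor
  · rintro ⟨⟨f, hf, hfx⟩, hcl⟩
    refine hsub.antisymm ?_
    have hS := fun {v} => TVG.mem_of_edge_closed (v := v) hc
      (S := {v | ∃ f ∈ Learned G κ σ x s, f.1 = v}) hx ⟨f, hf, hfx⟩ ?_
    · rintro _ ⟨v, hv, rfl⟩
      obtain ⟨g, hg, hgv⟩ := hS hv
      obtain ⟨w, -, rfl⟩ := hsub hg
      obtain rfl : w = v := hgv
      exact hg
    · rintro u w he ⟨g, hg, hgu⟩
      obtain ⟨u', -, rfl⟩ := hsub hg
      obtain rfl : u' = u := hgu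
      obtain ⟨s', h1, h2⟩ := hΔ.edge_iff.1 he
      exact hcl _ hg w s' ⟨h1, h2⟩
  · intro h
    rw [h]
    refine ⟨⟨_, ⟨x, hx, rfl⟩, rfl⟩, ?_⟩
    rintro _ ⟨u, hu, rfl⟩ w s' hw
    exact ⟨_, ⟨w, TVG.mem_right hw.2, rfl⟩, rfl⟩

/-- The emitter makes its decision at the same date in all later views, and knows all reports
then. -/
theorem exists_decided (hΔ : G.RecurrenceBound κ.horizon) (hc : G.footprint.Connected)
    (hx : x ∈ G.nodes) : ∃ m₀ : ℕ,
      Learned G κ σ x (t₀ + m₀ * κ.horizon) = G.facts κ.horizon ∧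
      ∀ t m, (view G κ x t₀ σ x t).Decided t₀ m ↔ m = m₀ ∧ t₀ + m₀ * κ.horizon ≤ t := by
  classical
  have hex : ∃ m : ℕ, Complete x (Learned G κ σ x (t₀ + m * κ.horizon)) := by
    obtain ⟨m, hm⟩ := exists_learned hσ hζ hΔ hc hx (t₀ := t₀)
    exact ⟨m, (complete_iff hσ hζ hΔ hc hx).2 ((learned_subset hσ hζ x hx _).antisymm hm)⟩
  -- A first success exists because completeness is tested only at the discrete dates `t₀ + m *
  -- κ.horizon`.
  refine ⟨Nat.find hex, (complete_iff hσ hζ hΔ hc hx).1 (Nat.find_spec hex), fun t m => ?_⟩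
  have hset : {m : ℕ | t₀ + m * κ.horizon ≤ t ∧
      Complete x ((view G κ x t₀ σ x t).known (t₀ + m * κ.horizon))} =
      {m : ℕ | t₀ + m * κ.horizon ≤ t ∧ Complete x (Learned G κ σ x (t₀ + m * κ.horizon))} := by
    ext m
    exact and_congr_right fun h => by rw [known_view h]
  have hdef : (view G κ x t₀ σ x t).Decided t₀ m ↔ IsLeast {m : ℕ | t₀ + m * κ.horizon ≤ t ∧
      Complete x ((view G κ x t₀ σ x t).known (t₀ + m * κ.horizon))} m := Iff.rfl
  rw [hdef, hset]
  constructor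
  · rintro ⟨⟨h1, h2⟩, h3⟩
    have h4 : Nat.find hex ≤ m := Nat.find_min' hex h2
    have h5 : t₀ + Nat.find hex * κ.horizon ≤ t := by
      have : (Nat.find hex : ℝ) ≤ m := by exact_mod_cast h4
      nlinarith [hΔ.1]
    exact ⟨le_antisymm (h3 ⟨h5, Nat.find_spec hex⟩) h4, h5⟩
  · rintro ⟨rfl, h⟩
    exact ⟨⟨h, Nat.find_spec hex⟩, fun m hm => Nat.find_min' hex hm.2⟩

end Reports

omit hσ

/-! #### The information -/

/-- The date at which the `j`-th information is released if the plan `pl` is made at date `c`. -/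
noncomputable def Plan.release (pl : Plan) (P : Objective) (Δ t₀ c : ℝ) (j : ℕ) : ℝ :=
  open Classical in if P = .foremost ∧ j = 0 then t₀ else c + pl.delay + j * pl.gap Δ

/-- The links along which the `j`-th information is sent. -/
def Plan.links (pl : Plan) (P : Objective) (x j : ℕ) (v w : ℕ) : Prop :=
  (P = .foremost ∧ j = 0) ∨ (pl.parent w = v ∧ w ≠ x)

theorem Plan.release_of_not {pl : Plan} {P : Objective} {Δ t₀ c : ℝ} {j : ℕ}
    (h : ¬ (P = .foremost ∧ j = 0)) :
    pl.release P Δ t₀ c j = c + pl.delay + j * pl.gap Δ := if_neg h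

theorem Plan.release_of {pl : Plan} {P : Objective} {Δ t₀ c : ℝ} {j : ℕ}
    (h : P = .foremost ∧ j = 0) : pl.release P Δ t₀ c j = t₀ := if_pos h

theorem Plan.strictMono_release {pl : Plan} {P : Objective} {Δ t₀ c : ℝ} (hΔ : 0 < Δ)
    (h0 : 0 ≤ pl.delay) (h1 : 0 ≤ pl.span) (hc : t₀ ≤ c) : StrictMono (pl.release P Δ t₀ c) := by
  have hgap := h1.trans_lt (pl.span_lt_gap hΔ)
  refine strictMono_nat_of_lt_succ fun j => ?_
  rw [Plan.release_of_not (j := j + 1) (by simp)]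
  by_cases hj : P = .foremost ∧ j = 0
  · rw [Plan.release_of hj, hj.2]
    push_cast
    linarith
  · rw [Plan.release_of_not hj]
    push_cast
    linarith

/-- The emitter acts according to the plan `pl` made at date `c`. -/
structure ActsBy (ζ : ℝ) (G : TVG ζ) (κ : Knowledge) (x : ℕ) (t₀ : ℝ) (P : Objective)
    (σ : ℕ → ℕ → ℝ → Option (Packet Content)) (pl : Plan) (c : ℝ) : Prop where
  run : ∀ v w t, σ v w t = (view G κ x t₀ σ v t).message ζ P w
  le : t₀ ≤ c
  delay : 0 ≤ pl.delay
  span : 0 ≤ pl.span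
  starts_iff : ∀ t, t₀ ≤ t → ∀ j e C, (view G κ x t₀ σ x t).Starts ζ P j e C ↔
    e = pl.release P κ.horizon t₀ c j ∧ C = pl.links P x j ∧ (¬ (P = .foremost ∧ j = 0) → c ≤ t)
  terminated_iff : ∀ t, t₀ ≤ t → ∀ j, (view G κ x t₀ σ x t).Terminated ζ P j ↔
    t = c + pl.delay + j * pl.gap κ.horizon + pl.span

theorem exists_actsBy (hσ : ∀ v w t, σ v w t = (view G κ x t₀ σ v t).message ζ P w) (hζ : 0 < ζ)
    (hG : G.Plannable P κ.horizon) (hx : x ∈ G.nodes) (ht₀ : 0 ≤ t₀) :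
    ∃ (pl : Plan) (m : ℕ), pl.Suits G κ.horizon x t₀ P ∧
      ActsBy ζ G κ x t₀ P σ pl (t₀ + m * κ.horizon) := by
  obtain ⟨m₀, hL, hdec⟩ := exists_decided hσ hζ hG.bound hG.connected hx (t₀ := t₀)
  obtain ⟨h1, h2, h3⟩ := makePlan_spec hζ hG hx ht₀
  set pl := makePlan ζ P κ.horizon (G.facts κ.horizon) x t₀ with hpl
  have hΔ := hG.bound.1
  have hle : t₀ ≤ t₀ + m₀ * κ.horizon := by
    have : 0 ≤ m₀ * κ.horizon := by positivity
    linarith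
  have hplan : ∀ t, t₀ + m₀ * κ.horizon ≤ t → (view G κ x t₀ σ x t).plan ζ P t₀ m₀ = pl := by
    intro t ht
    have : (view G κ x t₀ σ x t).known (t₀ + m₀ * κ.horizon) = G.facts κ.horizon := by
      rw [known_view ht, hL]
    unfold View.plan
    exact congrArg (fun F => makePlan ζ P κ.horizon F x t₀) this
  have hgap := h2.trans_lt (pl.span_lt_gap hΔ)
  refine ⟨pl, m₀, h3, hσ, hle, h1, h2, fun t ht j e C => ?_, fun t ht j => ?_⟩
  · unfold View.Starts
    simp only [emission_emitter ht, Option.some.injEq, exists_eq_left', hdec]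
    by_cases hj : P = .foremost ∧ j = 0
    · rw [Plan.release_of hj]
      have : pl.links P x j = fun _ _ => True := by
        funext a b
        simp [Plan.links, hj]
      rw [this]
      simp [hj]
    · rw [Plan.release_of_not hj]
      have hlinks : pl.links P x j = fun v w => pl.parent w = v ∧ w ≠ x := by
        funext a b
        simp [Plan.links, hj]
      rw [hlinks]
      simp only [hj, false_imp_iff, true_and, not_false_eq_true, true_imp_iff]
      constructor
      · rintro ⟨m, ⟨rfl, h⟩, h5, h6⟩
        rw [hplan t h] at h5 h6
        exact ⟨h5, h6, h⟩
      · rintro ⟨h5, h6, h⟩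
        refine ⟨m₀, ⟨rfl, h⟩, ?_⟩
        rw [hplan t h]
        exact ⟨h5, h6⟩
  · unfold View.Terminated
    simp only [emission_emitter ht, Option.some.injEq, exists_and_left, exists_eq_left', hdec]
    constructor
    · rintro ⟨m, ⟨rfl, h⟩, h5⟩
      rw [hplan t h] at h5
      exact h5
    · intro h
      have hc : t₀ + m₀ * κ.horizon ≤ t := by
        have : 0 ≤ (j : ℝ) * pl.gap κ.horizon := by positivity
        linarith
      refine ⟨m₀, ⟨rfl, hc⟩, ?_⟩
      rw [hplan t hc]
      exact h

namespace ActsBy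

variable {pl : Plan} {c : ℝ} (h : ActsBy ζ G κ x t₀ P σ pl c) (hζ : 0 < ζ)
include h

theorem emission_le_release (hΔ : 0 < κ.horizon) (j : ℕ) : t₀ ≤ pl.release P κ.horizon t₀ c j := by
  refine le_trans ?_ ((Plan.strictMono_release hΔ h.delay h.span h.le).monotone (Nat.zero_le j))
  by_cases hj : P = .foremost ∧ (0 : ℕ) = 0
  · rw [Plan.release_of hj]
  · rw [Plan.release_of_not hj]
    simp only [Nat.cast_zero, zero_mul, add_zero]
    linarith [h.le, h.delay]

theorem decision_le_release (hΔ : 0 < κ.horizon) {j : ℕ} (hj : ¬ (P = .foremost ∧ j = 0)) :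
    c ≤ pl.release P κ.horizon t₀ c j := by
  rw [Plan.release_of_not hj]
  have := h.span.trans_lt (pl.span_lt_gap hΔ)
  have : 0 ≤ (j : ℝ) * pl.gap κ.horizon := by positivity
  linarith [h.delay]

/-- A release that waits for the decision comes no earlier than it. So once the release date is
reached, the proviso that the decision has been made can be dropped. -/
theorem starts_le_iff (hΔ : 0 < κ.horizon) {t : ℝ} (ht : t₀ ≤ t) {j : ℕ} {e : ℝ}
    {C : ℕ → ℕ → Prop} (het : e ≤ t) : (view G κ x t₀ σ x t).Starts ζ P j e C ↔
      e = pl.release P κ.horizon t₀ c j ∧ C = pl.links P x j := by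
  rw [h.starts_iff t ht]
  constructor
  · exact fun h => ⟨h.1, h.2.1⟩
  · rintro ⟨rfl, rfl⟩
    exact ⟨rfl, rfl, fun hj => (h.decision_le_release hΔ hj).trans het⟩

include hζ

/-- Before `t₀` the emitter behaves like any other node and would accept information from its
neighbours; this excludes that it receives any. -/
theorem emission_le_sends {j v w : ℕ} {s : ℝ} (hs : SendsInfo σ j v w s) : t₀ ≤ s := by
  refine date_induction hζ (p := fun s => ∀ v w, SendsInfo σ j v w s → t₀ ≤ s)
    (fun s ih v w hs => ?_) s v w hs
  by_contra hlt
  rcases ((sendsInfo_iff h.run).1 hs).2.1 with ⟨h1, -⟩ | ⟨-, u, r, b, hr⟩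
  · exact h1 (emission_eq_none (Or.inr (not_le.1 hlt)))
  · obtain ⟨h1, h2⟩ := view_received.1 hr
    obtain ⟨hc, h3⟩ := arrival_eq_some.1 h2
    have := ih (r - ζ) (hc.nonneg hζ) (by linarith) u v ⟨b, h3⟩
    linarith

theorem holds_iff (hΔ : 0 < κ.horizon) {j v : ℕ} {t : ℝ} :
    (view G κ x t₀ σ v t).Holds ζ P j ↔ Held G σ x (pl.release P κ.horizon t₀ c) j v t := by
  unfold View.Holds Held
  by_cases hv : v = x ∧ t₀ ≤ t
  · obtain ⟨rfl, ht⟩ := hv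
    simp only [emission_emitter ht, ne_eq, reduceCtorEq, not_false_eq_true, true_and, false_and,
      or_false, not_true_eq_false]
    constructor
    · rintro ⟨e, C, h1, h2⟩
      have h2' : e ≤ t := h2
      rw [h.starts_le_iff hΔ ht h2'] at h1
      exact h1.1 ▸ h2'
    · exact fun h2 => ⟨_, _, (h.starts_le_iff hΔ ht h2).2 ⟨rfl, rfl⟩, h2⟩
  · have hv' : v ≠ x ∨ t < t₀ := by
      by_cases hvx : v = x
      · exact Or.inr (not_le.1 fun ht => hv ⟨hvx, ht⟩)
      · exact Or.inl hvx
    simp only [emission_eq_none hv', ne_eq, not_true_eq_false, false_and, true_and, false_or,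
      view_received]
    constructor
    · rintro ⟨w, s, b, h1, h2⟩
      by_cases hvx : v = x
      · have ht : t < t₀ := hv'.resolve_left (not_not.2 hvx)
        obtain ⟨-, h3⟩ := arrival_eq_some.1 h2
        have := h.emission_le_sends hζ ⟨b, h3⟩
        linarith
      · exact Or.inr ⟨hvx, w, s, h1, b, h2⟩
    · rintro (⟨rfl, h1⟩ | ⟨hvx, w, s, h1, b, h2⟩)
      · have := hv'.resolve_left (not_not.2 rfl)
        linarith [h.emission_le_release hΔ j]
      · exact ⟨w, s, b, h1, h2⟩

/-- Only the emitter computes the tree. The allowed links travel inside the information messages and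
are copied unchanged at every hop. -/
theorem allows_iff {j v : ℕ} {t : ℝ}
    (hh : (view G κ x t₀ σ v t).Holds ζ P j) :
    (view G κ x t₀ σ v t).Allows ζ P j = pl.links P x j := by
  refine date_induction hζ (p := fun t => ∀ v, (view G κ x t₀ σ v t).Holds ζ P j →
    (view G κ x t₀ σ v t).Allows ζ P j = pl.links P x j) (fun t ih v hh => ?_) t v hh
  funext a b
  unfold View.Allows
  rcases hh with ⟨hne, e, C, h1, h2⟩ | ⟨hn, w, s, bd, hr⟩
  · have hv : v = x ∧ t₀ ≤ t := by
      by_contra hv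
      refine hne (emission_eq_none ?_)
      by_cases hvx : v = x
      · exact Or.inr (not_le.1 fun ht => hv ⟨hvx, ht⟩)
      · exact Or.inl hvx
    obtain ⟨rfl, ht⟩ := hv
    simp only [emission_emitter ht, ne_eq, reduceCtorEq, not_false_eq_true, true_and, false_and,
      or_false]
    refine propext ⟨?_, fun hab => ⟨_, _, h1, ?_⟩⟩
    · rintro ⟨e', C', h3, h4⟩
      rw [((h.starts_iff t ht j e' C').1 h3).2.1] at h4
      exact h4
    · rwa [((h.starts_iff t ht j e C).1 h1).2.1]
  · have key : ∀ w s bd, (view G κ x t₀ σ v t).received w s = some ⟨some j, bd⟩ →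
        bd.allow = pl.links P x j := by
      intro w s bd hr
      obtain ⟨hst, h1⟩ := view_received.1 hr
      obtain ⟨hc, h2⟩ := arrival_eq_some.1 h1
      rw [h.run, View.message_info_iff] at h2
      rw [h2.2]
      exact ih _ (hc.nonneg hζ) (by linarith) w h2.1.2.1
    simp only [hn, ne_eq, not_true_eq_false, false_and, true_and, false_or]
    refine propext ⟨?_, fun hab => ⟨w, s, bd, hr, ?_⟩⟩
    · rintro ⟨w, s, q, h1, h2⟩
      rwa [key w s q h1] at h2
    · rwa [key w s bd hr]

theorem gets_iff (hΔ : 0 < κ.horizon) {j v : ℕ} {t : ℝ}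
    (hh : (view G κ x t₀ σ v t).Holds ζ P j) :
    (view G κ x t₀ σ v t).Gets ζ P j ↔ Fresh G σ x (pl.release P κ.horizon t₀ c) j v t := by
  unfold View.Gets Fresh
  by_cases hvx : v = x
  · subst hvx
    have ht : t₀ ≤ t := by
      rcases (h.holds_iff hζ hΔ).1 hh with ⟨-, h1⟩ | ⟨h1, -⟩
      · exact (h.emission_le_release hΔ j).trans h1
      · exact absurd rfl h1
    simp only [emission_emitter ht, ne_eq, reduceCtorEq, not_false_eq_true, true_and, false_and,
      or_false, not_true_eq_false]
    have hnow : (view G κ v t₀ σ v t).now = t := rfl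
    rw [hnow]
    constructor
    · rintro ⟨C, hC⟩
      exact ((h.starts_le_iff hΔ ht le_rfl).1 hC).1
    · exact fun h1 => ⟨_, (h.starts_le_iff hΔ ht le_rfl).2 ⟨h1, rfl⟩⟩
  · simp only [emission_eq_none (Or.inl hvx), ne_eq, not_true_eq_false, false_and, true_and,
      false_or, view_received, hvx, not_false_eq_true]
    have hnow : (view G κ x t₀ σ v t).now = t := rfl
    rw [hnow]
    constructor
    · rintro ⟨⟨w, b, -, h2⟩, hmin⟩
      refine ⟨⟨w, b, h2⟩, ?_⟩
      rintro r ⟨w', b', h3⟩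
      by_contra hlt
      exact hlt (hmin w' r b' ⟨(not_le.1 hlt).le, h3⟩)
    · rintro ⟨⟨w, b, h2⟩, hmin⟩
      exact ⟨⟨w, b, le_rfl, h2⟩, fun w' r b' hr => hmin ⟨w', b', hr.2⟩⟩

theorem forwards_iff (hΔ : 0 < κ.horizon) {j v w : ℕ} {s : ℝ} :
    SendsInfo σ j v w s ↔ G.present v w s ∧ Held G σ x (pl.release P κ.horizon t₀ c) j v s ∧
      (∀ i, j < i → ¬ Held G σ x (pl.release P κ.horizon t₀ c) i v s) ∧ pl.links P x j v w ∧
      (G.Appears v w s ∨ Fresh G σ x (pl.release P κ.horizon t₀ c) j v s) := by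
  rw [sendsInfo_iff h.run, View.Forwards, presence_now_view, appearsNow_view]
  simp only [h.holds_iff hζ hΔ]
  refine and_congr_right fun _ => and_congr_right fun hh => and_congr_right fun _ => ?_
  have hh' := (h.holds_iff hζ hΔ).2 hh
  rw [h.allows_iff hζ hh', h.gets_iff hζ hΔ hh']
  rfl

/-- Proved separately from `Propagates.held_le`, since the finiteness required by `Propagates`
depends on it. -/
theorem held_le (hΔ : 0 < κ.horizon) {j v : ℕ} {s : ℝ}
    (hh : Held G σ x (pl.release P κ.horizon t₀ c) j v s) :
    pl.release P κ.horizon t₀ c j ≤ s := by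
  refine date_induction hζ (p := fun s => ∀ v, Held G σ x (pl.release P κ.horizon t₀ c) j v s →
    pl.release P κ.horizon t₀ c j ≤ s) (fun s ih v hh => ?_) s v hh
  rcases hh with ⟨-, h1⟩ | ⟨-, u, r, hr, hd⟩
  · exact h1
  · obtain ⟨hc, hs⟩ := delivers_iff.1 hd
    have := ih (r - ζ) (hc.nonneg hζ) (by linarith) u ((h.forwards_iff hζ hΔ).1 hs).2.1
    linarith

/-- A node sends only at appearances, at multiples of the horizon, and when it first gets some
information. Up to date `t` there are finitely many dates of each kind, since only finitely many
pieces have been released. -/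
theorem finite_sends (hΔ : 0 < κ.horizon) (ht₀ : 0 ≤ t₀) (v : ℕ) (t : ℝ) :
    {q : ℕ × ℝ | 0 ≤ q.2 ∧ q.2 ≤ t ∧ σ v q.1 q.2 ≠ none}.Finite := by
  have hfresh : ∀ j, {s | Fresh G σ x (pl.release P κ.horizon t₀ c) j v s}.Finite := by
    refine fun j => Set.Subsingleton.finite ?_
    rintro a (⟨h1, rfl⟩ | ⟨h1, h2⟩) b (⟨h3, rfl⟩ | ⟨h3, h4⟩)
    · rfl
    · exact absurd h1 h3
    · exact absurd h3 h1
    · exact h2.unique h4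
  have hgap := h.span.trans_lt (pl.span_lt_gap hΔ)
  obtain ⟨J, hJ⟩ := exists_nat_gt (t / pl.gap κ.horizon)
  obtain ⟨N, hN⟩ := exists_nat_gt (t / κ.horizon)
  rw [div_lt_iff₀ hgap] at hJ
  rw [div_lt_iff₀ hΔ] at hN
  have h1 := G.nodes.finite_toSet.biUnion fun w _ => TVG.finite_appears hζ G v w t
  have h2 := (Set.finite_Iic N).image fun m : ℕ => (m : ℝ) * κ.horizon
  have h3 := (Set.finite_Iic J).biUnion fun j _ => hfresh j
  refine (G.nodes.finite_toSet.prod ((h1.union h2).union h3)).subset ?_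
  rintro ⟨w, s⟩ ⟨hs0, hst, hne⟩
  simp only at hs0 hst hne
  rw [h.run, View.message_ne_none_iff, reports_view] at hne
  have hfw : ∀ j, (view G κ x t₀ σ v s).Forwards ζ P w j ↔ _ := fun j =>
    (sendsInfo_iff h.run).symm.trans (h.forwards_iff hζ hΔ)
  simp only [hfw] at hne
  have hw : w ∈ G.nodes := by
    rcases hne with ⟨j, h4, -⟩ | ⟨h4, -⟩ <;> exact TVG.mem_right h4
  refine ⟨hw, ?_⟩
  simp only [Set.mem_union, Set.mem_iUnion, Set.mem_image]
  rcases hne with ⟨j, -, hh, -, -, h5 | h5⟩ | ⟨-, h5 | ⟨m, rfl⟩⟩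
  · exact Or.inl (Or.inl ⟨w, hw, h5, hst⟩)
  · refine Or.inr ⟨j, ?_, h5⟩
    have hjs := h.held_le hζ hΔ hh
    have hj : (j : ℝ) * pl.gap κ.horizon ≤ pl.release P κ.horizon t₀ c j := by
      by_cases hj : P = .foremost ∧ j = 0
      · rw [Plan.release_of hj, hj.2]; simpa using ht₀
      · rw [Plan.release_of_not hj]; linarith [h.delay, h.le]
    have : (j : ℝ) < J := lt_of_mul_lt_mul_right (by linarith) hgap.le
    exact Set.mem_Iic.2 (by exact_mod_cast this.le)
  · exact Or.inl (Or.inl ⟨w, hw, h5, hst⟩)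
  · refine Or.inl (Or.inr ⟨m, ?_, rfl⟩)
    have : (m : ℝ) < N := lt_of_mul_lt_mul_right (by linarith) hΔ.le
    exact Set.mem_Iic.2 (by exact_mod_cast this.le)

theorem propagates (hΔ : 0 < κ.horizon) (ht₀ : 0 ≤ t₀) :
    Propagates G σ x (pl.release P κ.horizon t₀ c) (pl.links P x) where
  delay := hζ
  nonneg := ht₀.trans (h.emission_le_release hΔ 0)
  mono := Plan.strictMono_release hΔ h.delay h.span h.le
  finite v _ t := h.finite_sends hζ hΔ ht₀ v t
  sends_iff _ _ _ _ _ := h.forwards_iff hζ hΔ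

end ActsBy

end Analysis

theorem run_treeProtocol {ζ : ℝ} (hζ : 0 < ζ) (G : TVG ζ) (P : Objective) (κ : Knowledge) (x : ℕ)
    (t₀ : ℝ) (v w : ℕ) (t : ℝ) :
    run G (treeProtocol ζ P) κ x t₀ v w t =
      (view G κ x t₀ (run G (treeProtocol ζ P) κ x t₀) v t).message ζ P w :=
  run_eq G (treeProtocol ζ P) κ x t₀ hζ v w t

/-! ### Optimality of all broadcasts along one tree -/

section Reuse

variable {ζ : ℝ} {G : TVG ζ} {P : Objective} {κ : Knowledge} {x : ℕ} {t₀ : ℝ}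

/-- The creation date of the `j`-th information. -/
noncomputable def Plan.creation (pl : Plan) (Δ t₀ c : ℝ) (j : ℕ) : ℝ :=
  if j = 0 then t₀ else c + pl.delay + j * pl.gap Δ

/-- The dates can differ only for `j = 0`: that information is created at `t₀`, but for shortest and
fastest trees it is held back until the plan is made. -/
theorem Plan.creation_of_ne {pl : Plan} {Δ t₀ c : ℝ} {j : ℕ} (hj : j ≠ 0) :
    pl.creation Δ t₀ c j = pl.release P Δ t₀ c j := by
  rw [Plan.release_of_not (by simp [hj]), Plan.creation, if_neg hj]

theorem reusesTree_treeProtocol (hζ : 0 < ζ) (hG : G.Plannable P κ.horizon) (hx : x ∈ G.nodes)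
    (ht₀ : 0 ≤ t₀) (k : ℕ∞) : ReusesTree k P (treeProtocol ζ P) G κ x t₀ := by
  obtain ⟨pl, m, hsuit, hact⟩ :=
    exists_actsBy (run_treeProtocol hζ G P κ x t₀) hζ hG hx ht₀
  set σ : ℕ → ℕ → ℝ → Option (Packet Content) := run G (treeProtocol ζ P) κ x t₀ with hσ
  set Δ := κ.horizon with hΔdef
  set c := t₀ + m * Δ with hc
  have hΔ : 0 < Δ := hG.bound.1
  have hprop := hact.propagates hζ hΔ ht₀
  have hspan := pl.span_lt_gap hΔ
  have hgap := hact.span.trans_lt hspan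
  set e := pl.release P Δ t₀ c with he
  set f : ℕ → ℝ := fun j => c + pl.delay + j * pl.gap Δ + pl.span with hf
  have hle : ∀ j, pl.creation Δ t₀ c j ≤ e j := by
    intro j
    by_cases hj : j = 0
    · subst hj
      exact hact.emission_le_release hΔ 0
    · exact (Plan.creation_of_ne hj).le
  have hef : ∀ j, e j + pl.span ≤ f j := by
    intro j
    by_cases hj : P = .foremost ∧ j = 0
    · rw [he, Plan.release_of hj]
      simp only [hf, hj.2, Nat.cast_zero, zero_mul]
      linarith [hact.le, hact.delay]
    · rw [he, Plan.release_of_not hj]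
  have hfe : ∀ j, f j < e (j + 1) := by
    intro j
    rw [he, Plan.release_of_not (by simp)]
    simp only [hf]
    push_cast
    linarith
  have hcf : ∀ j, pl.creation Δ t₀ c j ≤ f j := fun j => by linarith [hle j, hef j, hact.span]
  have het : ∀ j, t₀ ≤ e j := hact.emission_le_release hΔ
  have hroot : pl.parent x = x := by
    cases P with
    | shortest => obtain ⟨-, D, hT, -⟩ := hsuit; exact hT.root
    | foremost => obtain ⟨-, R, hT, -⟩ := hsuit; exact hT.root
    | fastest => obtain ⟨R, d, -, hT, -⟩ := hsuit; exact hT.root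
  have hmain : ∀ j, (∀ v ∈ G.nodes, v ≠ x → ∃ r, r ≤ e j + pl.span ∧
      FirstReception G σ j v r ∧ Delivers G σ j (pl.parent v) v r) ∧
      Optimal G σ x j (pl.creation Δ t₀ c j) pl.parent P := by
    intro j
    have hlinks : ∀ v ∈ G.nodes, v ≠ x → pl.links P x j (pl.parent v) v := fun v _ hvx =>
      Or.inr ⟨rfl, hvx⟩
    -- Both the decision date, counted from `t₀`, and the gap are multiples of `Δ`. So if `Δ` is a
    -- period, all these releases have the phase of `t₀ + pl.delay`, for which the tree was planned.
    have hshift : ¬ (P = .foremost ∧ j = 0) →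
        e j = t₀ + pl.delay + (m + j * (⌈pl.span / Δ⌉₊ + 1) : ℕ) * Δ := by
      intro hj
      rw [he, Plan.release_of_not hj, Plan.gap]
      push_cast
      ring
    cases P with
    | shortest =>
      obtain ⟨h0, D, hT, hD⟩ := hsuit
      refine ⟨fun v hv hvx => ?_, fun v hv hvx => ?_⟩
      · refine hprop.shortest hG.bound hT (fun u w => ?_) hD ((hef j).trans (hfe j).le) hv hvx
        simp [Plan.links]
      · refine ⟨D v, hT.isLeast hζ hG.bound ?_ hv hvx, hT.iterate _ v hv rfl⟩
        unfold Plan.creation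
        split_ifs
        · exact ht₀
        · have : 0 ≤ (j : ℝ) * pl.gap Δ := by positivity
          linarith [hact.delay, hact.le]
    | foremost =>
      have hp := hG.period (by simp)
      obtain ⟨h0, R, hT, hR⟩ := hsuit
      -- For `j = 0` the tree is computed only after the flooding has begun, but it was planned for
      -- departure at `t₀`, so it describes the flooding too. Later broadcasts use it shifted by
      -- periods.
      have key : e j = pl.creation Δ t₀ c j ∧ ∃ R' : ℕ → ℝ,
          G.ForemostTree x (e j) pl.parent R' ∧ ∀ v ∈ G.nodes, R' v ≤ e j + pl.span := by
        by_cases hj : j = 0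
        · subst hj
          have : e 0 = t₀ := Plan.release_of ⟨rfl, rfl⟩
          exact ⟨by simp [this, Plan.creation], R, by rwa [this], by rwa [this]⟩
        · refine ⟨(Plan.creation_of_ne hj).symm,
            fun v => R v + (m + j * (⌈pl.span / Δ⌉₊ + 1) : ℕ) * Δ, ?_, ?_⟩
          · rw [hshift (by simp [hj]), h0, add_zero]
            exact hT.shift_nat_mul hζ hp ht₀ _
          · intro v hv
            rw [hshift (by simp [hj]), h0]
            linarith [hR v hv]
      obtain ⟨hej, R', hT', hR'⟩ := key
      have hrec : ∀ v ∈ G.nodes, v ≠ x → FirstReception G σ j v (R' v) ∧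
          Delivers G σ j (pl.parent v) v (R' v) := fun v hv hvx =>
        hprop.foremost hT' hlinks (fun v hv => by linarith [hR' v hv, hef j, hfe j]) hv hvx
      refine ⟨fun v hv hvx => ⟨R' v, hR' v hv, hrec v hv hvx⟩, fun v hv hvx => ?_⟩
      exact ⟨R' v, (hrec v hv hvx).1, hej ▸ hT'.least v hv hvx⟩
    | fastest =>
      have hp := hG.period (by simp)
      obtain ⟨R, d, hd, hT, hR⟩ := hsuit
      set n := m + j * (⌈pl.span / Δ⌉₊ + 1)
      have hej : e j = t₀ + pl.delay + (n : ℕ) * Δ := hshift (by simp)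
      have hT' := hT.shift_nat_mul hζ hp (by linarith [hact.delay]) n
      rw [← hej] at hT'
      have hR' : ∀ v ∈ G.nodes, R v + n * Δ ≤ e j + d := fun v hv => by
        rw [hej]; linarith [(hR v hv).1]
      have hds : d ≤ pl.span := (hR x hx).2
      have hrec : ∀ v ∈ G.nodes, v ≠ x → FirstReception G σ j v (R v + n * Δ) ∧
          Delivers G σ j (pl.parent v) v (R v + n * Δ) := fun v hv hvx =>
        hprop.foremost hT' hlinks (fun v hv => by linarith [hR' v hv, hef j, hfe j]) hv hvx
      refine ⟨fun v hv hvx => ⟨_, by linarith [hR' v hv], hrec v hv hvx⟩, e j, d, ?_, hle j, ?_, ?_⟩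
      · rwa [hp.broadcastDurations_eq hζ x (τ' := t₀) ?_ ht₀]
        unfold Plan.creation
        split_ifs
        · exact ht₀
        · have : 0 ≤ (j : ℝ) * pl.gap Δ := by positivity
          linarith [hact.delay, hact.le]
      · exact fun v hv w s hs => hprop.sends_le hv hs
      · exact fun v hv hvx => ⟨_, (hrec v hv hvx).1, hR' v hv⟩
  refine ⟨fun v _ t => hact.finite_sends hζ hΔ ht₀ v t, pl.parent, pl.creation Δ t₀ c, f,
    by simp [Plan.creation], fun j _ => ⟨⟨hcf j, ?_, hroot, ?_⟩, (hmain j).2, ?_, fun hj => ?_⟩⟩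
  · exact fun v hv w s hs => (hprop.causal hv hs).imp (fun h => ⟨h.1, (hle j).trans h.2⟩) id
  · intro v hv hvx
    obtain ⟨r, h1, h2⟩ := (hmain j).1 v hv hvx
    exact ⟨r, h1.trans (hef j), h2⟩
  · have hft : t₀ ≤ f j := by linarith [het j, hef j, hact.span]
    refine ⟨⟨hcf j, (hact.terminated_iff _ hft j).2 rfl⟩, ?_⟩
    rintro s ⟨hs, hterm⟩
    have hts : t₀ ≤ s := by
      refine le_trans ?_ hs
      by_cases hj : j = 0
      · simp [Plan.creation, hj]
      · rw [Plan.creation_of_ne (P := P) hj]; exact het j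
    exact ((hact.terminated_iff s hts j).1 hterm).ge
  · have hj0 : j ≠ 0 := by omega
    have hnf : ¬ (P = .foremost ∧ j = 0) := by simp [hj0]
    have hcr : pl.creation Δ t₀ c j = e j := Plan.creation_of_ne hj0
    refine ⟨?_, ⟨⟨hcr ▸ het j, ?_⟩, ?_⟩, ?_⟩
    · rw [hcr]
      have := hfe (j - 1)
      rwa [Nat.sub_add_cancel hj] at this
    · rw [hcr]
      exact ⟨_, (hact.starts_le_iff hΔ (het j) le_rfl).2 ⟨rfl, rfl⟩⟩
    · rintro s ⟨hs, C, hC⟩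
      rw [hcr]
      exact ((hact.starts_iff s hs j _ C).1 hC).1.ge
    · intro v hv w s hs
      obtain ⟨h1, -, -, h2, -⟩ := (hprop.sends_iff v hv j w s).1 hs
      rcases h2 with h2 | h2
      · exact absurd h2 hnf
      · exact ⟨TVG.mem_right h1, h2.2, h2.1⟩

end Reuse

theorem reusable_shortest {ζ : ℝ} (hζ : 0 < ζ) (k : ℕ∞) {c : Context}
    (hc : c = .Bdelta ∨ c = .BnDelta ∨ c = .Pdelta ∨ c = .PnDelta ∨ c = .Pp) :
    Reusable ζ k .shortest c := by
  refine ⟨treeProtocol ζ .shortest, fun G κ hκ x hx t₀ ht₀ =>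
    reusesTree_treeProtocol hζ ⟨?_, ?_, fun h => absurd rfl h⟩ hx ht₀ k⟩
  · rcases hc with rfl | rfl | rfl | rfl | rfl
    · exact hκ.1.1.1
    · exact hκ.1.1.1
    · exact hκ.1.1
    · exact hκ.1.1
    · exact hκ.1.1
  · rcases hc with rfl | rfl | rfl | rfl | rfl
    · obtain ⟨-, Δ, h, rfl⟩ := hκ; exact h
    · obtain ⟨-, Δ, h, rfl⟩ := hκ; exact h
    · obtain ⟨-, Δ, h, rfl⟩ := hκ; exact h
    · obtain ⟨-, Δ, h, rfl⟩ := hκ; exact h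
    · obtain ⟨-, p, h, rfl⟩ := hκ; exact h.recurrenceBound hζ

theorem reusable_of_period {ζ : ℝ} (hζ : 0 < ζ) (k : ℕ∞) (P : Objective) :
    Reusable ζ k P .Pp := by
  refine ⟨treeProtocol ζ P, fun G κ hκ x hx t₀ ht₀ => ?_⟩
  obtain ⟨hc, p, h, rfl⟩ := hκ
  have hG : G.Plannable P (Knowledge.period p).horizon :=
    ⟨hc.1, h.recurrenceBound hζ, fun _ => h⟩
  exact reusesTree_treeProtocol hζ hG hx ht₀ k

/-! ### Indistinguishable graphs -/

section Agreement

variable {ζ : ℝ} {G H : TVG ζ} {τ : ℝ}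

theorem view_eq_of_agree {M : Type} (hζ : 0 < ζ)
    (h : ∀ u v s, s ≤ τ → (G.present u v s ↔ H.present u v s)) (κ : Knowledge) (x : ℕ) (t₀ : ℝ)
    {σ ρ : ℕ → ℕ → ℝ → Option (Packet M)} (hσ : ∀ v w s, s ≤ τ → σ v w s = ρ v w s) (v : ℕ) {t : ℝ}
    (ht : t ≤ τ) : view G κ x t₀ σ v t = view H κ x t₀ ρ v t := by
  unfold view
  congr 1
  · funext w s
    exact propext (and_congr_right fun hs => h v w s (hs.trans ht))
  · funext w s
    split_ifs with hs
    · unfold arrival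
      have hc : G.Crossing w v (s - ζ) ↔ H.Crossing w v (s - ζ) :=
        forall_congr' fun r => forall_congr' fun hr => h w v r (by linarith [hr.2])
      by_cases hG : G.Crossing w v (s - ζ)
      · rw [if_pos hG, if_pos (hc.1 hG), hσ _ _ _ (by linarith)]
      · rw [if_neg hG, if_neg fun h => hG (hc.2 h)]
    · rfl

/-- Up to a date until which two graphs agree, the nodes cannot distinguish them. -/
theorem view_run_eq_of_agree (hζ : 0 < ζ)
    (h : ∀ u v s, s ≤ τ → (G.present u v s ↔ H.present u v s)) (A : Protocol) (κ : Knowledge)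
    (x : ℕ) (t₀ : ℝ) (v : ℕ) {t : ℝ} (ht : t ≤ τ) :
    view G κ x t₀ (run G A κ x t₀) v t = view H κ x t₀ (run H A κ x t₀) v t := by
  have key : ∀ m v w s, s ≤ τ → ((react G A κ x t₀)^[m] fun _ _ _ => none) v w s =
      ((react H A κ x t₀)^[m] fun _ _ _ => none) v w s := by
    intro m
    induction m with
    | zero => exact fun _ _ _ _ => rfl
    | succ m ih =>
      intro v w s hs
      rw [Function.iterate_succ_apply', Function.iterate_succ_apply']
      exact congrArg (A.send · w) (view_eq_of_agree hζ h κ x t₀ ih v hs)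
  exact view_eq_of_agree hζ h κ x t₀ (fun v w s hs => key _ v w s hs) v ht

/-- Agreement is needed only up to the least element of the first set. In this way a date that the
emitter picks from its view is transferred to an indistinguishable graph. -/
theorem IsLeast.eq_of_agree {S S' : Set ℝ} {a b : ℝ} (hS : ∀ s ≤ a, s ∈ S ↔ s ∈ S')
    (ha : IsLeast S a) (hb : IsLeast S' b) : b = a := by
  have h1 : b ≤ a := hb.2 ((hS a le_rfl).1 ha.1)
  exact le_antisymm h1 (ha.2 ((hS b h1).2 hb.1))

theorem IsBroadcast.le_sends {M : Type} {σ : ℕ → ℕ → ℝ → Option (Packet M)} {x j : ℕ} {φ : ℝ}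
    {T : ℕ → ℕ} (hζ : 0 < ζ) (h : IsBroadcast G σ x j τ φ T) {v w : ℕ} (hv : v ∈ G.nodes) {s : ℝ}
    (hs : SendsInfo σ j v w s) : τ ≤ s := by
  refine date_induction hζ (p := fun s => ∀ v w, v ∈ G.nodes → SendsInfo σ j v w s → τ ≤ s)
    (fun s ih v w hv hs => ?_) s v w hv hs
  rcases h.causal v hv w s hs with ⟨-, h1⟩ | ⟨u, r, hr, hd⟩
  · exact h1
  · obtain ⟨hc, hs'⟩ := delivers_iff.1 hd
    have := ih _ (hc.nonneg hζ) (by linarith) u v (hc.edge hζ).mem_left hs'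
    linarith

end Agreement

/-! ### Graphs with three nodes and short contacts -/

/-- The points of `D` are nonnegative and at pairwise distance more than `ζ`. -/
def Separated (ζ : ℝ) (D : Set ℝ) : Prop :=
  (∀ a ∈ D, 0 ≤ a) ∧ ∀ a ∈ D, ∀ b ∈ D, a < b → a + ζ < b

/-- Repetition of `B` with period `M`. -/
def periodize (M : ℝ) (B : Set ℝ) : Set ℝ := {a | ∃ b ∈ B, ∃ n : ℕ, a = b + n * M}

theorem subset_periodize {M : ℝ} {B : Set ℝ} : B ⊆ periodize M B := fun b hb => ⟨b, hb, 0, by simp⟩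

theorem Separated.periodize {ζ M : ℝ} (hM : 0 < M) {B : Set ℝ} (h : Separated ζ B)
    (hB : ∀ b ∈ B, b + 2 * ζ ≤ M) : Separated ζ (periodize M B) := by
  constructor
  · rintro _ ⟨b, hb, n, rfl⟩
    have := h.1 b hb
    positivity
  · rintro _ ⟨b, hb, n, rfl⟩ _ ⟨b', hb', n', rfl⟩ hlt
    have h1 := h.1 b hb
    have h2 := h.1 b' hb'
    have h3 := hB b hb
    have h4 := hB b' hb'
    rcases lt_trichotomy n n' with hn | rfl | hn
    · have : (n : ℝ) + 1 ≤ n' := by exact_mod_cast hn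
      nlinarith
    · linarith [h.2 b hb b' hb' (by linarith)]
    · have : (n' : ℝ) + 1 ≤ n := by exact_mod_cast hn
      nlinarith

/-- The graph on the nodes `0`, `1`, `2` in which the edge between `u` and `v` is present exactly
for the duration `ζ` from each of the dates in `D (u + v)` on. -/
def triangle (ζ : ℝ) (_ : 0 < ζ) (D : ℕ → Set ℝ) (hD : ∀ i, Separated ζ (D i)) : TVG ζ where
  nodes := {0, 1, 2}
  -- The sum of the end nodes identifies the edge: `1` stands for `0`–`1`, `2` for `0`–`2`, and `3`
  -- for `1`–`2`.
  present u v t := (u ≤ 2 ∧ v ≤ 2 ∧ u ≠ v) ∧ ∃ s ∈ D (u + v), s ≤ t ∧ t ≤ s + ζ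
  mem_left := by
    rintro u v t ⟨⟨h, -, -⟩, -⟩
    simp only [Finset.mem_insert, Finset.mem_singleton]
    omega
  symm := by
    rintro u v t ⟨⟨h1, h2, h3⟩, h4⟩
    exact ⟨⟨h2, h1, h3.symm⟩, by rwa [add_comm]⟩
  loopless := by
    rintro u t ⟨⟨-, -, h⟩, -⟩
    exact h rfl
  nonneg := by
    rintro u v t ⟨-, s, hs, h1, -⟩
    exact ((hD _).1 s hs).trans h1
  intervals u v := by
    refine ⟨{I | (u ≤ 2 ∧ v ≤ 2 ∧ u ≠ v) ∧ ∃ s ∈ D (u + v), I = Set.Icc s (s + ζ)}, ?_, ?_, ?_⟩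
    · rintro _ ⟨-, a, ha, rfl⟩ _ ⟨-, b, hb, rfl⟩ hne
      refine Set.disjoint_left.2 fun t h1 h2 => hne ?_
      simp only [id, Set.mem_Icc] at h1 h2
      rcases lt_trichotomy a b with h | rfl | h
      · linarith [(hD _).2 a ha b hb h]
      · rfl
      · linarith [(hD _).2 b hb a ha h]
    · rintro _ ⟨-, a, -, rfl⟩
      exact Or.inl ⟨a, a + ζ, le_rfl, rfl⟩
    · ext t
      simp only [Set.mem_ofPred_eq, Set.mem_sUnion]
      constructor
      · rintro ⟨h, s, hs, h1, h2⟩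
        exact ⟨_, ⟨h, s, hs, rfl⟩, h1, h2⟩
      · rintro ⟨_, ⟨h, s, hs, rfl⟩, h1, h2⟩
        exact ⟨h, s, hs, h1, h2⟩

namespace triangle

variable {ζ : ℝ} {hζ : 0 < ζ} {D : ℕ → Set ℝ} {hD : ∀ i, Separated ζ (D i)} {u v : ℕ}

theorem mem_nodes : u ∈ (triangle ζ hζ D hD).nodes ↔ u ≤ 2 := by
  simp only [triangle, Finset.mem_insert, Finset.mem_singleton]
  omega

theorem crossing_of_mem {s : ℝ} (h : u ≤ 2 ∧ v ≤ 2 ∧ u ≠ v) (hs : s ∈ D (u + v)) :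
    (triangle ζ hζ D hD).Crossing u v s := fun _ ht => ⟨h, s, hs, ht.1, ht.2⟩

theorem mem_of_crossing {s : ℝ} (h : (triangle ζ hζ D hD).Crossing u v s) :
    (u ≤ 2 ∧ v ≤ 2 ∧ u ≠ v) ∧ s ∈ D (u + v) := by
  obtain ⟨hl, a, ha, h1, h2⟩ := h s ⟨le_rfl, by linarith⟩
  refine ⟨hl, ?_⟩
  rcases h1.eq_or_lt with rfl | h1
  · exact ha
  exfalso
  -- A crossing starting strictly inside the contact at `a` would need another contact right after
  -- `a + ζ`. The next one, `b`, begins strictly later, and a contact covering the dates in between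
  -- would be too close to `b`.
  have hcov : ∀ t, a + ζ < t → t ≤ s + ζ → ∃ b ∈ D (u + v), a + ζ < b ∧ b ≤ t := by
    intro t h3 h4
    obtain ⟨-, b, hb, h5, h6⟩ := h t ⟨by linarith, h4⟩
    refine ⟨b, hb, ?_, h5⟩
    rcases lt_trichotomy a b with h7 | rfl | h7
    · exact (hD _).2 a ha b hb h7
    · linarith
    · linarith [(hD _).2 b hb a ha h7]
  obtain ⟨b, hb, h3, h4⟩ := hcov (s + ζ) (by linarith) le_rfl
  obtain ⟨b', hb', h5, h6⟩ := hcov ((a + ζ + b) / 2) (by linarith) (by linarith)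
  linarith [(hD _).2 b' hb' b hb (by linarith)]

theorem appears_of_mem {a : ℝ} (h : u ≤ 2 ∧ v ≤ 2 ∧ u ≠ v) (ha : a ∈ D (u + v)) :
    (triangle ζ hζ D hD).Appears u v a := by
  refine ⟨⟨h, a, ha, le_rfl, by linarith⟩, fun s hs => ?_⟩
  by_contra hcon
  push Not at hcon
  have hr : max s (a - ζ) < a := max_lt hs (by linarith)
  obtain ⟨-, b, hb, h1, h2⟩ := hcon ((max s (a - ζ) + a) / 2)
    (by linarith [le_max_left s (a - ζ)]) (by linarith)
  have h3 := (hD _).2 b hb a ha (by linarith)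
  obtain ⟨-, c, hc, h4, h5⟩ := hcon ((b + ζ + a) / 2)
    (by linarith [le_max_left s (a - ζ)]) (by linarith)
  have h6 := (hD _).2 c hc a ha (by linarith)
  rcases lt_trichotomy b c with h7 | rfl | h7
  · linarith [(hD _).2 b hb c hc h7, le_max_right s (a - ζ)]
  · linarith
  · linarith [(hD _).2 c hc b hb h7]

theorem connected (h1 : (D 1).Nonempty) (h3 : (D 3).Nonempty) :
    (triangle ζ hζ D hD).footprint.Connected := by
  rw [SimpleGraph.connected_iff_exists_forall_reachable]
  refine ⟨⟨1, mem_nodes.2 (by norm_num)⟩, ?_⟩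
  rintro ⟨v, hv⟩
  have hv2 := mem_nodes.1 hv
  by_cases hv1 : v = 1
  · subst hv1
    exact SimpleGraph.Reachable.refl _
  · refine SimpleGraph.Adj.reachable ?_
    change (triangle ζ hζ D hD).Edge 1 v
    have hne : (D (1 + v)).Nonempty := by
      obtain rfl | rfl : v = 0 ∨ v = 2 := by omega
      · exact h1
      · exact h3
    obtain ⟨s, hs⟩ := hne
    exact (crossing_of_mem ⟨by norm_num, hv2, fun h => hv1 h.symm⟩ hs).edge hζ

theorem recurrenceBound {Δ : ℝ} (hΔ : 0 < Δ)
    (h : ∀ i, ∀ t, 0 ≤ t → ∃ d ∈ D i, t < d ∧ d ≤ t + Δ) :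
    (triangle ζ hζ D hD).RecurrenceBound Δ := by
  refine ⟨hΔ, fun u v ⟨_, hl, _⟩ => ⟨?_, fun a ha => Or.inr ?_⟩⟩
  · obtain ⟨d, hd, -, h2⟩ := h (u + v) 0 le_rfl
    exact ⟨d, by linarith, appears_of_mem hl hd⟩
  · obtain ⟨d, hd, h1, h2⟩ := h (u + v) a ha.nonneg
    exact ⟨d, h1, h2, appears_of_mem hl hd⟩

theorem isPeriod {M : ℝ} (hM : 0 < M) {B : ℕ → Set ℝ} (hB : ∀ i, ∀ b ∈ B i, b + 2 * ζ ≤ M)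
    (hDB : ∀ i, D i = periodize M (B i)) : (triangle ζ hζ D hD).IsPeriod M := by
  refine ⟨hM, fun u v t ht => and_congr_right fun _ => ⟨?_, ?_⟩⟩
  · rintro ⟨s, hs, h1, h2⟩
    rw [hDB] at hs ⊢
    obtain ⟨b, hb, n, rfl⟩ := hs
    exact ⟨b + n * M + M, ⟨b, hb, n + 1, by push_cast; ring⟩, by linarith, by linarith⟩
  · rintro ⟨s, hs, h1, h2⟩
    rw [hDB] at hs ⊢
    obtain ⟨b, hb, n, rfl⟩ := hs
    cases n with
    | zero =>
      simp only [Nat.cast_zero, zero_mul, add_zero] at h2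
      linarith [hB _ b hb]
    | succ n =>
      push_cast at h1 h2
      exact ⟨b + n * M, ⟨b, hb, n, rfl⟩, by linarith, by linarith⟩

end triangle

/-! ### Two graphs that agree up to a given date -/

/-- The first contacts in the graph `regular`; `E` is for the edge between `0` and `2`. -/
def offsets (ζ : ℝ) (E : Set ℝ) (i : ℕ) : Set ℝ :=
  -- From date `0`, node `2` is reached through `1` at `2 * ζ`, before the direct edge appears at `3
  -- * ζ` (or never, if `E` is empty). Modulo the period `10 * ζ`, the contacts of `0` with `1` and
  -- with `2` never coincide.
  if i = 1 then {0} else if i = 3 then {ζ} else E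

/-- The contacts in the graph `regular`. -/
def contacts (ζ : ℝ) (E : Set ℝ) (i : ℕ) : Set ℝ := periodize (10 * ζ) (offsets ζ E i)

/-- The contacts in the graph `deviating` in its first period. -/
def firstContacts (ζ : ℝ) (E : Set ℝ) (τ : ℝ) (i : ℕ) : Set ℝ :=
  -- The offset `2 * ζ` keeps clear of contacts that began by `τ`, and `5 * ζ` lets the edge `1`–`2`
  -- appear only after `0` could have reached `2` directly.
  {a | a ∈ contacts ζ E i ∧ a ≤ τ} ∪ {if i = 3 then τ + 5 * ζ else τ + 2 * ζ}

section Pair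

variable {ζ : ℝ} {E : Set ℝ} {τ : ℝ}

theorem offsets_eq (hE : E ⊆ {3 * ζ}) {i : ℕ} {a b : ℝ} (ha : a ∈ offsets ζ E i)
    (hb : b ∈ offsets ζ E i) : a = b := by
  unfold offsets at ha hb
  split_ifs at ha hb
  · exact ha.trans hb.symm
  · exact ha.trans hb.symm
  · exact (hE ha).trans (hE hb).symm

theorem offsets_bounds (hζ : 0 < ζ) (hE : E ⊆ {3 * ζ}) {i : ℕ} {a : ℝ} (ha : a ∈ offsets ζ E i) :
    0 ≤ a ∧ a ≤ 3 * ζ := by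
  unfold offsets at ha
  split_ifs at ha
  · obtain rfl : a = 0 := ha
    exact ⟨le_rfl, by linarith⟩
  · obtain rfl : a = ζ := ha
    exact ⟨hζ.le, by linarith⟩
  · obtain rfl : a = 3 * ζ := hE ha
    exact ⟨by linarith, le_rfl⟩

theorem separated_contacts (hζ : 0 < ζ) (hE : E ⊆ {3 * ζ}) (i : ℕ) :
    Separated ζ (contacts ζ E i) :=
  Separated.periodize (by linarith)
    ⟨fun a ha => (offsets_bounds hζ hE ha).1,
      fun a ha b hb hab => absurd (offsets_eq hE ha hb) hab.ne⟩
    fun b hb => by linarith [(offsets_bounds hζ hE hb).2]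

theorem firstContacts_le (hζ : 0 < ζ) {i : ℕ} {b : ℝ} (hb : b ∈ firstContacts ζ E τ i) :
    b + 2 * ζ ≤ τ + 10 * ζ := by
  rcases hb with ⟨-, h⟩ | h
  · linarith
  · have h' : b = if i = 3 then τ + 5 * ζ else τ + 2 * ζ := h
    rw [h']
    split_ifs <;> linarith

theorem separated_firstContacts (hζ : 0 < ζ) (hE : E ⊆ {3 * ζ}) (hτ : 0 ≤ τ) (i : ℕ) :
    Separated ζ (firstContacts ζ E τ i) := by
  obtain ⟨h1, h2⟩ := separated_contacts hζ hE i
  set β := if i = 3 then τ + 5 * ζ else τ + 2 * ζ with hβ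
  have hβτ : τ + 2 * ζ ≤ β := by rw [hβ]; split_ifs <;> linarith
  constructor
  · rintro a (⟨ha, -⟩ | ha)
    · exact h1 a ha
    · obtain rfl : a = β := ha
      linarith
  · rintro a (⟨ha, haτ⟩ | ha) b (⟨hb, hbτ⟩ | hb) hab
    · exact h2 a ha b hb hab
    · obtain rfl : b = β := hb
      linarith
    · obtain rfl : a = β := ha
      linarith
    · obtain rfl : a = β := ha
      exact absurd hab (not_lt.2 (le_of_eq (hb : b = _)))

/-- A graph of period `10 * ζ`. -/
def regular (hζ : 0 < ζ) (hE : E ⊆ {3 * ζ}) : TVG ζ :=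
  triangle ζ hζ (contacts ζ E) (separated_contacts hζ hE)

/-- A periodic graph that agrees with `regular` up to date `τ`; then the edges between `0` and the
other nodes appear simultaneously. -/
def deviating (hζ : 0 < ζ) (hE : E ⊆ {3 * ζ}) (hτ : 0 ≤ τ) : TVG ζ :=
  triangle ζ hζ (fun i => periodize (τ + 10 * ζ) (firstContacts ζ E τ i)) fun i =>
    (separated_firstContacts hζ hE hτ i).periodize (by linarith) fun _ => firstContacts_le hζ

variable {hζ : 0 < ζ} {hE : E ⊆ {3 * ζ}} {hτ : 0 ≤ τ}

theorem regular_isPeriod : (regular hζ hE).IsPeriod (10 * ζ) :=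
  triangle.isPeriod (by linarith)
    (fun _ _ hb => by linarith [(offsets_bounds hζ hE hb).2]) fun _ => rfl

theorem deviating_isPeriod : (deviating hζ hE hτ).IsPeriod (τ + 10 * ζ) :=
  triangle.isPeriod (by linarith) (fun _ _ => firstContacts_le hζ) fun _ => rfl

theorem zero_mem_contacts : (0 : ℝ) ∈ contacts ζ E 1 := subset_periodize (by simp [offsets])

theorem delay_mem_contacts : ζ ∈ contacts ζ E 3 := subset_periodize (by simp [offsets])

theorem regular_connected : (regular hζ hE).footprint.Connected :=
  triangle.connected ⟨0, zero_mem_contacts⟩ ⟨ζ, delay_mem_contacts⟩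

theorem deviating_connected : (deviating hζ hE hτ).footprint.Connected :=
  triangle.connected ⟨_, subset_periodize (Or.inr rfl)⟩ ⟨_, subset_periodize (Or.inr rfl)⟩

theorem exists_contact (hζ : 0 < ζ) (i : ℕ) {t : ℝ} (ht : 0 ≤ t) :
    ∃ d ∈ contacts ζ {3 * ζ} i, t < d ∧ d ≤ t + 13 * ζ := by
  have hne : (offsets ζ {3 * ζ} i).Nonempty := by
    unfold offsets
    split_ifs <;> exact Set.singleton_nonempty _
  obtain ⟨b, hb⟩ := hne
  obtain ⟨h1, h2⟩ := offsets_bounds hζ (Set.Subset.refl _) hb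
  have h3 := Nat.floor_le (div_nonneg ht (by linarith : 0 ≤ 10 * ζ))
  have h4 := Nat.lt_floor_add_one (t / (10 * ζ))
  rw [le_div_iff₀ (by linarith)] at h3
  rw [div_lt_iff₀ (by linarith)] at h4
  refine ⟨b + (⌊t / (10 * ζ)⌋₊ + 1 : ℕ) * (10 * ζ), ⟨b, hb, _, rfl⟩, ?_, ?_⟩
  · push_cast
    linarith
  · push_cast
    linarith

/-- The constant is generous. What matters is that the same bound is correct for `deviating` with
every `τ`, so that knowing it does not tell the graphs apart. -/
theorem regular_recurrenceBound : (regular hζ (Set.Subset.refl {3 * ζ})).RecurrenceBound (100 * ζ) :=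
  triangle.recurrenceBound (by linarith) fun i t ht => by
    obtain ⟨d, hd, h1, h2⟩ := exists_contact hζ i ht
    exact ⟨d, hd, h1, by linarith⟩

theorem deviating_recurrenceBound :
    (deviating hζ (Set.Subset.refl {3 * ζ}) hτ).RecurrenceBound (100 * ζ) := by
  refine triangle.recurrenceBound (by linarith) fun i t ht => ?_
  have key : ∀ t, 0 ≤ t → t ≤ τ → ∃ b ∈ firstContacts ζ {3 * ζ} τ i, t < b ∧ b ≤ t + 18 * ζ := by
    intro t ht htτ
    obtain ⟨d, hd, h1, h2⟩ := exists_contact hζ i ht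
    by_cases hdτ : d ≤ τ
    · exact ⟨d, Or.inl ⟨hd, hdτ⟩, h1, by linarith⟩
    · refine ⟨_, Or.inr rfl, ?_, ?_⟩ <;> split_ifs <;> linarith
  obtain ⟨n, h1, h2⟩ := TVG.exists_sub_mul_mem (p := τ + 10 * ζ) (by linarith) ht
  by_cases hle : t - n * (τ + 10 * ζ) ≤ τ
  · obtain ⟨b, hb, h3, h4⟩ := key _ h1 hle
    exact ⟨_, ⟨b, hb, n, rfl⟩, by linarith, by linarith⟩
  · obtain ⟨b, hb, h3, h4⟩ := key 0 le_rfl hτ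
    refine ⟨_, ⟨b, hb, n + 1, rfl⟩, ?_, ?_⟩
    · push_cast
      linarith
    · push_cast
      linarith

theorem mem_deviating {i : ℕ} {a : ℝ}
    (ha : a ∈ periodize (τ + 10 * ζ) (firstContacts ζ E τ i)) (hζ : 0 < ζ) (hE : E ⊆ {3 * ζ})
    (hτ : 0 ≤ τ) :
    (a ∈ contacts ζ E i ∧ a ≤ τ) ∨ (a = τ + 5 * ζ ∧ i = 3) ∨ (a = τ + 2 * ζ ∧ i ≠ 3) ∨
      τ + 10 * ζ ≤ a := by
  obtain ⟨b, hb, n, rfl⟩ := ha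
  cases n with
  | zero =>
    simp only [Nat.cast_zero, zero_mul, add_zero]
    rcases hb with hb | hb
    · exact Or.inl hb
    · have hb' : b = if i = 3 then τ + 5 * ζ else τ + 2 * ζ := hb
      split_ifs at hb' with h
      · exact Or.inr (Or.inl ⟨hb', h⟩)
      · exact Or.inr (Or.inr (Or.inl ⟨hb', h⟩))
  | succ n =>
    have := (separated_firstContacts hζ hE hτ i).1 b hb
    have h2 : 0 ≤ (n : ℝ) * (τ + 10 * ζ) := by positivity
    refine Or.inr (Or.inr (Or.inr ?_))
    push_cast
    linarith

theorem agree (u v : ℕ) (s : ℝ) (hs : s ≤ τ) :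
    (regular hζ hE).present u v s ↔ (deviating hζ hE hτ).present u v s := by
  refine and_congr_right fun _ => exists_congr fun a => ?_
  constructor
  · rintro ⟨ha, h1, h2⟩
    exact ⟨subset_periodize (Or.inl ⟨ha, h1.trans hs⟩), h1, h2⟩
  · rintro ⟨ha, h1, h2⟩
    rcases mem_deviating ha hζ hE hτ with h | h | h | h
    · exact ⟨h.1, h1, h2⟩
    · linarith
    · linarith
    · linarith

theorem deviating_crossing_late (hζ : 0 < ζ) (hE : E ⊆ {3 * ζ}) (hτ : 0 ≤ τ) {v : ℕ}
    (hv : v = 1 ∨ v = 2) : (deviating hζ hE hτ).Crossing 0 v (τ + 2 * ζ) := by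
  refine triangle.crossing_of_mem (by omega) (subset_periodize (Or.inr ?_))
  rw [if_neg (by omega)]
  rfl

theorem mem_deviating_nodes {v : ℕ} : v ∈ (deviating hζ hE hτ).nodes ↔ v ≤ 2 := triangle.mem_nodes

end Pair

/-! ### Impossibility -/

/-- In `regular` with `E = ∅` the edge `0`–`2` does not exist, and termination must nevertheless be
detected at some date. In `deviating` it is detected at the same date, but there `2` is one hop from
`0` along an edge that has not yet appeared. -/
theorem not_reusable_shortest {ζ : ℝ} (hζ : 0 < ζ) (k : ℕ∞) : ¬ Reusable ζ k .shortest .Pn := by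
  rintro ⟨A, hA⟩
  have hE : (∅ : Set ℝ) ⊆ {3 * ζ} := Set.empty_subset _
  obtain ⟨-, T, t, f, ht0, hj⟩ := hA (regular hζ hE) (.size 3)
    ⟨⟨regular_connected, _, regular_isPeriod⟩, rfl⟩ 0 (triangle.mem_nodes.2 (by norm_num)) 0 le_rfl
  obtain ⟨hb, -, hf, -⟩ := hj 0 (by simp)
  have hτ : 0 ≤ f 0 := by linarith [hb.le]
  obtain ⟨-, T', t', f', ht0', hj'⟩ := hA (deviating hζ hE hτ) (.size 3)
    ⟨⟨deviating_connected, _, deviating_isPeriod⟩, rfl⟩ 0 (triangle.mem_nodes.2 (by norm_num)) 0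
    le_rfl
  obtain ⟨hb', hopt', hf', -⟩ := hj' 0 (by simp)
  have hff : f' 0 = f 0 := by
    refine IsLeast.eq_of_agree (fun s hs => ?_) hf hf'
    rw [ht0, ht0']
    exact and_congr_right fun _ => by rw [view_run_eq_of_agree hζ agree A _ 0 0 0 hs]
  obtain ⟨h, ⟨hh1, hh2⟩, hiter⟩ := hopt' 2 (mem_deviating_nodes.2 le_rfl) (by norm_num)
  have h1 : h ≤ 1 := hh2 ⟨f 0 + 2 * ζ, _, by rw [ht0']; linarith,
    .single (deviating_crossing_late hζ hE hτ (Or.inr rfl))⟩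
  have hT : T' 2 = 0 := by
    interval_cases h
    · simp at hiter
    · simpa using hiter
  obtain ⟨r, hr, -, hd⟩ := hb'.tree 2 (mem_deviating_nodes.2 le_rfl) (by norm_num)
  obtain ⟨hc, -⟩ := delivers_iff.1 hd
  rw [hT] at hc
  rcases mem_deviating (triangle.mem_of_crossing hc).2 hζ hE hτ with h | h | h | h
  · obtain ⟨⟨b, hb, -⟩, -⟩ := h
    simp [offsets] at hb
  · linarith
  · linarith
  · linarith

/-- In `deviating` duration `ζ` is possible, so `0` must reach both other nodes by messages sent at
one and the same date. Before termination this is impossible, because the contacts are still those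
of `regular`. -/
theorem not_reusable_fastest {ζ : ℝ} (hζ : 0 < ζ) (k : ℕ∞) :
    ¬ Reusable ζ k .fastest .PnDelta := by
  rintro ⟨A, hA⟩
  have hE := Set.Subset.refl {3 * ζ}
  obtain ⟨-, T, t, f, ht0, hj⟩ := hA (regular hζ hE) (.sizeBound 3 (100 * ζ))
    ⟨⟨regular_connected, _, regular_isPeriod⟩, _, regular_recurrenceBound, rfl⟩ 0
    (triangle.mem_nodes.2 (by norm_num)) 0 le_rfl
  obtain ⟨hb, -, hf, -⟩ := hj 0 (by simp)
  have hτ : 0 ≤ f 0 := by linarith [hb.le]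
  obtain ⟨-, T', t', f', ht0', hj'⟩ := hA (deviating hζ hE hτ) (.sizeBound 3 (100 * ζ))
    ⟨⟨deviating_connected, _, deviating_isPeriod⟩, _, deviating_recurrenceBound, rfl⟩ 0
    (triangle.mem_nodes.2 (by norm_num)) 0 le_rfl
  obtain ⟨hb', ⟨a, d, hd, ha, hsend, hrec⟩, hf', -⟩ := hj' 0 (by simp)
  have hff : f' 0 = f 0 := by
    refine IsLeast.eq_of_agree (fun s hs => ?_) hf hf'
    rw [ht0, ht0']
    exact and_congr_right fun _ => by rw [view_run_eq_of_agree hζ agree A _ 0 0 0 hs]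
  have hdζ : d ≤ ζ := by
    refine hd.2 ⟨hζ.le, f 0 + 2 * ζ, by linarith, fun v hv hv0 => ?_⟩
    have hv2 := mem_deviating_nodes.1 hv
    exact ⟨_, _, 1, .single (deviating_crossing_late hζ hE hτ (by omega)), le_rfl, le_rfl⟩
  have key : ∀ v, v = 1 ∨ v = 2 → a ∈ contacts ζ {3 * ζ} v := by
    intro v hv
    have hvn : v ∈ (deviating hζ hE hτ).nodes := mem_deviating_nodes.2 (by omega)
    obtain ⟨r, hr, hra⟩ := hrec v hvn (by omega)
    obtain ⟨r', hr', hfr, hdel⟩ := hb'.tree v hvn (by omega)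
    obtain rfl := hr.unique hfr
    obtain ⟨hc, hs⟩ := delivers_iff.1 hdel
    have hu := (hc.edge hζ).mem_left
    have h1 := hsend _ hu _ _ hs
    -- No emission precedes `a` and all receptions occur by `a + ζ`, so the delivering message left
    -- exactly at `a`; its sender cannot have received the information before, hence is `0`.
    obtain rfl : a = r - ζ := by linarith
    rcases hb'.causal _ hu _ _ hs with ⟨h0, -⟩ | ⟨u, q, hq, hdq⟩
    · rw [h0] at hc
      obtain ⟨-, hmem⟩ := triangle.mem_of_crossing hc
      rw [zero_add] at hmem
      rcases mem_deviating hmem hζ hE hτ with h | h | h | h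
      · exact h.1
      · linarith
      · linarith
      · linarith
    · obtain ⟨hc', hs'⟩ := delivers_iff.1 hdq
      linarith [hsend u (hc'.edge hζ).mem_left _ _ hs']
  obtain ⟨b, hb1, n, hn⟩ := key 1 (Or.inl rfl)
  obtain ⟨b', hb2, n', hn'⟩ := key 2 (Or.inr rfl)
  simp only [offsets, if_pos, Set.mem_singleton_iff] at hb1
  simp only [offsets, OfNat.ofNat_ne_one, if_false] at hb2
  norm_num at hb2
  subst hb1 hb2
  have h3 : (n : ℝ) * 10 = 3 + n' * 10 := by
    have : ζ * ((n : ℝ) * 10) = ζ * (3 + n' * 10) := by linarith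
    exact mul_left_cancel₀ hζ.ne' this
  have h4 : n * 10 = 3 + n' * 10 := by exact_mod_cast h3
  omega

/-- A single foremost broadcast is unproblematic; the contradiction lies in the second one. The
first forces the parent of `2` to be `1`, but the second starts at `t 1`, after which `deviating`
offers a direct contact to `2` before `1` meets `2` again. -/
theorem not_reusable_foremost {ζ : ℝ} (hζ : 0 < ζ) {k : ℕ∞} (hk : 1 ≤ k) :
    ¬ Reusable ζ k .foremost .PnDelta := by
  rintro ⟨A, hA⟩
  have hE := Set.Subset.refl {3 * ζ}
  obtain ⟨-, T, t, f, ht0, hj⟩ := hA (regular hζ hE) (.sizeBound 3 (100 * ζ))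
    ⟨⟨regular_connected, _, regular_isPeriod⟩, _, regular_recurrenceBound, rfl⟩ 0
    (triangle.mem_nodes.2 (by norm_num)) 0 le_rfl
  obtain ⟨hb, -, -, -⟩ := hj 0 (by simp)
  obtain ⟨-, -, -, hnext⟩ := hj 1 (by simpa using hk)
  obtain ⟨hft, hbeg, -⟩ := hnext le_rfl
  -- This places the contacts at `0` and `ζ`, which determine the first tree, within the common past
  -- of both graphs.
  have hζτ : ζ ≤ t 1 := by
    obtain ⟨r, hr, -, hd⟩ := hb.tree 1 (triangle.mem_nodes.2 (by norm_num)) (by norm_num)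
    have := (delivers_iff.1 hd).1.nonneg hζ
    simp only [Nat.sub_self] at hft
    linarith
  have hτ : 0 ≤ t 1 := hζ.le.trans hζτ
  obtain ⟨-, T', t', f', ht0', hj'⟩ := hA (deviating hζ hE hτ) (.sizeBound 3 (100 * ζ))
    ⟨⟨deviating_connected, _, deviating_isPeriod⟩, _, deviating_recurrenceBound, rfl⟩ 0
    (triangle.mem_nodes.2 (by norm_num)) 0 le_rfl
  obtain ⟨hb0, hopt0, -, -⟩ := hj' 0 (by simp)
  obtain ⟨hb1, hopt1, -, hnext'⟩ := hj' 1 (by simpa using hk)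
  obtain ⟨-, hbeg', -⟩ := hnext' le_rfl
  have htt : t' 1 = t 1 := by
    refine IsLeast.eq_of_agree (fun s hs => ?_) hbeg hbeg'
    exact and_congr_right fun _ => by rw [view_run_eq_of_agree hζ agree A _ 0 0 0 hs]
  have h2n : 2 ∈ (deviating hζ hE hτ).nodes := mem_deviating_nodes.2 le_rfl
  have hT : T' 2 = 1 := by
    obtain ⟨r, hr, hmin⟩ := hopt0 2 h2n (by norm_num)
    have hr2 : r ≤ ζ + ζ := by
      refine hmin.2 ⟨0, 2, by rw [ht0'], .cons (w := 1) (d := ζ) ?_ (by simp) (.single ?_)⟩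
      · exact triangle.crossing_of_mem (by omega)
          (subset_periodize (Or.inl ⟨zero_mem_contacts, hτ⟩))
      · exact triangle.crossing_of_mem (by omega)
          (subset_periodize (Or.inl ⟨delay_mem_contacts, hζτ⟩))
    obtain ⟨r', -, hfr, hd⟩ := hb0.tree 2 h2n (by norm_num)
    obtain rfl := hr.unique hfr
    obtain ⟨⟨h1, -, h2⟩, hmem⟩ := triangle.mem_of_crossing (delivers_iff.1 hd).1
    by_contra hne
    have h0 : T' 2 = 0 := by omega
    rw [h0, zero_add] at hmem
    rcases mem_deviating hmem hζ hE hτ with ⟨⟨b, hb, n, hn⟩, -⟩ | h | h | h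
    · simp only [offsets, OfNat.ofNat_ne_one, if_false] at hb
      norm_num at hb
      have : 0 ≤ (n : ℝ) * (10 * ζ) := by positivity
      linarith
    · linarith
    · linarith
    · linarith
  obtain ⟨r, hr, hmin⟩ := hopt1 2 h2n (by norm_num)
  have hr3 : r ≤ t 1 + 2 * ζ + ζ :=
    hmin.2 ⟨_, 1, by rw [htt]; linarith, .single (deviating_crossing_late hζ hE hτ (Or.inr rfl))⟩
  obtain ⟨r', -, hfr, hd⟩ := hb1.tree 2 h2n (by norm_num)
  obtain rfl := hr.unique hfr
  rw [hT] at hd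
  obtain ⟨hc, hs⟩ := delivers_iff.1 hd
  -- The only contact of `1` and `2` early enough would have begun by `t 1`, when the second
  -- information cannot yet have reached `1`.
  have hle : r - ζ ≤ t 1 := by
    rcases mem_deviating (triangle.mem_of_crossing hc).2 hζ hE hτ with h | h | h | h
    · exact h.2
    · linarith
    · omega
    · linarith
  rcases hb1.causal 1 (mem_deviating_nodes.2 (by norm_num)) _ _ hs with ⟨h, -⟩ | ⟨u, q, hq, hdq⟩
  · omega
  · obtain ⟨hc', hs'⟩ := delivers_iff.1 hdq
    have := hb1.le_sends hζ (hc'.edge hζ).mem_left hs'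
    rw [htt] at this
    linarith

/-! ### Contexts with less knowledge -/

/-- Nodes may discard part of what they know: each runs the given protocol on its view with the
knowledge replaced by its image under `g`. -/
theorem Reusable.of_knowledge {ζ : ℝ} {k : ℕ∞} {P : Objective} {c c' : Context}
    (g : Knowledge → Knowledge)
    (hg : ∀ (G : TVG ζ) κ, c'.Admits G κ → c.Admits G (g κ)) (h : Reusable ζ k P c) :
    Reusable ζ k P c' := by
  obtain ⟨A, hA⟩ := h
  exact ⟨⟨A.Msg, fun ν => A.send { ν with know := g ν.know },
    fun ν => A.begins { ν with know := g ν.know },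
    fun ν => A.terminated { ν with know := g ν.know }⟩,
    fun G κ hκ x hx t₀ ht₀ => hA G (g κ) (hg G κ hκ) x hx t₀ ht₀⟩

/-- Without knowledge of a period at most as much is possible as in periodic graphs with known
size and recurrence bound. -/
theorem Reusable.to_PnDelta {ζ : ℝ} (hζ : 0 < ζ) {k : ℕ∞} {P : Objective} {c : Context}
    (hc : c ≠ .Pp) (h : Reusable ζ k P c) : Reusable ζ k P .PnDelta := by
  have hB : ∀ {G : TVG ζ}, G.ClassP → G.ClassB := fun h => h.classB hζ
  let toSize : Knowledge → Knowledge := fun κ => match κ with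
    | .sizeBound n _ => .size n
    | κ => κ
  let toBound : Knowledge → Knowledge := fun κ => match κ with
    | .sizeBound _ Δ => .bound Δ
    | κ => κ
  cases c with
  | Rn => exact h.of_knowledge toSize fun G κ ⟨h1, Δ, h2, h3⟩ => h3 ▸ ⟨(hB h1).1, rfl⟩
  | Bn => exact h.of_knowledge toSize fun G κ ⟨h1, Δ, h2, h3⟩ => h3 ▸ ⟨hB h1, rfl⟩
  | Bdelta => exact h.of_knowledge toBound fun G κ ⟨h1, Δ, h2, h3⟩ => h3 ▸ ⟨hB h1, Δ, h2, rfl⟩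
  | BnDelta => exact h.of_knowledge id fun G κ ⟨h1, Δ, h2, h3⟩ => h3 ▸ ⟨hB h1, Δ, h2, rfl⟩
  | Pn => exact h.of_knowledge toSize fun G κ ⟨h1, Δ, h2, h3⟩ => h3 ▸ ⟨h1, rfl⟩
  | Pdelta => exact h.of_knowledge toBound fun G κ ⟨h1, Δ, h2, h3⟩ => h3 ▸ ⟨h1, Δ, h2, rfl⟩
  | PnDelta => exact h
  | Pp => exact absurd rfl hc

/-- Nodes that know only the size can do at most as much as in periodic graphs. -/
theorem Reusable.to_Pn {ζ : ℝ} (hζ : 0 < ζ) {k : ℕ∞} {P : Objective} {c : Context}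
    (hc : c = .Rn ∨ c = .Bn ∨ c = .Pn) (h : Reusable ζ k P c) : Reusable ζ k P .Pn := by
  have hB : ∀ {G : TVG ζ}, G.ClassP → G.ClassB := fun h => h.classB hζ
  rcases hc with rfl | rfl | rfl
  · exact h.of_knowledge (c := .Rn) (c' := .Pn) id fun G κ ⟨h1, h2⟩ => ⟨(hB h1).1, h2⟩
  · exact h.of_knowledge (c := .Bn) (c' := .Pn) id fun G κ ⟨h1, h2⟩ => ⟨hB h1, h2⟩
  · exact h

theorem reusable_shortest_iff {ζ : ℝ} (hζ : 0 < ζ) (k : ℕ∞) (c : Context) :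
    Reusable ζ k .shortest c ↔
      c = .Bdelta ∨ c = .BnDelta ∨ c = .Pdelta ∨ c = .PnDelta ∨ c = .Pp := by
  refine ⟨fun h => ?_, reusable_shortest hζ k⟩
  by_contra hc
  refine not_reusable_shortest hζ k (h.to_Pn hζ ?_)
  cases c <;> simp at hc ⊢

theorem reusable_foremost_iff {ζ : ℝ} (hζ : 0 < ζ) {k : ℕ∞} (hk : 1 ≤ k) (c : Context) :
    Reusable ζ k .foremost c ↔ c = .Pp := by
  refine ⟨fun h => ?_, fun h => h ▸ reusable_of_period hζ k _⟩
  by_contra hc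
  exact not_reusable_foremost hζ hk (h.to_PnDelta hζ hc)

theorem reusable_fastest_iff {ζ : ℝ} (hζ : 0 < ζ) (k : ℕ∞) (c : Context) :
    Reusable ζ k .fastest c ↔ c = .Pp := by
  refine ⟨fun h => ?_, fun h => h ▸ reusable_of_period hζ k _⟩
  by_contra hc
  exact not_reusable_fastest hζ k (h.to_PnDelta hζ hc)

end DynNet

theorem mainTheorem3 (ζ : ℝ) (hζ : 0 < ζ) (k : ℕ∞) (hk : 1 ≤ k) :
    DynNet.ReuseLT ζ k DynNet.universeU .shortest .foremost ∧
    DynNet.ReuseEquiv ζ k DynNet.universeU .foremost .fastest ∧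
    (∀ c ∈ DynNet.universeU, DynNet.Reusable ζ k .shortest c ↔
      c = .Bdelta ∨ c = .BnDelta ∨ c = .Pdelta ∨ c = .PnDelta ∨ c = .Pp) ∧
    (∀ c ∈ DynNet.universeU, DynNet.Reusable ζ k .foremost c ↔ c = .Pp) ∧
    (∀ c ∈ DynNet.universeU, DynNet.Reusable ζ k .fastest c ↔ c = .Pp) := by
  have hs := DynNet.reusable_shortest_iff hζ k
  have hfo := DynNet.reusable_foremost_iff hζ hk
  have hfa := DynNet.reusable_fastest_iff hζ k
  refine ⟨⟨fun c _ h => ?_, .Bdelta, trivial, (hs _).2 (Or.inl rfl), fun h => ?_⟩,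
    ⟨fun c _ h => (hfo c).2 ((hfa c).1 h), fun c _ h => (hfa c).2 ((hfo c).1 h)⟩,
    fun c _ => hs c, fun c _ => hfo c, fun c _ => hfa c⟩
  · simp [hs, (hfo c).1 h]
  · simpa using (hfo _).1 h
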